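/- **Theorem (local Plücker formulas for $SO(2n,\mathbb C)$).** Let $n\ge 2$ and let $V=\mathbb C^{2n}$ have the basis $e_1,\dots,e_n,f_1,\dots,f_n$ and the symmetric bilinear form $Q$ with $Q(e_i,f_i)=Q(f_i,e_i)=1$ and all other products of basis vectors equal to $0$. Let $G=SO(2n,\mathbb C)=SO(V,Q)$, let $B\subset G$ be the stabilizer of the isotropic flag $\langle e_1\rangle\subset\langle e_1,e_2\rangle\subset\dots\subset\langle e_1,\dots,e_n\rangle$, let $\mathfrak g,\mathfrak b$ be the Lie algebras of $G,B$, and let $\mathcal N$ be the $G$-invariant distribution on $G/B$ whose value at the base point is $\{x\in\mathfrak g:[x,[\mathfrak b,\mathfrak b]]\subset\mathfrak b\}/\mathfrak b\subset\mathfrak g/\mathfrak b$. Let $V_i=\bigwedge^iV$ with highest weight vector $v_i=e_1\wedge\dots\wedge e_i$ for $1\le i\le n-2$. Let $V_{n-1}$ and $V_n$ be the half-spin representations, realised in $\bigwedge^\bullet\langle e_1,\dots,e_n\rangle$ (where $e_i$ acts by wedge product and $f_i$ by contraction), with highest weight vectors $v_{n-1}=v_-=e_1\wedge\dots\wedge e_{n-1}$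 and $v_n=v_+=e_1\wedge\dots\wedge e_n$. Let $\pi_i:G/B\to\mathbb P(V_i)$, $[g]\mapsto[g\,v_i]$ (for $i=n-1,n$, through any preimage of $g$ in the spin group). Equip $V_i$, and each $\bigwedge^kV$, with the Hermitian product for which the wedge products of basis vectors are orthonormal; it is invariant under the compact form of $G$. Let $FS=\frac{i}{2\pi}\partial\bar\partial\log\|Z\|^2$ be the corresponding Fubini–Study form. Let $S$ be a Riemann surface and $f:S\to G/B$ a holomorphic integral curve of $\mathcal N$. Put $\varphi_i=f^*\pi_i^*(FS)$, $\varphi_-=\varphi_{n-1}$, $\varphi_+=\varphi_n$. Where $\varphi_i\neq0$ it is the $(1,1)$-form of a Hermitian metric; if $\varphi_i=\frac{i}{2\pi}h_i\,dz\wedge d\bar z$ in a local holomorphic coordinate, its curvature form is $\theta_i=-\frac{i}{2\pi}\partial\bar\partial\log h_i$; put $\theta_-=\theta_{n-1}$, $\theta_+=\theta_n$. 1. The vector of curvature forms is the Cartan matrix $A$ of type $D_n$ times the vector of metrics: $\theta=A\varphi$, that is, $\theta_i=\sum_jA_{ij}\varphi_j$ at every point where $\varphi_i\ne0$. (For $n=2$,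 $A=\mathrm{diag}(2,2)$.) 2. These formulas are pullbacks of the formulas of type $A_{2n-1}$. Let $i_\pm:G/B\to Fl(V)$ send $[g]$ to the complete flag spanned by the successive vectors of $ge_1,\dots,ge_n,gf_n,gf_{n-1},\dots,gf_1$ (sign $+$), respectively of $ge_1,\dots,ge_{n-1},gf_n,ge_n,gf_{n-1},\dots,gf_1$ (sign $-$). For $1\le k\le 2n-1$ let $\widehat\phi_k$ be the pullback to $Fl(V)$ of the Fubini–Study form on $\mathbb P(\bigwedge^kV)$ by the Plücker map $F_\bullet\mapsto[\bigwedge^kF_k]$, and let $\widehat\vartheta_k$ be the curvature form $-\frac{i}{2\pi}\partial\bar\partial\log\|l\|^2$ ($l$ a local nowhere zero holomorphic section) of the line bundle $\mathrm{Hom}(F_k/F_{k-1},F_{k+1}/F_k)$ with the metric induced from $V$. Then, for both signs: * $(i_\pm f)^*\widehat\vartheta_k=\sum_jC_{kj}\,(i_\pm f)^*\widehat\phi_j$ for all $k$, where $C$ is the Cartan matrix of type $A_{2n-1}$; * $(i_\pm f)^*\widehat\phi_k=\varphi_k$ for $k\le n-2$, $\ (i_\pm f)^*\widehat\phi_{n-1}=\varphi_++\varphi_-$,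 $\ (i_\pm f)^*\widehat\phi_n=2\varphi_\pm$; * $(i_\pm f)^*\widehat\vartheta_k=\theta_k$ for $k\le n-2$ and $(i_\pm f)^*\widehat\vartheta_{n-1}=\theta_\mp$, at every point where the metric whose curvature stands on the right-hand side is non-zero. -/

import Mathlib

open scoped Manifold ContDiff LinearAlgebra.Projectivization

noncomputable section

namespace SOPlucker

attribute [local instance] LieRing.ofAssociativeRing

/-! ### The quadratic space, the group `SO(2n, ℂ)`, its Borel subgroup and Lie algebra -/

/-- The index set of the basis `e₁, …, eₙ, f₁, …, fₙ`: `Sum.inl i` stands for `e_i`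
and `Sum.inr i` for `f_i` (indices start at `0`). -/
abbrev Idx (n : ℕ) : Type := Fin n ⊕ Fin n

/-- The space `V = ℂ^{2n}`. -/
abbrev V (n : ℕ) : Type := Idx n → ℂ

/-- The basis vector of `V` with a given index. -/
abbrev stdVec (n : ℕ) (a : Idx n) : V n := Pi.single a 1

/-- Gram matrix of the symmetric form: `Q(e_i, f_i) = Q(f_i, e_i) = 1`,
all other products of basis vectors vanish. -/
abbrev gram (n : ℕ) : Matrix (Idx n) (Idx n) ℂ := LieAlgebra.Orthogonal.JD (Fin n) ℂ

/-- The group `G = SO(2n, ℂ)` of matrices of determinant one preserving `Q`. -/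
def SO (n : ℕ) : Subgroup (Matrix.SpecialLinearGroup (Idx n) ℂ) where
  carrier := {g | (g : Matrix (Idx n) (Idx n) ℂ).transpose * gram n *
    (g : Matrix (Idx n) (Idx n) ℂ) = gram n}
  one_mem' := by simp
  mul_mem' := by
    intro a b ha hb
    simp only [Set.mem_ofPred_eq, Matrix.SpecialLinearGroup.coe_mul, Matrix.transpose_mul] at *
    calc _ = (b : Matrix (Idx n) (Idx n) ℂ).transpose *
          ((a : Matrix (Idx n) (Idx n) ℂ).transpose * gram n * (a : Matrix (Idx n) (Idx n) ℂ)) *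
          (b : Matrix (Idx n) (Idx n) ℂ) := by simp only [Matrix.mul_assoc]
      _ = _ := by rw [ha, hb]
  inv_mem' := by
    intro a ha
    simp only [Set.mem_ofPred_eq] at *
    have h1 : (a : Matrix (Idx n) (Idx n) ℂ) *
        ((a⁻¹ : Matrix.SpecialLinearGroup (Idx n) ℂ) : Matrix (Idx n) (Idx n) ℂ) = 1 := by
      rw [← Matrix.SpecialLinearGroup.coe_mul, mul_inv_cancel,
        Matrix.SpecialLinearGroup.coe_one]
    generalize ((a⁻¹ : Matrix.SpecialLinearGroup (Idx n) ℂ) : Matrix (Idx n) (Idx n) ℂ) = c at h1 ⊢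
    calc c.transpose * gram n * c
        = c.transpose * ((a : Matrix (Idx n) (Idx n) ℂ).transpose * gram n *
          (a : Matrix (Idx n) (Idx n) ℂ)) * c := by rw [ha]
      _ = ((a : Matrix (Idx n) (Idx n) ℂ) * c).transpose * gram n *
          ((a : Matrix (Idx n) (Idx n) ℂ) * c) := by
            simp only [Matrix.transpose_mul, Matrix.mul_assoc]
      _ = gram n := by simp [h1]

/-- The matrix of an element of `SO(2n, ℂ)`. -/
abbrev mat {n : ℕ} (g : SO n) : Matrix (Idx n) (Idx n) ℂ := g.1.1

/-- The linear automorphism of `V` given by `g`. -/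
abbrev act {n : ℕ} (g : SO n) : V n →ₗ[ℂ] V n := Matrix.toLin' (mat g)

lemma act_mul {n : ℕ} (g h : SO n) : act (g * h) = act g ∘ₗ act h := by
  simp [act, mat, Matrix.toLin'_mul]

lemma act_one {n : ℕ} : act (1 : SO n) = LinearMap.id := by
  simp [act, mat]

lemma act_injective {n : ℕ} (g : SO n) : Function.Injective (act g) := by
  have h : act g⁻¹ ∘ₗ act g = LinearMap.id := by rw [← act_mul, inv_mul_cancel, act_one]
  exact Function.LeftInverse.injective (g := act g⁻¹) fun x => LinearMap.congr_fun h x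

/-- The `k`-th term `⟨e₁, …, e_k⟩` of the standard maximal isotropic flag (`k ≤ n`). -/
def isoFlag (n k : ℕ) : Submodule ℂ (V n) :=
  Submodule.span ℂ {v | ∃ i : Fin n, i.1 < k ∧ v = stdVec n (Sum.inl i)}

/-- The Borel subgroup `B`: the stabilizer in `SO(2n, ℂ)` of the standard maximal isotropic
flag. -/
def borel (n : ℕ) : Subgroup (SO n) where
  carrier := {g | ∀ k : ℕ, (isoFlag n k).map (act g) = isoFlag n k}
  one_mem' := by
    intro k
    rw [act_one, Submodule.map_id]
  mul_mem' := by
    intro a b ha hb k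
    rw [act_mul, Submodule.map_comp, hb k, ha k]
  inv_mem' := by
    intro a ha k
    have h : act a⁻¹ ∘ₗ act a = LinearMap.id := by rw [← act_mul, inv_mul_cancel, act_one]
    conv_lhs => rw [← ha k]
    rw [← Submodule.map_comp, h, Submodule.map_id]

/-- The Lie algebra `𝔤 = 𝔰𝔬(2n, ℂ)`. -/
abbrev so (n : ℕ) : LieSubalgebra ℂ (Matrix (Idx n) (Idx n) ℂ) :=
  LieAlgebra.Orthogonal.typeD (Fin n) ℂ

/-- The Lie algebra `𝔟` of `B`. -/
def borelAlgebra (n : ℕ) : LieSubalgebra ℂ (so n) where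
  carrier := {x | ∀ k : ℕ, ∀ v ∈ isoFlag n k, x.1.mulVec v ∈ isoFlag n k}
  zero_mem' := by
    intro k v _
    simp
  add_mem' := by
    intro x y hx hy k v hv
    simpa [Matrix.add_mulVec] using add_mem (hx k v hv) (hy k v hv)
  smul_mem' := by
    intro c x hx k v hv
    simpa [Matrix.smul_mulVec] using Submodule.smul_mem _ c (hx k v hv)
  lie_mem' := by
    intro x y hx hy k v hv
    have h : ((⁅x, y⁆ : so n) : Matrix (Idx n) (Idx n) ℂ).mulVec v
        = x.1.mulVec (y.1.mulVec v) - y.1.mulVec (x.1.mulVec v) := by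
      rw [LieSubalgebra.coe_bracket, Ring.lie_def, Matrix.sub_mulVec, Matrix.mulVec_mulVec,
        Matrix.mulVec_mulVec]
    rw [h]
    exact sub_mem (hx k _ (hy k v hv)) (hy k _ (hx k v hv))

/-- The derived algebra `[𝔟, 𝔟]`. -/
def borelDerived (n : ℕ) : Submodule ℂ (so n) :=
  Submodule.span ℂ {y | ∃ a ∈ borelAlgebra n, ∃ b ∈ borelAlgebra n, y = ⁅a, b⁆}

/-- The subspace `{x ∈ 𝔤 | [x, [𝔟, 𝔟]] ⊆ 𝔟}`; its quotient by `𝔟` is the value of the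
distribution `𝒩` at the base point of `G/B`. -/
def distr (n : ℕ) : Set (so n) :=
  {x | ∀ y ∈ borelDerived n, ⁅x, y⁆ ∈ borelAlgebra n}

/-! ### Curves in `G/B` -/

section Curves

variable {S : Type*} [TopologicalSpace S] [ChartedSpace ℂ S]

/-- `g` is a holomorphic lift to `G` over the open set `U` of the curve `f : S → G/B`. -/
structure IsLift {n : ℕ} (f : S → SO n ⧸ borel n) (U : Set S) (g : S → SO n) : Prop where
  isOpen : IsOpen U
  lifts : ∀ p ∈ U, (QuotientGroup.mk (g p) : SO n ⧸ borel n) = f p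
  holomorphic : ∀ a b : Idx n,
    MDifferentiableOn 𝓘(ℂ, ℂ) 𝓘(ℂ, ℂ) (fun p => mat (g p) a b) U

/-- A curve in `G/B` is holomorphic if locally it is the projection of a holomorphic map to `G`
(the projection `G → G/B` is a holomorphic submersion, so it has local holomorphic sections). -/
def IsHolomorphicCurve {n : ℕ} (f : S → SO n ⧸ borel n) : Prop :=
  ∀ p : S, ∃ U : Set S, p ∈ U ∧ ∃ g : S → SO n, IsLift f U g

/-- The derivative, in the local coordinate `e`, of a matrix-valued function at the point
with coordinate `z`. -/
def matDeriv {n : ℕ} (g : S → SO n) (e : OpenPartialHomeomorph S ℂ) (z : ℂ) :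
    Matrix (Idx n) (Idx n) ℂ :=
  Matrix.of fun a b => deriv (fun w => mat (g (e.symm w)) a b) z

/-- The curve `f` is tangent to `𝒩`. The tangent space of `G/B` at `[g]` is `𝔤/𝔟` by left
translation, `𝒩` is the `G`-invariant distribution, and the velocity of `[g(z)]` is the class
of `g(z)⁻¹ g'(z)`. -/
def IsIntegralCurve {n : ℕ} (f : S → SO n ⧸ borel n) : Prop :=
  ∀ (U : Set S) (g : S → SO n), IsLift f U g →
    ∀ e ∈ IsManifold.maximalAtlas 𝓘(ℂ, ℂ) ω S, ∀ z ∈ e.target, e.symm z ∈ U →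
      ∃ x ∈ distr n, matDeriv g e z = mat (g (e.symm z)) * (x : Matrix (Idx n) (Idx n) ℂ)

end Curves

/-! ### Forms of type `(1,1)` on a Riemann surface

A `(1,1)`-form on `S` is described by its coefficients in the local holomorphic coordinates of `S`:
in the coordinate `z` given by a chart `e`, the form with coefficient `h` is
`(i/2π) h(z) dz ∧ dz̄`. -/

/-- The coefficient `∂²u/∂z∂z̄ = (1/4) Δu` of `∂∂̄u`. -/
def ddbar (u : ℂ → ℝ) (z : ℂ) : ℝ := Laplacian.laplacian u z / 4

/-- The curvature form of a metric whose associated `(1,1)`-form is `(i/2π) h dz ∧ dz̄` is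
`-(i/2π) ∂∂̄ log h`; this is its coefficient. It is meaningful where `h ≠ 0`. -/
def curvatureCoeff (h : ℂ → ℝ) (z : ℂ) : ℝ := -ddbar (fun w => Real.log (h w)) z

section FubiniStudy

variable {ι : Type*} [Fintype ι] {E : Type*} [AddCommGroup E] [Module ℂ E]

/-- The Hermitian inner product for which the basis `b` is orthonormal. -/
def hermInner (b : Module.Basis ι ℂ E) (x y : E) : ℂ :=
  ∑ i, (starRingEnd ℂ) (b.repr x i) * b.repr y i

/-- Its squared norm. -/
def hermNormSq (b : Module.Basis ι ℂ E) (x : E) : ℝ := ∑ i, ‖b.repr x i‖ ^ 2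

/-- The Fubini-Study Kähler potential `log ‖Z‖²` on the affine chart
`{[Z] : ⟨Z₀, Z⟩ ≠ 0}` of `ℙ(E)` around `[Z₀]`, where `Z` is the holomorphic representative
normalised by `⟨Z₀, Z⟩ = 1`. -/
def fsPotential (b : Module.Basis ι ℂ E) (x₀ x : ℙ ℂ E) : ℝ :=
  Real.log (hermNormSq b ((hermInner b x₀.rep x.rep)⁻¹ • x.rep))

/-- The coefficient, in the coordinate `e`, of the pullback of the Fubini-Study form
`(i/2π) ∂∂̄ log ‖Z‖²` along the curve `F : S → ℙ(E)`. -/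
def fsPullback {S : Type*} [TopologicalSpace S] (b : Module.Basis ι ℂ E) (F : S → ℙ ℂ E)
    (e : OpenPartialHomeomorph S ℂ) (z : ℂ) : ℝ :=
  ddbar (fun w => fsPotential b (F (e.symm z)) (F (e.symm w))) z

end FubiniStudy

/-! ### The maps to the projectivized exterior powers of `V` -/

/-- The basis `e₁, …, eₙ, f₁, …, fₙ`, indexed by a linear order. -/
def stdBasis (n : ℕ) : Module.Basis (Fin (n + n)) ℂ (V n) :=
  (Pi.basisFun ℂ (Idx n)).reindex finSumFinEquiv

/-- The basis of `⋀^k V` formed by the wedge products of the vectors of the standard basis. The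
Hermitian product for which it is orthonormal is invariant under the compact form
`K = SO(2n, ℂ) ∩ U(2n)`. -/
abbrev wedgeBasis (n k : ℕ) : Module.Basis (Set.powersetCard (Fin (n + n)) k) ℂ (⋀[ℂ]^k (V n)) :=
  (stdBasis n).exteriorPower k

/-- The wedge product of the standard basis vectors with indices `c 0, …, c (k-1)`. -/
def wedgeVec (n : ℕ) {k : ℕ} (c : Fin k → Idx n) : ⋀[ℂ]^k (V n) :=
  exteriorPower.ιMulti ℂ k fun j => stdVec n (c j)

lemma wedgeVec_ne_zero (n : ℕ) {k : ℕ} (c : Fin k → Idx n) (hc : Function.Injective c) :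
    wedgeVec n c ≠ 0 := by
  intro h
  have h1 : LinearIndependent ℂ (fun j => stdVec n (c j)) := by
    have := (Pi.basisFun ℂ (Idx n)).linearIndependent.comp c hc
    convert this using 2
    simp
  have h2 := exteriorPower.ιMulti_family_linearIndependent_field (n := k) h1
  refine h2.ne_zero (Set.powersetCard.ofFinEmbEquiv (RelEmbedding.refl _)) ?_
  rw [exteriorPower.ιMulti_family, Equiv.symm_apply_apply]
  exact h

/-- The map `G/B → ℙ(⋀^k V)`, `[g] ↦ [g u₁ ∧ ⋯ ∧ g u_k]`, where `u_j` is the standard basis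
vector with index `c j`. It is used only when `⟨u₁, …, u_k⟩` is stable under `B`, so that the
choice of the representative `g` of a coset is irrelevant. -/
def wedgeOrbit (n : ℕ) {k : ℕ} (c : Fin k → Idx n) (hc : Function.Injective c)
    (x : SO n ⧸ borel n) : ℙ ℂ (⋀[ℂ]^k (V n)) :=
  Projectivization.map (exteriorPower.map k (act x.out))
    (exteriorPower.map_injective_field (act_injective x.out))
    (Projectivization.mk ℂ (wedgeVec n c) (wedgeVec_ne_zero n c hc))

/-! ### The half-spin representations -/

/-- The quadratic form `v ↦ Q(v, v) / 2`, so that `v w + w v = Q(v, w)` in its Clifford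
algebra. -/
def quad (n : ℕ) : QuadraticForm ℂ (V n) :=
  (1 / 2 : ℂ) • (Matrix.toBilin' (gram n)).toQuadraticMap

lemma quad_apply (n : ℕ) (v : V n) : quad n v = ∑ i, v (Sum.inl i) * v (Sum.inr i) := by
  have h : (Matrix.toBilin' (gram n)) v v = 2 * ∑ i, v (Sum.inl i) * v (Sum.inr i) := by
    rw [Matrix.toBilin'_apply', dotProduct, Fintype.sum_sum_type, two_mul]
    congr 1
    · refine Finset.sum_congr rfl fun i _ => ?_
      simp [gram, LieAlgebra.Orthogonal.JD, Matrix.fromBlocks_mulVec]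
    · refine Finset.sum_congr rfl fun i _ => ?_
      simp [gram, LieAlgebra.Orthogonal.JD, Matrix.fromBlocks_mulVec, mul_comm]
  simp [quad, h]

/-- The exterior algebra `⋀ W` of `W = ⟨e₁, …, eₙ⟩ ≅ ℂⁿ`. The half-spin spaces `S_±` are its
even and odd parts. -/
abbrev Spinors (n : ℕ) : Type := ExteriorAlgebra ℂ (Fin n → ℂ)

/-- Clifford multiplication on `⋀ W`: a vector of `W` acts by the wedge product, a vector of
`W' = ⟨f₁, …, fₙ⟩ ≅ W^*` by contraction. -/
def cliffordMul (n : ℕ) : V n →ₗ[ℂ] Module.End ℂ (Spinors n) :=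
  (LinearMap.mul ℂ (Spinors n)) ∘ₗ (ExteriorAlgebra.ι ℂ) ∘ₗ
      (LinearMap.funLeft ℂ ℂ (Sum.inl : Fin n → Idx n)) +
    CliffordAlgebra.contractLeft ∘ₗ (Pi.basisFun ℂ (Fin n)).toDual ∘ₗ
      (LinearMap.funLeft ℂ ℂ (Sum.inr : Fin n → Idx n))

lemma cliffordMul_sq (n : ℕ) (v : V n) :
    cliffordMul n v * cliffordMul n v = algebraMap ℂ _ (quad n v) := by
  refine LinearMap.ext fun x => ?_
  have h1 : ∀ y : Spinors n, cliffordMul n v y =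
      ExteriorAlgebra.ι ℂ (fun i => v (Sum.inl i)) * y +
        CliffordAlgebra.contractLeft
          ((Pi.basisFun ℂ (Fin n)).toDual (fun i => v (Sum.inr i))) y := fun y => rfl
  have h2 : (Pi.basisFun ℂ (Fin n)).toDual (fun i => v (Sum.inr i)) (fun i => v (Sum.inl i))
      = quad n v := by
    rw [quad_apply]
    have h3 : (fun i => v (Sum.inl i)) =
        ∑ i, v (Sum.inl i) • (Pi.basisFun ℂ (Fin n)) i := by
      ext i
      simp [Pi.single_apply]
    rw [h3, map_sum]
    refine Finset.sum_congr rfl fun i _ => ?_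
    rw [map_smul, Module.Basis.toDual_apply_left]
    simp
  rw [Module.End.mul_apply, h1, h1, map_add, CliffordAlgebra.contractLeft_contractLeft, mul_add,
    CliffordAlgebra.contractLeft_ι_mul, h2, ← mul_assoc, ExteriorAlgebra.ι_sq_zero]
  simp [Module.algebraMap_end_apply]

/-- The spin module: the action of the Clifford algebra on `⋀ W`. -/
def spinModule (n : ℕ) : CliffordAlgebra (quad n) →ₐ[ℂ] Module.End ℂ (Spinors n) :=
  CliffordAlgebra.lift (quad n) ⟨cliffordMul n, cliffordMul_sq n⟩

/-- The element `s` of the spin group lies over `g ∈ SO(2n, ℂ)`: `s v s⁻¹ = g v` for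
`v ∈ V`. -/
def Covers {n : ℕ} (s : spinGroup (quad n)) (g : SO n) : Prop :=
  ∀ v : V n, (s : CliffordAlgebra (quad n)) * CliffordAlgebra.ι (quad n) v =
    CliffordAlgebra.ι (quad n) (act g v) * (s : CliffordAlgebra (quad n))

/-- An element of the spin group over `g`; it exists because `Spin(2n, ℂ) → SO(2n, ℂ)` is
surjective, and it is unique up to sign. -/
def spinLift {n : ℕ} (g : SO n) : spinGroup (quad n) :=
  Classical.epsilon fun s => Covers s g

/-- The basis of `⋀ W` of wedge products of `e₁, …, eₙ`. For the Hermitian product making it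
orthonormal, contraction with `f_i` is adjoint to the wedge product with `e_i`; hence the product
is invariant under the preimage in the spin group of the compact form
`K = SO(2n, ℂ) ∩ U(2n)`. -/
abbrev spinBasis (n : ℕ) : Module.Basis (Finset (Fin n)) ℂ (Spinors n) :=
  (Pi.basisFun ℂ (Fin n)).ExteriorAlgebra

/-- The highest weight vectors of the half-spin representations: `v₊ = e₁ ∧ ⋯ ∧ eₙ`
(for `true`), of weight `(L₁ + ⋯ + Lₙ)/2`, and `v₋ = e₁ ∧ ⋯ ∧ eₙ₋₁` (for `false`),
of weight `(L₁ + ⋯ + Lₙ₋₁ - Lₙ)/2`. -/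
def spinVec (n : ℕ) : Bool → Spinors n
  | true => spinBasis n Finset.univ
  | false => spinBasis n (Finset.univ.filter fun i => i.1 + 1 < n)

lemma spinVec_ne_zero (n : ℕ) (ε : Bool) : spinVec n ε ≠ 0 := by
  cases ε <;> exact (spinBasis n).ne_zero _

lemma spinModule_injective {n : ℕ} (s : spinGroup (quad n)) :
    Function.Injective (spinModule n (s : CliffordAlgebra (quad n))) := by
  have h : spinModule n (star (s : CliffordAlgebra (quad n))) *
      spinModule n (s : CliffordAlgebra (quad n)) = 1 := by
    rw [← map_mul, spinGroup.coe_star_mul_self, map_one]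
  exact Function.LeftInverse.injective
    (g := spinModule n (star (s : CliffordAlgebra (quad n))))
    fun x => LinearMap.congr_fun h x

/-- The maps `π_± : G/B → ℙ(S_±)`, `[g] ↦ [g v_±]`, followed by the inclusion of `ℙ(S_±)` in
`ℙ(⋀ W)`. Since `B` acts on the line of `v_±`, the choice of the representative of a coset is
irrelevant. -/
def spinOrbit (n : ℕ) (ε : Bool) (x : SO n ⧸ borel n) : ℙ ℂ (Spinors n) :=
  Projectivization.map (spinModule n (spinLift x.out : CliffordAlgebra (quad n)))
    (spinModule_injective (spinLift x.out))
    (Projectivization.mk ℂ (spinVec n ε) (spinVec_ne_zero n ε))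

/-! ### Metrics and curvatures of a curve in `G/B` -/

section Metrics

variable {S : Type*} [TopologicalSpace S]

/-- The coefficient of the metric `φ_{i+1} = f^* π_{i+1}^*(FS)` on the curve, `0 ≤ i < n`. For
`i + 1 ≤ n - 2` the fundamental representation is `⋀^{i+1} V` with highest weight vector
`e₁ ∧ ⋯ ∧ e_{i+1}`; the last two are the half-spin representations: `π_{n-1} = π₋`,
`π_n = π₊`. -/
def metric {n : ℕ} (f : S → SO n ⧸ borel n) (e : OpenPartialHomeomorph S ℂ) (i : Fin n) :
    ℂ → ℝ :=
  if i.1 + 2 < n then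
    fsPullback (wedgeBasis n (i.1 + 1))
      (fun p => wedgeOrbit n (fun j : Fin (i.1 + 1) => Sum.inl (Fin.castLE i.2 j))
        (Sum.inl_injective.comp (Fin.castLE_injective i.2)) (f p)) e
  else if i.1 + 1 < n then
    fsPullback (spinBasis n) (fun p => spinOrbit n false (f p)) e
  else
    fsPullback (spinBasis n) (fun p => spinOrbit n true (f p)) e

/-- The coefficient of the curvature form `θ_{i+1}` of the metric `φ_{i+1}`. -/
def curvature {n : ℕ} (f : S → SO n ⧸ borel n) (e : OpenPartialHomeomorph S ℂ) (i : Fin n) :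
    ℂ → ℝ :=
  curvatureCoeff (metric f e i)

end Metrics

/-! ### The embeddings `i_± : G/B → Fl(V)` and the pulled back objects of `Fl(V)`

The complete flags `i_±([g])` are spanned by the successive vectors of the bases
`g e₁, …, g eₙ, g fₙ, g fₙ₋₁, …, g f₁` (sign `+`, `true`) and
`g e₁, …, g eₙ₋₁, g fₙ, g eₙ, g fₙ₋₁, …, g f₁` (sign `-`, `false`) of `V`; the terms of dimension
more than `n` are the orthogonal complements of those of dimension less than `n`. -/

/-- The exchange of the indices of `eₙ` and `fₙ`. -/
def swapLast (n : ℕ) : Equiv.Perm (Idx n) :=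
  Function.Involutive.toPerm
    (fun a => match a with
      | Sum.inl i => if i.1 + 1 = n then Sum.inr i else Sum.inl i
      | Sum.inr i => if i.1 + 1 = n then Sum.inl i else Sum.inr i)
    (by
      rintro (i | i) <;> by_cases h : i.1 + 1 = n <;> simp [h])

/-- The order in which the standard basis vectors are adapted to the base flag of `i_±`. -/
def flagIdx (n : ℕ) : Bool → Fin (n + n) ≃ Idx n
  | true => finSumFinEquiv.symm.trans (Equiv.sumCongr (Equiv.refl _) Fin.revPerm)
  | false => (finSumFinEquiv.symm.trans (Equiv.sumCongr (Equiv.refl _) Fin.revPerm)).trans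
      (swapLast n)

section Flags

variable {S : Type*} [TopologicalSpace S]

/-- The coefficient of `(i_± ∘ f)^* φ̂_k`, `1 ≤ k ≤ 2n - 1`, where `φ̂_k` is the pullback to
`Fl(V)` of the Fubini-Study form by the Plücker embedding `Fl(V) → Gr(k, 2n) → ℙ(⋀^k V)`. -/
def flagMetric {n : ℕ} (ε : Bool) (f : S → SO n ⧸ borel n) (e : OpenPartialHomeomorph S ℂ)
    (k : ℕ) (hk : k ≤ n + n) : ℂ → ℝ :=
  fsPullback (wedgeBasis n k)
    (fun p => wedgeOrbit n (fun j : Fin k => flagIdx n ε (Fin.castLE hk j))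
      ((flagIdx n ε).injective.comp (Fin.castLE_injective hk)) (f p)) e

/-- The Hermitian norm of the class of `g u_{j+1}` in the quotient `F_{j+1}/F_j` of the flag
`F = i_±([g])` with adapted basis `g u₁, …, g u_{2n}`: the distance of `g u_{j+1}` to
`F_j`. -/
def quotientNorm {n : ℕ} (ε : Bool) (g : SO n) (j : Fin (n + n)) : ℝ :=
  Metric.infDist (WithLp.toLp 2 (act g (stdVec n (flagIdx n ε j))) : EuclideanSpace ℂ (Idx n))
    (Submodule.span ℂ {v : EuclideanSpace ℂ (Idx n) | ∃ i : Fin (n + n), i < j ∧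
      v = WithLp.toLp 2 (act g (stdVec n (flagIdx n ε i)))} : Set (EuclideanSpace ℂ (Idx n)))

/-- The coefficient of `(i_± ∘ f)^* ϑ̂_k`, computed with a holomorphic lift `g` of `f`. Here
`ϑ̂_k` is the curvature form of the line bundle `𝒩_k = Hom(F_k/F_{k-1}, F_{k+1}/F_k)` on `Fl(V)`
with its metric induced from `V`: it is `-(i/2π) ∂∂̄ log ‖l‖²`, where `l` is the nowhere zero
holomorphic section that sends `g u_k` to `g u_{k+1}`. -/
def flagCurvature {n : ℕ} (ε : Bool) (g : S → SO n) (e : OpenPartialHomeomorph S ℂ)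
    (k : ℕ) (hk1 : 1 ≤ k) (hk : k < n + n) (z : ℂ) : ℝ :=
  -ddbar (fun w => Real.log
    ((quotientNorm ε (g (e.symm w)) ⟨k, hk⟩ /
      quotientNorm ε (g (e.symm w)) ⟨k - 1, by omega⟩) ^ 2)) z

end Flags

end SOPlucker

end

/-! Near a point the curve lifts to a holomorphic matrix g. Put H = gᴴ g and let D_k be the Gram
determinant of the first k vectors of the basis adapted to i_±. Everything is read off from the
functions log D_k.

Type A. By Cauchy-Binet D_k is the squared norm of the k-th Plücker vector, so (i_± f)^*φ̂_k has
coefficient ∂∂̄ log D_k (`flagMetric_eq`). By Gram-Schmidt the section l of Hom(F_k/F_{k-1},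
F_{k+1}/F_k) has squared norm D_{k+1} D_{k-1} / D_k² (`quotientNorm_sq`), whose logarithm is a row
of the Cartan matrix applied to the log D_j (`flagCurvature_eq`). This part holds for every
holomorphic curve.

Type D, k ≤ n-2. Let X = g⁻¹ g'. The derivative ∂∂̄ log D_k is a trace involving only the entries of
X that lead out of the first k vectors (`gramCurvature_eq_sum_compl`). For a curve tangent to 𝒩 a
single such entry x survives, so φ_k = |x|² D_{k+1} D_{k-1} / D_k² (`flagMetric_eq_of_lt`). Since x
is holomorphic, log |x|² is harmonic where x ≠ 0, so the curvature of the metric is that of the line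
bundle.

The Lagrangian step. The block of X leading out of an n-dimensional isotropic term of the flag is
skew, and tangency leaves one pair of entries ± x. As H preserves Q, the Schur complement of the
Lagrangian block of H is the transpose of the inverse of that block, and Jacobi's identity gives
(i_± f)^*φ̂_n = 2 |x|² D_{n-2} / D_n (`flagMetric_eq_of_lagrangian`). The Lagrangian determinants of
the two signs satisfy D_n⁺ D_n⁻ = D_{n-1}² (`principalMinor_insert_mul_insert`), which is the
relation φ̂_{n-1} = φ₊ + φ₋ once φ̂_n = 2 φ_± is known.

Spinors. Let A be the action on ⋀ W of an element of the spin group over H. Conjugating γ(e₁)⋯γ(eₙ),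
which is a matrix unit, by A gives γ(He₁)⋯γ(Heₙ). Comparing one entry shows that the square of the
highest weight coefficient of A is the n × n minor of H on the e_i (`SpinCovers.sq_apply_univ`).
Applied to s₀ᴴ s over g₀ᴴ g, it says that Hermitian products of spinors are square roots of those in
⋀ⁿ V, whence φ̂_n = 2 φ_±. That every g has a preimage in the spin group is the Cartan-Dieudonné
argument of `exists_pinCovers`. -/

noncomputable section

namespace SOPlucker

attribute [local instance] LieRing.ofAssociativeRing

open Matrix Filter Topology ComplexConjugate

/-! ### Principal minors -/

section Minors

variable {ι : Type*} [DecidableEq ι]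

/-- The principal minor of `H` with index set `s`. -/
def principalMinor (H : Matrix ι ι ℂ) (s : Finset ι) : ℂ :=
  (H.submatrix (Subtype.val : s → ι) Subtype.val).det

/-- Jacobi's identity for complementary minors of the inverse matrix. -/
lemma det_inv_submatrix_mul_det {a b m : Type*} [Fintype a] [Fintype b] [Fintype m]
    [DecidableEq a] [DecidableEq b] [DecidableEq m] (e : a ⊕ b ≃ m) {G N : Matrix m m ℂ}
    (h : G * N = 1) :
    (N.submatrix (e ∘ Sum.inr) (e ∘ Sum.inr)).det * G.det =
      (G.submatrix (e ∘ Sum.inl) (e ∘ Sum.inl)).det := by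
  set G' := G.submatrix e e with hG'
  set N' := N.submatrix e e with hN'
  have h' : G' * N' = 1 := by
    rw [hG', hN', Matrix.submatrix_mul_equiv, h, Matrix.submatrix_one_equiv]
  rw [← Matrix.fromBlocks_toBlocks G', ← Matrix.fromBlocks_toBlocks N',
    Matrix.fromBlocks_multiply, ← Matrix.fromBlocks_one, Matrix.fromBlocks_inj] at h'
  -- Replacing the first block column of N by that of the identity gives a factor of determinant det
  -- N₂₂, and the product is block triangular with determinant det G₁₁.
  have key : Matrix.fromBlocks G'.toBlocks₁₁ G'.toBlocks₁₂ G'.toBlocks₂₁ G'.toBlocks₂₂ *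
      Matrix.fromBlocks 1 N'.toBlocks₁₂ 0 N'.toBlocks₂₂ =
      Matrix.fromBlocks G'.toBlocks₁₁ 0 G'.toBlocks₂₁ 1 := by
    rw [Matrix.fromBlocks_multiply, h'.2.1, h'.2.2.2]
    simp
  have h2 := congrArg Matrix.det key
  rw [Matrix.det_mul, Matrix.fromBlocks_toBlocks, Matrix.det_fromBlocks_zero₂₁,
    Matrix.det_fromBlocks_zero₁₂, Matrix.det_one, Matrix.det_one, one_mul, mul_one, hG',
    Matrix.det_submatrix_equiv_self, mul_comm] at h2
  exact h2

lemma principalMinor_eq_det {H : Matrix ι ι ℂ} {s : Finset ι} {a : Type*} [Fintype a]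
    [DecidableEq a] (c : a → ι) (hc : Function.Injective c)
    (hs : ∀ i, i ∈ s ↔ i ∈ Set.range c) :
    principalMinor H s = (H.submatrix c c).det := by
  let e : a ≃ s := Equiv.ofBijective (fun x => ⟨c x, (hs _).2 ⟨x, rfl⟩⟩)
    ⟨fun x y h => hc (congrArg Subtype.val h), fun ⟨i, hi⟩ => by
      obtain ⟨x, hx⟩ := (hs i).1 hi
      exact ⟨x, Subtype.ext hx⟩⟩
  rw [principalMinor, ← Matrix.det_submatrix_equiv_self e]
  rfl

/-- The inverse of a principal submatrix, extended by zero. -/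
def subInv (H : Matrix ι ι ℂ) (s : Finset ι) : Matrix s s ℂ :=
  (H.submatrix (Subtype.val : s → ι) Subtype.val)⁻¹

lemma mul_subInv {H : Matrix ι ι ℂ} {s : Finset ι} (h : principalMinor H s ≠ 0) :
    H.submatrix (Subtype.val : s → ι) Subtype.val * subInv H s = 1 :=
  Matrix.mul_nonsing_inv _ (isUnit_iff_ne_zero.2 h)

lemma subInv_mul {H : Matrix ι ι ℂ} {s : Finset ι} (h : principalMinor H s ≠ 0) :
    subInv H s * H.submatrix (Subtype.val : s → ι) (Subtype.val : s → ι) = 1 :=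
  Matrix.nonsing_inv_mul _ (isUnit_iff_ne_zero.2 h)

/-- Jacobi's identity with a complement of one element. -/
lemma subInv_apply_mul {H : Matrix ι ι ℂ} {s : Finset ι} (h : principalMinor H s ≠ 0) (a : s) :
    subInv H s a a * principalMinor H s = principalMinor H (s.erase a) := by
  let f : (s.erase a : Finset ι) ⊕ Unit → s :=
    Sum.elim (fun x => ⟨x.1, Finset.mem_of_mem_erase x.2⟩) fun _ => a
  have hf : Function.Bijective f := by
    constructor
    · rintro (x | x) (y | y) hxy
      · exact congrArg Sum.inl (Subtype.ext (congrArg (Subtype.val : s → ι) hxy))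
      · exact absurd (congrArg Subtype.val hxy) (Finset.ne_of_mem_erase x.2)
      · exact absurd (congrArg Subtype.val hxy).symm (Finset.ne_of_mem_erase y.2)
      · rfl
    · intro x
      by_cases hx : x = a
      · exact ⟨Sum.inr (), hx.symm⟩
      · exact ⟨Sum.inl ⟨x.1, Finset.mem_erase.2 ⟨fun h => hx (Subtype.ext h), x.2⟩⟩, rfl⟩
  have := det_inv_submatrix_mul_det (Equiv.ofBijective f hf) (mul_subInv h)
  rw [Matrix.det_unique] at this
  exact this

/-- Jacobi's identity with a complement of two elements. This 2 × 2 minor of the inverse is what the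
skew pair of entries of X produces in the Lagrangian case. -/
lemma subInv_det_two_mul {H : Matrix ι ι ℂ} {s : Finset ι} (h : principalMinor H s ≠ 0) {a b : s}
    (hab : a ≠ b) :
    (subInv H s a a * subInv H s b b - subInv H s a b * subInv H s b a) * principalMinor H s =
      principalMinor H ((s.erase a).erase b) := by
  let f : ((s.erase a).erase b : Finset ι) ⊕ Fin 2 → s :=
    Sum.elim (fun x => ⟨x.1, Finset.mem_of_mem_erase (Finset.mem_of_mem_erase x.2)⟩) ![a, b]
  have hf : Function.Bijective f := by
    have h1 : ∀ x : ((s.erase a).erase b : Finset ι), f (Sum.inl x) ≠ a := fun x hx =>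
      Finset.ne_of_mem_erase (Finset.mem_of_mem_erase x.2) (congrArg Subtype.val hx)
    have h2 : ∀ x : ((s.erase a).erase b : Finset ι), f (Sum.inl x) ≠ b := fun x hx =>
      Finset.ne_of_mem_erase x.2 (congrArg Subtype.val hx)
    constructor
    · rintro (x | x) (y | y) hxy
      · exact congrArg Sum.inl (Subtype.ext (congrArg (Subtype.val : s → ι) hxy))
      · fin_cases y
        · exact absurd hxy (h1 x)
        · exact absurd hxy (h2 x)
      · fin_cases x
        · exact absurd hxy.symm (h1 y)
        · exact absurd hxy.symm (h2 y)
      · fin_cases x <;> fin_cases y <;> simp_all [f, eq_comm]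
    · intro x
      by_cases hx : x = a
      · exact ⟨Sum.inr 0, hx.symm⟩
      by_cases hx' : x = b
      · exact ⟨Sum.inr 1, hx'.symm⟩
      exact ⟨Sum.inl ⟨x.1, Finset.mem_erase.2 ⟨fun h => hx' (Subtype.ext h),
        Finset.mem_erase.2 ⟨fun h => hx (Subtype.ext h), x.2⟩⟩⟩, rfl⟩
  have := det_inv_submatrix_mul_det (Equiv.ofBijective f hf) (mul_subInv h)
  rw [Matrix.det_fin_two] at this
  exact this

variable [Fintype ι]

/-- Cramer's rule for a vector supported on `insert t s` that `H` maps to a vector vanishing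
on `s`. -/
lemma principalMinor_insert_mul {H : Matrix ι ι ℂ} {s : Finset ι} {t : ι} (ht : t ∉ s)
    (h : principalMinor H (insert t s) ≠ 0) (b : ι → ℂ) (hb : ∀ i, i ≠ t → i ∉ s → b i = 0)
    (hs : ∀ i ∈ s, (H *ᵥ b) i = 0) :
    principalMinor H (insert t s) * b t = (H *ᵥ b) t * principalMinor H s := by
  set T := insert t s
  let t' : T := ⟨t, Finset.mem_insert_self _ _⟩
  have hmul : H.submatrix (Subtype.val : T → ι) Subtype.val *ᵥ (fun i : T => b i) =
      Pi.single t' ((H *ᵥ b) t) := by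
    ext i
    have h1 : (H.submatrix (Subtype.val : T → ι) Subtype.val *ᵥ (fun i : T => b i)) i =
        (H *ᵥ b) i := by
      simp only [Matrix.mulVec, dotProduct, Matrix.submatrix_apply]
      rw [Finset.sum_coe_sort T (fun j => H i j * b j)]
      refine Finset.sum_subset (Finset.subset_univ _) fun j _ hj => ?_
      rw [hb j (fun hjt => hj (hjt ▸ Finset.mem_insert_self _ _))
        fun hjs => hj (Finset.mem_insert_of_mem hjs), mul_zero]
    rw [h1]
    by_cases hi : i = t'
    · rw [hi, Pi.single_eq_same]
    · rw [Pi.single_eq_of_ne hi]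
      refine hs _ ((Finset.mem_insert.1 i.2).resolve_left fun hit => hi (Subtype.ext hit))
  have h2 := congrArg (fun v => (subInv H T *ᵥ v) t') hmul
  simp only [Matrix.mulVec_mulVec, subInv_mul h, Matrix.one_mulVec, Matrix.mulVec_single,
    Pi.smul_apply, MulOpposite.smul_eq_mul_unop, MulOpposite.unop_op, Matrix.col_apply] at h2
  have h3 := subInv_apply_mul h t'
  have h4 : T.erase (t' : ι) = s := Finset.erase_insert ht
  rw [h4] at h3
  change b t = _ at h2
  rw [h2, ← h3]
  ring

/-- Orthogonalization of the basis vector `t` against those in `s`. -/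
lemma exists_orthogonalized {H : Matrix ι ι ℂ} {s : Finset ι} {t : ι} (ht : t ∉ s)
    (h : principalMinor H s ≠ 0) :
    ∃ b : ι → ℂ, b t = 1 ∧ (∀ i, i ≠ t → i ∉ s → b i = 0) ∧ (∀ i ∈ s, (H *ᵥ b) i = 0) ∧
      (H *ᵥ b) t = H t t - ∑ i : s, ∑ j : s, H t i * subInv H s i j * H j t := by
  let c : s → ℂ := subInv H s *ᵥ fun j => H j t
  let b : ι → ℂ := fun i => if hi : i ∈ s then -c ⟨i, hi⟩ else if i = t then 1 else 0
  have hbt : b t = 1 := by simp [b, ht]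
  have hb0 : ∀ i, i ≠ t → i ∉ s → b i = 0 := fun i h1 h2 => by simp [b, h1, h2]
  have hmul : ∀ i, (H *ᵥ b) i = H i t - ∑ j : s, H i j * c j := by
    intro i
    have h1 : (H *ᵥ b) i = ∑ j ∈ insert t s, H i j * b j := by
      simp only [Matrix.mulVec, dotProduct]
      refine (Finset.sum_subset (Finset.subset_univ _) fun j _ hj => ?_).symm
      rw [hb0 j (fun hjt => hj (hjt ▸ Finset.mem_insert_self _ _))
        fun hjs => hj (Finset.mem_insert_of_mem hjs), mul_zero]
    rw [h1, Finset.sum_insert ht, hbt, mul_one, sub_eq_add_neg, ← Finset.sum_neg_distrib,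
      ← Finset.sum_coe_sort s]
    congr 1
    refine Finset.sum_congr rfl fun j _ => ?_
    simp [b]
  refine ⟨b, hbt, hb0, fun i hi => ?_, ?_⟩
  · rw [hmul]
    have h1 : ∑ j : s, H i j * c j =
        (H.submatrix (Subtype.val : s → ι) Subtype.val *ᵥ c) ⟨i, hi⟩ := rfl
    rw [h1, Matrix.mulVec_mulVec, mul_subInv h, Matrix.one_mulVec, sub_self]
  · rw [hmul]
    simp only [c, Matrix.mulVec, dotProduct, Finset.mul_sum, mul_assoc]

end Minors

/-! ### Gram matrices of bases -/

section Gram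

open scoped ComplexOrder

variable {ι : Type*} [Fintype ι] [DecidableEq ι]

lemma posDef_gram {M : Matrix ι ι ℂ} (hM : IsUnit M.det) : (Mᴴ * M).PosDef :=
  Matrix.PosDef.conjTranspose_mul_self M
    (Matrix.mulVec_injective_of_isUnit ((Matrix.isUnit_iff_isUnit_det M).2 hM))

/-- The Gram determinant of the columns of `M` with indices in `s`. -/
def gramDet (M : Matrix ι ι ℂ) (s : Finset ι) : ℝ := (principalMinor (Mᴴ * M) s).re

lemma principalMinor_pos {M : Matrix ι ι ℂ} (hM : IsUnit M.det) (s : Finset ι) :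
    0 < principalMinor (Mᴴ * M) s :=
  ((posDef_gram hM).submatrix Subtype.val_injective).det_pos

lemma principalMinor_ne_zero {M : Matrix ι ι ℂ} (hM : IsUnit M.det) (s : Finset ι) :
    principalMinor (Mᴴ * M) s ≠ 0 := (principalMinor_pos hM s).ne'

lemma gramDet_pos {M : Matrix ι ι ℂ} (hM : IsUnit M.det) (s : Finset ι) : 0 < gramDet M s :=
  (Complex.pos_iff.1 (principalMinor_pos hM s)).1

lemma coe_gramDet {M : Matrix ι ι ℂ} (hM : IsUnit M.det) (s : Finset ι) :
    (gramDet M s : ℂ) = principalMinor (Mᴴ * M) s :=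
  Complex.ext rfl (Complex.pos_iff.1 (principalMinor_pos hM s)).2

end Gram

/-! ### Schur complements and the curvature of Gram determinants. -/

section Schur

variable {ι : Type*} [Fintype ι] [DecidableEq ι]

/-- The Schur complement of the principal submatrix of `H` with index set `s`, extended by
zero. -/
def schur (H : Matrix ι ι ℂ) (s : Finset ι) : Matrix ι ι ℂ :=
  H - H.submatrix id (Subtype.val : s → ι) * subInv H s *
    H.submatrix (Subtype.val : s → ι) id

omit [Fintype ι] in
lemma schur_apply (H : Matrix ι ι ℂ) (s : Finset ι) (i j : ι) :
    schur H s i j = H i j - ∑ a : s, ∑ b : s, H i a * subInv H s a b * H b j := by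
  simp only [schur, Matrix.sub_apply, Matrix.mul_apply, Matrix.submatrix_apply, id,
    Finset.sum_mul]
  rw [Finset.sum_comm]

-- When H is a Gram matrix, the Schur complement is the Gram matrix of the projections to the
-- orthogonal complement of the vectors in s, so the vectors of s themselves contribute nothing.
omit [Fintype ι] in
lemma schur_apply_of_mem_left {H : Matrix ι ι ℂ} {s : Finset ι} (h : principalMinor H s ≠ 0)
    {i : ι} (hi : i ∈ s) (j : ι) : schur H s i j = 0 := by
  have h1 : (H.submatrix (Subtype.val : s → ι) (Subtype.val : s → ι) * subInv H s *
      H.submatrix (Subtype.val : s → ι) id) ⟨i, hi⟩ j = H i j := by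
    rw [mul_subInv h, Matrix.one_mul]
    rfl
  exact sub_eq_zero.2 h1.symm

omit [Fintype ι] in
lemma schur_apply_of_mem_right {H : Matrix ι ι ℂ} {s : Finset ι} (h : principalMinor H s ≠ 0)
    (i : ι) {j : ι} (hj : j ∈ s) : schur H s i j = 0 := by
  have h1 : (H.submatrix id (Subtype.val : s → ι) * (subInv H s *
      H.submatrix (Subtype.val : s → ι) (Subtype.val : s → ι))) i ⟨j, hj⟩ = H i j := by
    rw [subInv_mul h, Matrix.mul_one]
    rfl
  rw [← Matrix.mul_assoc] at h1
  exact sub_eq_zero.2 h1.symm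

/-- The diagonal entry is the squared length of the vector t orthogonalized against s, that is, a
quotient of successive Gram determinants. -/
lemma schur_apply_self_mul {H : Matrix ι ι ℂ} {s : Finset ι} {t : ι} (ht : t ∉ s)
    (h : principalMinor H s ≠ 0) (h' : principalMinor H (insert t s) ≠ 0) :
    schur H s t t * principalMinor H s = principalMinor H (insert t s) := by
  obtain ⟨b, hbt, hb0, hbs, hb⟩ := exists_orthogonalized ht h
  rw [schur_apply, ← hb, ← principalMinor_insert_mul ht h' b hb0 hbs, hbt, mul_one]

/-- The coefficient of `∂∂̄ log det` of the Gram matrix of the columns in `s` of a holomorphic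
matrix `M` with `M' = M X` and `MᴴM = H`. -/
def gramCurvature (H X : Matrix ι ι ℂ) (s : Finset ι) : ℂ :=
  ∑ a : s, ∑ b : s, subInv H s a b * ∑ i, ∑ j, star (X i b) * schur H s i j * X j a

/-- The subtracted term projects the derivative M X to the span of the columns in s, so the bracket
is X_sᴴ times the Schur complement times X_s. After this only H and X matter. -/
lemma trace_eq_gramCurvature (M X : Matrix ι ι ℂ) (s : Finset ι) :
    (subInv (Mᴴ * M) s * (((M * X).submatrix id (Subtype.val : s → ι))ᴴ *
      (M * X).submatrix id (Subtype.val : s → ι) -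
      ((M * X).submatrix id (Subtype.val : s → ι))ᴴ * M.submatrix id (Subtype.val : s → ι) *
      subInv (Mᴴ * M) s * ((M.submatrix id (Subtype.val : s → ι))ᴴ *
      (M * X).submatrix id (Subtype.val : s → ι)))).trace = gramCurvature (Mᴴ * M) X s := by
  have h : ((M * X).submatrix id (Subtype.val : s → ι))ᴴ *
      (M * X).submatrix id (Subtype.val : s → ι) -
      ((M * X).submatrix id (Subtype.val : s → ι))ᴴ * M.submatrix id (Subtype.val : s → ι) *
      subInv (Mᴴ * M) s * ((M.submatrix id (Subtype.val : s → ι))ᴴ *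
      (M * X).submatrix id (Subtype.val : s → ι)) =
      (X.submatrix id (Subtype.val : s → ι))ᴴ * schur (Mᴴ * M) s *
        X.submatrix id (Subtype.val : s → ι) := by
    have e1 : (M * X).submatrix id (Subtype.val : s → ι) =
        M * X.submatrix id (Subtype.val : s → ι) := rfl
    have e2 : (Mᴴ * M).submatrix id (Subtype.val : s → ι) =
        Mᴴ * M.submatrix id (Subtype.val : s → ι) := rfl
    have e3 : (Mᴴ * M).submatrix (Subtype.val : s → ι) id =
        (M.submatrix id (Subtype.val : s → ι))ᴴ * M := rfl
    rw [schur, e1, e2, e3, Matrix.conjTranspose_mul]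
    simp only [Matrix.mul_assoc, Matrix.mul_sub, Matrix.sub_mul]
  rw [h, Matrix.trace, gramCurvature]
  refine Finset.sum_congr rfl fun a _ => ?_
  rw [Matrix.diag_apply, Matrix.mul_apply]
  refine Finset.sum_congr rfl fun b _ => ?_
  simp only [Matrix.mul_apply, Matrix.conjTranspose_apply, Matrix.submatrix_apply, id,
    Finset.sum_mul]
  rw [Finset.sum_comm]

/-- Since the Schur complement vanishes on s, only the entries of X leading from s to its complement
count: ∂∂̄ log det sees the velocity of the subspace spanned by s, not of its basis. -/
lemma gramCurvature_eq_sum_compl {H X : Matrix ι ι ℂ} {s : Finset ι}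
    (h : principalMinor H s ≠ 0) :
    gramCurvature H X s = ∑ a : s, ∑ b : s, ∑ i ∈ sᶜ, ∑ j ∈ sᶜ,
      subInv H s a b * (star (X i b) * schur H s i j * X j a) := by
  refine Finset.sum_congr rfl fun a _ => Finset.sum_congr rfl fun b _ => ?_
  rw [Finset.mul_sum]
  symm
  refine Finset.sum_subset_zero_on_sdiff (Finset.subset_univ _) (fun i hi => ?_) fun i hi => ?_
  · have : i ∈ s := by simpa using hi
    simp [schur_apply_of_mem_left h this]
  · rw [Finset.mul_sum]
    refine Finset.sum_subset_zero_on_sdiff (Finset.subset_univ _) (fun j hj => ?_) fun j hj => rfl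
    have : j ∈ s := by simpa using hj
    simp [schur_apply_of_mem_right h _ this]

/-- One entry of X leaves s, so the fourfold sum has one term: a diagonal entry of the inverse
(ratio of the minors of `s.erase r` and s) times a diagonal entry of the Schur complement (ratio of
the minors of `insert t s` and s). -/
lemma gramCurvature_of_single {H X : Matrix ι ι ℂ} {s : Finset ι} {r t : ι} (hr : r ∈ s)
    (ht : t ∉ s) (h : principalMinor H s ≠ 0) (h' : principalMinor H (insert t s) ≠ 0)
    (hX : ∀ i ∉ s, ∀ j ∈ s, X i j ≠ 0 → i = t ∧ j = r) :
    gramCurvature H X s * principalMinor H s ^ 2 =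
      star (X t r) * X t r * (principalMinor H (insert t s) * principalMinor H (s.erase r)) := by
  have key : gramCurvature H X s =
      subInv H s ⟨r, hr⟩ ⟨r, hr⟩ * (star (X t r) * schur H s t t * X t r) := by
    rw [gramCurvature_eq_sum_compl h, Finset.sum_eq_single ⟨r, hr⟩, Finset.sum_eq_single ⟨r, hr⟩,
      Finset.sum_eq_single t, Finset.sum_eq_single t]
    · intro j hj hjt
      have : X j r = 0 := by
        by_contra hne
        exact hjt (hX j (Finset.mem_compl.1 hj) r hr hne).1
      simp [this]
    · intro hn
      exact absurd (Finset.mem_compl.2 ht) hn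
    · intro j hj hjt
      have : X j r = 0 := by
        by_contra hne
        exact hjt (hX j (Finset.mem_compl.1 hj) r hr hne).1
      simp [this]
    · intro hn
      exact absurd (Finset.mem_compl.2 ht) hn
    · intro b _ hb
      refine Finset.sum_eq_zero fun i hi => Finset.sum_eq_zero fun j _ => ?_
      have : X i b = 0 := by
        by_contra hne
        exact hb (Subtype.ext (hX i (Finset.mem_compl.1 hi) b b.2 hne).2)
      simp [this]
    · simp
    · intro a _ ha
      refine Finset.sum_eq_zero fun b _ => Finset.sum_eq_zero fun i _ =>
        Finset.sum_eq_zero fun j hj => ?_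
      have : X j a = 0 := by
        by_contra hne
        exact ha (Subtype.ext (hX j (Finset.mem_compl.1 hj) a a.2 hne).2)
      simp [this]
    · simp
  rw [key, ← schur_apply_self_mul ht h h', ← subInv_apply_mul h ⟨r, hr⟩]
  ring

end Schur

/-! ### Gram matrices of bases adapted to a split quadratic form -/

section Involution

variable {ι : Type*} [Fintype ι] [DecidableEq ι] {σ : ι → ι} {H : Matrix ι ι ℂ}

/-- The Gram matrix `H` is the inverse of its transpose conjugated by the involution `σ`. -/
def IsSelfDual (σ : ι → ι) (H : Matrix ι ι ℂ) : Prop :=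
  ∀ i k, ∑ j, H i j * H k (σ j) = if k = σ i then 1 else 0

/-- Multiply the Schur complement on σ(s) by the transposed s-block of H. Self-duality turns the
leading term into the identity, and in the correction term it yields pairings of two elements of s,
which vanish because σ carries s to its complement. -/
lemma schur_apply_involution (hσ : Function.Involutive σ) (hH : IsSelfDual σ H)
    {s : Finset ι} (hs : ∀ i, σ i ∈ s ↔ i ∉ s) (h : principalMinor H s ≠ 0) (a b : s) :
    schur H s (σ a) (σ b) = subInv H s b a := by
  have hH' : ∀ i k, ∑ j, H i j * H k (σ j) = if k = σ i then 1 else 0 := hH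
  have hP : (Matrix.of fun a b : s => schur H s (σ a) (σ b)) *
      (H.submatrix (Subtype.val : s → ι) (Subtype.val : s → ι))ᵀ = 1 := by
    ext a c
    have h1 : ∑ b : s, schur H s (σ a) (σ b) * H c b = ∑ j, schur H s (σ a) j * H c (σ j) := by
      rw [← Equiv.sum_comp hσ.toPerm (fun j => schur H s (σ a) j * H c (σ j))]
      simp only [Function.Involutive.coe_toPerm, hσ _]
      rw [Finset.sum_coe_sort s (fun b => schur H s (σ a) (σ b) * H c b)]
      refine Finset.sum_subset (Finset.subset_univ _) fun j _ hj => ?_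
      rw [schur_apply_of_mem_right h _ ((hs j).2 hj), zero_mul]
    simp only [Matrix.mul_apply, Matrix.of_apply, Matrix.transpose_apply, Matrix.submatrix_apply]
    rw [h1]
    simp only [schur_apply, sub_mul, Finset.sum_sub_distrib, hH', Finset.sum_mul]
    rw [Finset.sum_comm]
    have h2 : ∀ a' : s, ∑ j, ∑ b' : s, H (σ a) a' * subInv H s a' b' * H b' j * H c (σ j) = 0 := by
      intro a'
      rw [Finset.sum_comm]
      refine Finset.sum_eq_zero fun b' _ => ?_
      simp only [mul_assoc, ← Finset.mul_sum, hH']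
      have : (c : ι) ≠ σ b' := fun hcb => (hs b').1 (hcb ▸ c.2) b'.2
      simp [this]
    rw [Finset.sum_eq_zero fun a' _ => h2 a', sub_zero, hσ, Matrix.one_apply]
    simp only [Subtype.ext_iff, eq_comm]
  have h3 : (Matrix.of fun a b : s => schur H s (σ a) (σ b)) = (subInv H s)ᵀ := by
    have h4 : (H.submatrix (Subtype.val : s → ι) (Subtype.val : s → ι))ᵀ * (subInv H s)ᵀ = 1 := by
      rw [← Matrix.transpose_mul, subInv_mul h, Matrix.transpose_one]
    calc _ = (Matrix.of fun a b : s => schur H s (σ a) (σ b)) *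
          ((H.submatrix (Subtype.val : s → ι) (Subtype.val : s → ι))ᵀ * (subInv H s)ᵀ) := by
            rw [h4, Matrix.mul_one]
      _ = _ := by rw [← Matrix.mul_assoc, hP, Matrix.one_mul]
  exact congrFun (congrFun h3 a) b

/-- The Schur complement on σ(s) is again the inverse of the s-block, so both factors of the trace
are entries of one inverse matrix. The skew pair of entries of X selects twice its 2 × 2 minor at r,
t, which Jacobi's identity evaluates. -/
lemma gramCurvature_of_lagrangian (hσ : Function.Involutive σ) (hH : IsSelfDual σ H)
    {X : Matrix ι ι ℂ} {s : Finset ι} (hs : ∀ i, σ i ∈ s ↔ i ∉ s)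
    (h : principalMinor H s ≠ 0) {r t : ι} (hr : r ∈ s) (ht : t ∈ s) (hrt : r ≠ t)
    (hX : ∀ i ∈ s, ∀ j ∈ s, X (σ i) j ≠ 0 → (i = t ∧ j = r) ∨ (i = r ∧ j = t))
    (hX' : X (σ r) t = - X (σ t) r) :
    gramCurvature H X s * principalMinor H s =
      2 * (star (X (σ t) r) * X (σ t) r) * principalMinor H ((s.erase r).erase t) := by
  set c := X (σ t) r with hc
  have hcompl : ∀ F : ι → ℂ, ∑ i ∈ sᶜ, F i = ∑ i : s, F (σ i) := by
    intro F
    rw [Finset.sum_coe_sort s (fun i => F (σ i))]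
    refine Finset.sum_bij' (fun i _ => σ i) (fun i _ => σ i) ?_ ?_ ?_ ?_ ?_
    · intro i hi
      exact (hs i).2 (Finset.mem_compl.1 hi)
    · intro i hi
      exact Finset.mem_compl.2 fun hi' => (hs i).1 hi' hi
    · intro i _
      exact hσ i
    · intro i _
      exact hσ i
    · intro i _
      rw [hσ]
  let r' : s := ⟨r, hr⟩
  let t' : s := ⟨t, ht⟩
  have hrt' : r' ≠ t' := fun h => hrt (congrArg Subtype.val h)
  have hXc : ∀ i j : s, X (σ i) j = c * ((if i = t' ∧ j = r' then 1 else 0) -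
      (if i = r' ∧ j = t' then 1 else 0)) := by
    intro i j
    by_cases h1 : i = t' ∧ j = r'
    · obtain ⟨rfl, rfl⟩ := h1
      simp [hrt', hrt'.symm, hc, r', t']
    by_cases h2 : i = r' ∧ j = t'
    · obtain ⟨rfl, rfl⟩ := h2
      simp [hrt', hX', r', t']
    · rw [if_neg h1, if_neg h2, sub_zero, mul_zero]
      by_contra hne
      rcases hX i i.2 j j.2 hne with h3 | h3
      · exact h1 ⟨Subtype.ext h3.1, Subtype.ext h3.2⟩
      · exact h2 ⟨Subtype.ext h3.1, Subtype.ext h3.2⟩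
  have h1 : ∀ (F : s → s → ℂ), ∑ i : s, ∑ j : s, F i j * ((if i = t' ∧ j = r' then 1 else 0) -
      (if i = r' ∧ j = t' then 1 else 0)) = F t' r' - F r' t' := by
    intro F
    simp [mul_sub, Finset.sum_sub_distrib, ite_and]
  have key : gramCurvature H X s = 2 * (star c * c) *
      (subInv H s r' r' * subInv H s t' t' - subInv H s r' t' * subInv H s t' r') := by
    -- The sums are reordered so that the inner pair carries the indices of the conjugated factor X
    -- and the outer pair those of the other one; each pair then collapses by `h1`.
    have swap : ∀ F : s → s → s → s → ℂ, ∑ a, ∑ b, ∑ i, ∑ j, F a b i j =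
        ∑ j, ∑ a, ∑ i, ∑ b, F a b i j := by
      intro F
      rw [Finset.sum_comm]
      symm
      rw [Finset.sum_comm]
      symm
      rw [Finset.sum_comm]
      refine Finset.sum_congr rfl fun a _ => ?_
      rw [Finset.sum_comm]
      symm
      rw [Finset.sum_comm]
      exact Finset.sum_congr rfl fun i _ => Finset.sum_comm
    rw [gramCurvature_eq_sum_compl h]
    simp only [hcompl, schur_apply_involution hσ hH hs h]
    calc _ = ∑ j : s, ∑ a : s, (∑ i : s, ∑ b : s,
          (star c * c * subInv H s a b * subInv H s j i) *
          ((if i = t' ∧ b = r' then 1 else 0) - (if i = r' ∧ b = t' then 1 else 0))) *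
          ((if j = t' ∧ a = r' then 1 else 0) - (if j = r' ∧ a = t' then 1 else 0)) := by
          simp only [Finset.sum_mul]
          rw [swap]
          refine Finset.sum_congr rfl fun j _ => Finset.sum_congr rfl fun a _ =>
            Finset.sum_congr rfl fun i _ => Finset.sum_congr rfl fun b _ => ?_
          rw [hXc i b, hXc j a, star_mul']
          have hstar : star ((if i = t' ∧ b = r' then (1 : ℂ) else 0) -
              (if i = r' ∧ b = t' then 1 else 0)) =
              (if i = t' ∧ b = r' then (1 : ℂ) else 0) - (if i = r' ∧ b = t' then 1 else 0) := by
            split_ifs <;> simp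
          rw [hstar]
          ring
      _ = _ := by
          simp only [h1]
          ring
  rw [key, ← subInv_det_two_mul h hrt']
  ring

/-- The product of the lengths of the two isotropic vectors completing an isotropic flag to the
two Lagrangian flags containing it. -/
lemma principalMinor_insert_mul_insert (hσ : Function.Involutive σ) (hH : IsSelfDual σ H)
    (hH' : ∀ k l, ∑ i, H i k * H (σ i) l = if l = σ k then 1 else 0)
    (hherm : ∀ i j, star (H i j) = H j i)
    {s : Finset ι} {t : ι} (hts : t ∉ s) (hts' : σ t ∉ s) (htt : t ≠ σ t)
    (hs : ∀ i ∈ s, σ i ∉ s) (hcover : ∀ i, i ∉ s → σ i ∉ s → i = t ∨ i = σ t)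
    (h0 : principalMinor H s ≠ 0) (h1 : principalMinor H (insert t s) ≠ 0)
    (h2 : principalMinor H (insert (σ t) s) ≠ 0) :
    principalMinor H (insert t s) * principalMinor H (insert (σ t) s) =
      principalMinor H s ^ 2 := by
  obtain ⟨a, hat, ha0, has, -⟩ := exists_orthogonalized hts h0
  have hc1 := principalMinor_insert_mul hts h1 a ha0 has
  rw [hat, mul_one] at hc1
  set P := (H *ᵥ a) t with hP
  have hP0 : P ≠ 0 := fun h => h1 (by rw [hc1, h, zero_mul])
  have hσs : ∀ i ∈ s, i ≠ t := fun i hi h => hts (h ▸ hi)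
  -- If a is the vector t orthogonalized against s, then c = conj (H a) ∘ σ is, up to the scalar P,
  -- the vector σ t orthogonalized against s: self-duality gives H c = conj a ∘ σ. Cramer's rule for
  -- a and for c gives the ratios P and 1/P.
  let c : ι → ℂ := fun i => star ((H *ᵥ a) (σ i))
  have hHc : ∀ i, (H *ᵥ c) i = star (a (σ i)) := by
    intro i
    have e1 : ∀ j, c j = ∑ k, H k (σ j) * star (a k) := by
      intro j
      simp only [c, Matrix.mulVec, dotProduct, star_sum, star_mul', hherm]
    simp only [Matrix.mulVec, dotProduct, e1, Finset.mul_sum]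
    rw [Finset.sum_comm]
    simp only [← mul_assoc, ← Finset.sum_mul]
    have e2 : ∀ k, ∑ j, H i j * H k (σ j) = if k = σ i then 1 else 0 := fun k => hH i k
    simp only [e2]
    simp
  have hPreal : star P = P := by
    have e1 : P = ∑ j, star (a j) * (H *ᵥ a) j := by
      rw [Finset.sum_eq_single t]
      · simp [hat, hP]
      · intro j _ hj
        by_cases hjs : j ∈ s
        · rw [has j hjs, mul_zero]
        · rw [ha0 j hj hjs, star_zero, zero_mul]
      · simp
    rw [e1]
    simp only [Matrix.mulVec, dotProduct, Finset.mul_sum, star_sum, star_mul', star_star, hherm]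
    rw [Finset.sum_comm]
    refine Finset.sum_congr rfl fun i _ => Finset.sum_congr rfl fun j _ => ?_
    ring
  have hct : c (σ t) = P := by simp only [c, hσ t]; exact hPreal
  have hcs : ∀ i, i ≠ t → i ≠ σ t → i ∉ s → c i = 0 := by
    intro i h1 h2 h3
    have : σ i ∈ s := by
      by_contra h4
      rcases hcover i h3 h4 with h | h
      · exact h1 h
      · exact h2 h
    simp [c, has _ this]
  -- The form is preserved by H, and a is isotropic because it is supported on s and t, no two
  -- elements of which are paired by σ.
  have hiso : ∑ i, c i * c (σ i) = 0 := by
    have e1 : ∑ i, (H *ᵥ a) i * (H *ᵥ a) (σ i) = 0 := by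
      have e2 : ∀ i, (H *ᵥ a) i * (H *ᵥ a) (σ i) =
          ∑ k, ∑ l, (H i k * H (σ i) l) * (a k * a l) := by
        intro i
        simp only [Matrix.mulVec, dotProduct, Finset.sum_mul, Finset.mul_sum]
        rw [Finset.sum_comm]
        refine Finset.sum_congr rfl fun k _ => Finset.sum_congr rfl fun l _ => ?_
        ring
      simp only [e2]
      rw [Finset.sum_comm]
      refine Finset.sum_eq_zero fun k _ => ?_
      rw [Finset.sum_comm]
      simp only [← Finset.sum_mul, hH']
      simp only [ite_mul, one_mul, zero_mul, Finset.sum_ite_eq', Finset.mem_univ, if_true]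
      by_cases hk : k = t
      · rw [hk, ha0 (σ t) htt.symm hts', mul_zero]
      by_cases hks : k ∈ s
      · rw [ha0 (σ k) (fun h => hts' (by rw [← h, hσ]; exact hks)) (hs k hks), mul_zero]
      · rw [ha0 k hk hks, zero_mul]
    have e3 : ∑ i, c i * c (σ i) = star (∑ i, (H *ᵥ a) i * (H *ᵥ a) (σ i)) := by
      simp only [c, star_sum, star_mul', hσ _]
      refine Finset.sum_congr rfl fun i _ => ?_
      ring
    rw [e3, e1, star_zero]
  -- In the isotropy relation only the pair t, σ t can contribute, and c (σ t) = P ≠ 0. So c has no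
  -- t component and is supported on s and σ t, as Cramer's rule requires.
  have hct0 : c t = 0 := by
    have e1 : ∑ i, c i * c (σ i) = 2 * (c t * P) := by
      rw [← Finset.sum_subset (Finset.subset_univ {t, σ t}), Finset.sum_pair htt, hσ, hct]
      · ring
      · intro i _ hi
        simp only [Finset.mem_insert, Finset.mem_singleton, not_or] at hi
        by_cases his : i ∈ s
        · have e2 : σ i ≠ t := fun h => hts' (by rw [← h, hσ]; exact his)
          have e3 : σ i ≠ σ t := fun h => hi.1 (hσ.injective h)
          rw [hcs (σ i) e2 e3 (hs i his), mul_zero]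
        · rw [hcs i hi.1 hi.2 his, zero_mul]
    rw [hiso] at e1
    simpa [hP0] using e1.symm
  have hc2 := principalMinor_insert_mul hts' h2 c
    (fun i h3 h4 => by
      by_cases hi : i = t
      · rw [hi, hct0]
      · exact hcs i hi h3 h4)
    (fun i hi => by
      rw [hHc, ha0 _ (fun h => hts' (by rw [← h, hσ]; exact hi)) (hs i hi), star_zero])
  rw [hct, hHc, hσ, hat, star_one, one_mul] at hc2
  rw [hc1, mul_comm P, mul_assoc, mul_comm P, hc2, sq]

end Involution

/-! ### Wirtinger derivatives -/

section Wirtinger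

/-- The real differential of `F` at `z` is `v ↦ p v + q v̄`. -/
def HasWirtingerAt (F : ℂ → ℂ) (p q z : ℂ) : Prop :=
  HasFDerivAt F (p • ContinuousLinearMap.id ℝ ℂ + q • (Complex.conjCLE : ℂ →L[ℝ] ℂ)) z

variable {F G : ℂ → ℂ} {p q p' q' z : ℂ}

lemma HasWirtingerAt.congr_deriv (h : HasWirtingerAt F p q z) (hp : p = p') (hq : q = q') :
    HasWirtingerAt F p' q' z := hp ▸ hq ▸ h

lemma HasWirtingerAt.congr_of_eventuallyEq (h : HasWirtingerAt F p q z) (hG : G =ᶠ[𝓝 z] F) :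
    HasWirtingerAt G p q z := HasFDerivAt.congr_of_eventuallyEq h hG

lemma HasWirtingerAt.unique (h : HasWirtingerAt F p q z) (h' : HasWirtingerAt F p' q' z) :
    p = p' ∧ q = q' := by
  have h1 := HasFDerivAt.unique h h'
  have e1 := congrArg (fun L : ℂ →L[ℝ] ℂ => L 1) h1
  have e2 := congrArg (fun L : ℂ →L[ℝ] ℂ => L Complex.I) h1
  simp at e1 e2
  have e3 : p - q = p' - q' := by
    refine mul_right_cancel₀ Complex.I_ne_zero ?_
    linear_combination e2
  constructor
  · linear_combination (e1 + e3) / 2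
  · linear_combination (e1 - e3) / 2

lemma hasWirtingerAt_of_hasDerivAt (h : HasDerivAt F p z) : HasWirtingerAt F p 0 z := by
  have := h.hasFDerivAt.restrictScalars ℝ
  refine HasFDerivAt.congr_fderiv this ?_
  ext
  simp [mul_comm]

lemma hasWirtingerAt_const (c : ℂ) : HasWirtingerAt (fun _ => c) 0 0 z := by
  refine HasFDerivAt.congr_fderiv (hasFDerivAt_const c z) ?_
  ext
  simp

lemma exists_hasWirtingerAt (h : DifferentiableAt ℝ F z) : ∃ p q, HasWirtingerAt F p q z := by
  set L := fderiv ℝ F z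
  refine ⟨(L 1 - Complex.I * L Complex.I) / 2, (L 1 + Complex.I * L Complex.I) / 2,
    h.hasFDerivAt.congr_fderiv ?_⟩
  apply ContinuousLinearMap.ext
  intro v
  have hv : v = v.re • (1 : ℂ) + v.im • Complex.I := by
    apply Complex.ext <;> simp
  have h1 : L v = v.re * L 1 + v.im * L Complex.I := by
    conv_lhs => rw [hv]
    rw [map_add, map_smul, map_smul]
    simp
  change L v = _
  rw [h1]
  simp only [_root_.add_apply, _root_.smul_apply,
    ContinuousLinearMap.id_apply, smul_eq_mul, ContinuousLinearEquiv.coe_coe,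
    Complex.conjCLE_apply]
  conv_rhs => rw [← Complex.re_add_im v]
  simp only [map_add, map_mul, Complex.conj_ofReal, Complex.conj_I]
  linear_combination (v.im : ℂ) * L Complex.I * Complex.I_sq

lemma HasWirtingerAt.differentiableAt (h : HasWirtingerAt F p q z) : DifferentiableAt ℝ F z :=
  HasFDerivAt.differentiableAt h

lemma HasWirtingerAt.add (h : HasWirtingerAt F p q z) (h' : HasWirtingerAt G p' q' z) :
    HasWirtingerAt (fun w => F w + G w) (p + p') (q + q') z := by
  refine HasFDerivAt.congr_fderiv (HasFDerivAt.add h h') ?_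
  ext
  simp
  ring

lemma HasWirtingerAt.mul (h : HasWirtingerAt F p q z) (h' : HasWirtingerAt G p' q' z) :
    HasWirtingerAt (fun w => F w * G w) (p * G z + F z * p') (q * G z + F z * q') z := by
  refine HasFDerivAt.congr_fderiv (HasFDerivAt.mul h h') ?_
  ext
  simp
  ring

lemma HasWirtingerAt.star (h : HasWirtingerAt F p q z) :
    HasWirtingerAt (fun w => star (F w)) (star q) (star p) z := by
  have := (Complex.conjCLE : ℂ →L[ℝ] ℂ).hasFDerivAt.comp z h
  refine HasFDerivAt.congr_fderiv this ?_
  ext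
  simp
  ring

lemma HasWirtingerAt.sum {a : Type*} {s : Finset a} {F : a → ℂ → ℂ} {p q : a → ℂ}
    (h : ∀ i ∈ s, HasWirtingerAt (F i) (p i) (q i) z) :
    HasWirtingerAt (fun w => ∑ i ∈ s, F i w) (∑ i ∈ s, p i) (∑ i ∈ s, q i) z := by
  classical
  induction s using Finset.induction_on with
  | empty => simpa using hasWirtingerAt_const 0
  | insert i s hi ih =>
    simp only [Finset.sum_insert hi]
    exact (h i (Finset.mem_insert_self _ _)).add
      (ih fun j hj => h j (Finset.mem_insert_of_mem hj))

lemma HasWirtingerAt.prod {a : Type*} [DecidableEq a] {s : Finset a} {F : a → ℂ → ℂ}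
    {p q : a → ℂ} (h : ∀ i ∈ s, HasWirtingerAt (F i) (p i) (q i) z) :
    HasWirtingerAt (fun w => ∏ i ∈ s, F i w) (∑ i ∈ s, (∏ j ∈ s.erase i, F j z) * p i)
      (∑ i ∈ s, (∏ j ∈ s.erase i, F j z) * q i) z := by
  refine HasFDerivAt.congr_fderiv (HasFDerivAt.finsetProd h) ?_
  ext
  simp [Finset.sum_add_distrib, Finset.sum_mul, mul_assoc]

/-- The two Wirtinger derivatives of a real function are conjugate; the hypothesis records this
instead of reality of F near z, so that F has to be real only at z. -/
lemma HasWirtingerAt.log_re (h : HasWirtingerAt F p (Star.star p) z) (hF : F z = ((F z).re : ℂ))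
    (hpos : 0 < (F z).re) :
    HasWirtingerAt (fun w => (Real.log (F w).re : ℂ)) (p / F z) (Star.star (p / F z)) z := by
  have h1 := Complex.ofRealCLM.hasFDerivAt.comp z
    ((Real.hasDerivAt_log hpos.ne').hasFDerivAt.comp z (Complex.reCLM.hasFDerivAt.comp z h))
  refine HasFDerivAt.congr_fderiv h1 ?_
  ext v
  have hs : Star.star (F z) = F z := by
    rw [hF]
    exact Complex.conj_ofReal _
  have e1 : ((p * v + Star.star p * conj v).re : ℂ) = p * v + Star.star p * conj v := by
    have : Star.star p * conj v = conj (p * v) := by rw [map_mul]; rfl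
    rw [this, Complex.add_conj]
    simp
  have e2 : ((F z).re : ℂ) ≠ 0 := Complex.ofReal_ne_zero.2 hpos.ne'
  rw [star_div₀, hs]
  have e3 : (p / F z * v + Star.star p / F z * conj v) =
      (p * v + Star.star p * conj v) / ((F z).re : ℂ) := by
    rw [← hF]
    ring
  refine Eq.trans ?_ e3.symm
  rw [← e1]
  simp
  ring

/-- Matrix-valued functions, entrywise. -/
def HasMatrixWirtingerAt {a b : Type*} (F : ℂ → Matrix a b ℂ) (P Q : Matrix a b ℂ) (z : ℂ) :
    Prop := ∀ i j, HasWirtingerAt (fun w => F w i j) (P i j) (Q i j) z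

lemma HasMatrixWirtingerAt.mul {a b c : Type*} [Fintype b] {F : ℂ → Matrix a b ℂ}
    {G : ℂ → Matrix b c ℂ} {P Q : Matrix a b ℂ} {P' Q' : Matrix b c ℂ}
    (h : HasMatrixWirtingerAt F P Q z) (h' : HasMatrixWirtingerAt G P' Q' z) :
    HasMatrixWirtingerAt (fun w => F w * G w) (P * G z + F z * P') (Q * G z + F z * Q') z := by
  intro i j
  simp only [Matrix.mul_apply, Matrix.add_apply, ← Finset.sum_add_distrib]
  exact HasWirtingerAt.sum fun k _ => (h i k).mul (h' k j)

lemma HasMatrixWirtingerAt.conjTranspose {a b : Type*} {F : ℂ → Matrix a b ℂ}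
    {P Q : Matrix a b ℂ} (h : HasMatrixWirtingerAt F P Q z) :
    HasMatrixWirtingerAt (fun w => (F w)ᴴ) Qᴴ Pᴴ z := fun i j => (h j i).star

lemma HasMatrixWirtingerAt.trace {a : Type*} [Fintype a] {F : ℂ → Matrix a a ℂ}
    {P Q : Matrix a a ℂ} (h : HasMatrixWirtingerAt F P Q z) :
    HasWirtingerAt (fun w => (F w).trace) P.trace Q.trace z :=
  HasWirtingerAt.sum fun i _ => h i i

variable {a : Type*} [Fintype a] [DecidableEq a]

/-- The product rule applied to the permutation expansion replaces one column at a time, and a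
determinant with one column replaced is an entry of the adjugate times that column. -/
lemma sum_sign_mul_eq_trace (G P : Matrix a a ℂ) :
    ∑ σ : Equiv.Perm a, ((Equiv.Perm.sign σ : ℤ) : ℂ) *
      ∑ i, (∏ j ∈ Finset.univ.erase i, G (σ j) j) * P (σ i) i =
      (G.adjugate * P).trace := by
  have h1 : ∀ i, (G.adjugate * P) i i = (G.updateCol i (fun k => P k i)).det := by
    intro i
    rw [← Matrix.cramer_apply, Matrix.cramer_eq_adjugate_mulVec]
    rfl
  simp only [Matrix.trace, Matrix.diag_apply, h1, Matrix.det_apply', Finset.mul_sum]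
  rw [Finset.sum_comm]
  refine Finset.sum_congr rfl fun i _ => Finset.sum_congr rfl fun σ _ => ?_
  congr 1
  rw [← Finset.mul_prod_erase _ _ (Finset.mem_univ i), mul_comm, Matrix.updateCol_self]
  congr 1
  refine Finset.prod_congr rfl fun j hj => ?_
  rw [Matrix.updateCol_ne (Finset.ne_of_mem_erase hj)]

/-- Jacobi's formula for the derivative of a determinant. -/
lemma HasMatrixWirtingerAt.det {G : ℂ → Matrix a a ℂ} {P Q : Matrix a a ℂ}
    (h : HasMatrixWirtingerAt G P Q z) :
    HasWirtingerAt (fun w => (G w).det) ((G z).adjugate * P).trace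
      ((G z).adjugate * Q).trace z := by
  simp only [Matrix.det_apply']
  rw [← sum_sign_mul_eq_trace, ← sum_sign_mul_eq_trace]
  refine HasWirtingerAt.sum fun σ _ => ?_
  refine ((hasWirtingerAt_const _).mul (HasWirtingerAt.prod fun i _ => h (σ i) i)).congr_deriv
    ?_ ?_ <;> simp

lemma differentiableAt_inv_entry {G : ℂ → Matrix a a ℂ} {P Q : Matrix a a ℂ}
    (h : HasMatrixWirtingerAt G P Q z) (h0 : (G z).det ≠ 0) (i j : a) :
    DifferentiableAt ℝ (fun w => (G w)⁻¹ i j) z := by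
  have h1 : (fun w => (G w)⁻¹ i j) =
      fun w => (G w).det⁻¹ * ((G w).updateRow j (Pi.single i 1)).det := by
    funext w
    rw [Matrix.inv_def, Matrix.smul_apply, Ring.inverse_eq_inv', smul_eq_mul,
      Matrix.adjugate_apply]
  rw [h1]
  have h2 : HasMatrixWirtingerAt (fun w => (G w).updateRow j (Pi.single i 1))
      (P.updateRow j 0) (Q.updateRow j 0) z := by
    intro k l
    by_cases hk : k = j
    · subst hk
      simpa using hasWirtingerAt_const _
    · simpa [Matrix.updateRow_ne hk] using h k l
  exact (h.det.differentiableAt.inv h0).mul h2.det.differentiableAt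

/-- Differentiate G G⁻¹ = 1. Only the antiholomorphic derivative enters ∂∂̄, so the holomorphic one
is left unspecified. -/
lemma exists_hasMatrixWirtingerAt_inv {G : ℂ → Matrix a a ℂ} {P Q : Matrix a a ℂ}
    (h : HasMatrixWirtingerAt G P Q z) (h0 : (G z).det ≠ 0) :
    ∃ P', HasMatrixWirtingerAt (fun w => (G w)⁻¹) P' (-((G z)⁻¹ * Q * (G z)⁻¹)) z := by
  choose P' Q' h' using fun i j => exists_hasWirtingerAt (differentiableAt_inv_entry h h0 i j)
  have h1 : HasMatrixWirtingerAt (fun w => (G w)⁻¹) (Matrix.of P') (Matrix.of Q') z :=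
    fun i j => h' i j
  have h2 := h.mul h1
  have h3 : ∀ᶠ w in 𝓝 z, G w * (G w)⁻¹ = 1 := by
    filter_upwards [h.det.differentiableAt.continuousAt.eventually_ne h0] with w hw
    exact Matrix.mul_nonsing_inv _ (isUnit_iff_ne_zero.2 hw)
  have h4 : Q * (G z)⁻¹ + G z * Matrix.of Q' = 0 := by
    ext i j
    have e1 := h2 i j
    have e2 : HasWirtingerAt (fun w => (G w * (G w)⁻¹) i j) 0 0 z :=
      (hasWirtingerAt_const ((1 : Matrix a a ℂ) i j)).congr_of_eventuallyEq
        (h3.mono fun w hw => by simp only [hw])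
    exact (e1.unique e2).2
  have h5 : Matrix.of Q' = -((G z)⁻¹ * Q * (G z)⁻¹) := by
    have e1 := congrArg (fun A => (G z)⁻¹ * A) (eq_neg_of_add_eq_zero_right h4)
    simp only [← Matrix.mul_assoc, Matrix.mul_neg,
      Matrix.nonsing_inv_mul _ (isUnit_iff_ne_zero.2 h0), Matrix.one_mul] at e1
    exact e1
  exact ⟨Matrix.of P', h5 ▸ h1⟩

/-! ### The operator `∂∂̄` -/

lemma ddbar_congr {u v : ℂ → ℝ} (h : u =ᶠ[𝓝 z] v) : ddbar u z = ddbar v z := by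
  rw [ddbar, ddbar, (InnerProductSpace.laplacian_congr_nhds h).eq_of_nhds]

lemma ddbar_add {u v : ℂ → ℝ} (hu : ContDiffAt ℝ 2 u z) (hv : ContDiffAt ℝ 2 v z) :
    ddbar (fun w => u w + v w) z = ddbar u z + ddbar v z := by
  rw [ddbar, ddbar, ddbar, ← add_div, ← hu.laplacian_add hv]
  rfl

lemma ddbar_const_mul {u : ℂ → ℝ} (c : ℝ) (hu : ContDiffAt ℝ 2 u z) :
    ddbar (fun w => c * u w) z = c * ddbar u z := by
  have := InnerProductSpace.laplacian_smul c hu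
  rw [smul_eq_mul] at this
  rw [ddbar, ddbar, ← mul_div_assoc, ← this]
  rfl

lemma ddbar_const (c : ℝ) : ddbar (fun _ => c) z = 0 := by
  rw [ddbar, InnerProductSpace.laplacian_const]
  simp

/-- Used whenever a holomorphic factor must not matter: the normalisation of an affine chart of
projective space, and the entry of g⁻¹ g' in a metric. -/
lemma ddbar_log_norm {h : ℂ → ℂ} (hh : AnalyticAt ℂ h z) (h0 : h z ≠ 0) :
    ContDiffAt ℝ 2 (fun w => Real.log ‖h w‖) z ∧ ddbar (fun w => Real.log ‖h w‖) z = 0 := by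
  have h1 := hh.harmonicAt_log_norm h0
  refine ⟨h1.1, ?_⟩
  have h2 := h1.2.eq_of_nhds
  rw [ddbar, h2]
  simp

/-- The operator `∂∂̄` in terms of Wirtinger derivatives. -/
lemma ddbar_eq_of_hasWirtingerAt {u : ℂ → ℝ} {D : ℂ → ℂ} {p q : ℂ}
    (hu : ∀ᶠ w in 𝓝 z, HasWirtingerAt (fun w => (u w : ℂ)) (D w) (star (D w)) w)
    (hD : HasWirtingerAt D p q z) : ddbar u z = q.re := by
  -- The differential of a real u with ∂u = D is v ↦ 2 Re (D v). Its second differential on (v, v)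
  -- is 2 Re (p v² + q |v|²); the sum over v = 1 and v = i is 4 Re q.
  let Λ : ℂ →L[ℝ] ℂ →L[ℝ] ℝ :=
    (2 : ℝ) • (ContinuousLinearMap.compL ℝ ℂ ℂ ℝ Complex.reCLM) ∘L (ContinuousLinearMap.mul ℝ ℂ)
  have hΛ : ∀ x v, Λ x v = 2 * (x * v).re := fun x v => rfl
  have h1 : fderiv ℝ u =ᶠ[𝓝 z] fun w => Λ (D w) := by
    filter_upwards [hu] with w hw
    have e1 := Complex.reCLM.hasFDerivAt.comp w hw
    have e2 : HasFDerivAt u (Λ (D w)) w := by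
      refine HasFDerivAt.congr_fderiv e1 ?_
      ext
      simp [hΛ]
      ring
    exact e2.fderiv
  have h2 : fderiv ℝ (fderiv ℝ u) z = Λ ∘L (p • ContinuousLinearMap.id ℝ ℂ +
      q • (Complex.conjCLE : ℂ →L[ℝ] ℂ)) := by
    rw [h1.fderiv_eq]
    exact (Λ.hasFDerivAt.comp z hD).fderiv
  rw [ddbar, InnerProductSpace.laplacian_eq_iteratedFDeriv_complexPlane]
  simp only [iteratedFDeriv_two_apply, h2]
  simp [hΛ]
  ring

/-- `∂∂̄ log det (Uᴴ U)` for a holomorphic matrix `U`. -/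
lemma ddbar_log_det_gram {ι : Type*} [Fintype ι] {U V : ℂ → Matrix ι a ℂ} {W : Matrix ι a ℂ}
    (hU : ∀ᶠ w in 𝓝 z, ∀ i j, HasDerivAt (fun w => U w i j) (V w i j) w)
    (hV : ∀ i j, HasDerivAt (fun w => V w i j) (W i j) z)
    (hpos : ∀ᶠ w in 𝓝 z, ((U w)ᴴ * U w).det = (((U w)ᴴ * U w).det.re : ℂ) ∧
      0 < ((U w)ᴴ * U w).det.re) :
    ddbar (fun w => Real.log ((U w)ᴴ * U w).det.re) z =
      ((((U z)ᴴ * U z)⁻¹ * ((V z)ᴴ * V z -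
        (V z)ᴴ * U z * ((U z)ᴴ * U z)⁻¹ * ((U z)ᴴ * V z))).trace).re := by
  have hG : ∀ᶠ w in 𝓝 z, HasMatrixWirtingerAt (fun w => (U w)ᴴ * U w) ((U w)ᴴ * V w)
      ((V w)ᴴ * U w) w := by
    filter_upwards [hU] with w hw
    have e1 : HasMatrixWirtingerAt U (V w) 0 w := fun i j => hasWirtingerAt_of_hasDerivAt (hw i j)
    have e2 := e1.conjTranspose.mul e1
    simpa using e2
  have hA : HasMatrixWirtingerAt (fun w => (U w)ᴴ * V w) ((U z)ᴴ * W) ((V z)ᴴ * V z) z := by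
    have e1 : HasMatrixWirtingerAt U (V z) 0 z :=
      fun i j => hasWirtingerAt_of_hasDerivAt (hU.self_of_nhds i j)
    have e2 : HasMatrixWirtingerAt V W 0 z := fun i j => hasWirtingerAt_of_hasDerivAt (hV i j)
    simpa using e1.conjTranspose.mul e2
  have h0 : ((U z)ᴴ * U z).det ≠ 0 := fun h => by
    have := hpos.self_of_nhds.2
    rw [h] at this
    simp at this
  obtain ⟨P', hinv⟩ := exists_hasMatrixWirtingerAt_inv hG.self_of_nhds h0
  have hD := (hinv.mul hA).trace
  rw [ddbar_eq_of_hasWirtingerAt (D := fun w => (((U w)ᴴ * U w)⁻¹ * ((U w)ᴴ * V w)).trace) ?_ hD]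
  · congr 1
    rw [Matrix.mul_sub, sub_eq_add_neg, add_comm]
    simp only [Matrix.mul_assoc, Matrix.neg_mul]
  · filter_upwards [hG, hpos] with w hw hpw
    have e1 := hw.det
    set G := (U w)ᴴ * U w with hGdef
    have e0 : G.det ≠ 0 := fun h => by
      have := hpw.2
      rw [h] at this
      simp at this
    have hherm : Gᴴ = G := by rw [hGdef, Matrix.conjTranspose_mul, conjTranspose_conjTranspose]
    have e2 : (G.adjugate * ((V w)ᴴ * U w)).trace =
        star (G.adjugate * ((U w)ᴴ * V w)).trace := by
      rw [← Matrix.trace_conjTranspose, Matrix.conjTranspose_mul, Matrix.conjTranspose_mul,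
        Matrix.conjTranspose_conjTranspose, Matrix.adjugate_conjTranspose, hherm,
        Matrix.trace_mul_comm]
    rw [e2] at e1
    have e3 := e1.log_re hpw.1 hpw.2
    have e4 : (G.adjugate * ((U w)ᴴ * V w)).trace / G.det =
        (G⁻¹ * ((U w)ᴴ * V w)).trace := by
      rw [Matrix.inv_def, Ring.inverse_eq_inv', Matrix.smul_mul, Matrix.trace_smul, smul_eq_mul,
        div_eq_inv_mul]
    rw [e4] at e3
    exact e3

end Wirtinger

/-! ### Hermitian products and Fubini-Study potentials -/

section Hermitian

variable {ι : Type*} [Fintype ι] {E : Type*} [AddCommGroup E] [Module ℂ E]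
  (b : Module.Basis ι ℂ E)

lemma hermInner_smul_right (c : ℂ) (x y : E) : hermInner b x (c • y) = c * hermInner b x y := by
  simp only [hermInner, map_smul, Finsupp.smul_apply, smul_eq_mul, Finset.mul_sum]
  exact Finset.sum_congr rfl fun i _ => by ring

lemma hermInner_smul_left (c : ℂ) (x y : E) :
    hermInner b (c • x) y = conj c * hermInner b x y := by
  simp only [hermInner, map_smul, Finsupp.smul_apply, smul_eq_mul, Finset.mul_sum, map_mul]
  exact Finset.sum_congr rfl fun i _ => by ring

lemma hermInner_self (x : E) : hermInner b x x = hermNormSq b x := by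
  simp only [hermInner, hermNormSq, Complex.ofReal_sum]
  refine Finset.sum_congr rfl fun i _ => ?_
  rw [mul_comm, Complex.mul_conj, Complex.normSq_eq_norm_sq]

lemma hermNormSq_smul (c : ℂ) (x : E) : hermNormSq b (c • x) = ‖c‖ ^ 2 * hermNormSq b x := by
  simp only [hermNormSq, map_smul, Finsupp.smul_apply, smul_eq_mul, norm_mul, mul_pow,
    Finset.mul_sum]

lemma hermNormSq_pos {x : E} (hx : x ≠ 0) : 0 < hermNormSq b x := by
  have h : ∃ i, b.repr x i ≠ 0 := by
    by_contra! h
    exact hx (b.repr.map_eq_zero_iff.1 (Finsupp.ext h))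
  obtain ⟨i, hi⟩ := h
  exact Finset.sum_pos' (fun _ _ => by positivity) ⟨i, Finset.mem_univ _, by positivity⟩

/-- The normalised potential differs from log ‖v‖² by the logarithm of the modulus of a Hermitian
product, which is harmonic along a holomorphic curve. -/
lemma fsPotential_mk (x₀ : ℙ ℂ E) {v : E} (hv : v ≠ 0) (h : hermInner b x₀.rep v ≠ 0) :
    fsPotential b x₀ (Projectivization.mk ℂ v hv) =
      Real.log (hermNormSq b v) - 2 * Real.log ‖hermInner b x₀.rep v‖ := by
  obtain ⟨c, hc⟩ := Projectivization.exists_smul_eq_mk_rep ℂ v hv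
  have hc0 : (c : ℂ) ≠ 0 := c.ne_zero
  rw [fsPotential, ← hc, Units.smul_def, hermInner_smul_right, smul_smul, hermNormSq_smul]
  have e1 : (c * hermInner b x₀.rep v)⁻¹ * (c : ℂ) = (hermInner b x₀.rep v)⁻¹ := by
    field_simp
  have e2 : ‖hermInner b x₀.rep v‖ ≠ 0 := norm_ne_zero_iff.2 h
  rw [e1, norm_inv, Real.log_mul (by positivity) (hermNormSq_pos b hv).ne', Real.log_pow,
    Real.log_inv]
  push_cast
  ring

lemma hermInner_rep_mk_ne_zero {v : E} (hv : v ≠ 0) :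
    hermInner b (Projectivization.mk ℂ v hv).rep v ≠ 0 := by
  obtain ⟨c, hc⟩ := Projectivization.exists_smul_eq_mk_rep ℂ v hv
  rw [← hc, Units.smul_def, hermInner_smul_left, hermInner_self]
  exact mul_ne_zero ((map_ne_zero _).2 c.ne_zero)
    (Complex.ofReal_ne_zero.2 (hermNormSq_pos b hv).ne')

/-- Any local holomorphic lift v computes the Fubini-Study form, since the chart normalisation
contributes a harmonic term. -/
lemma fsPullback_eq_ddbar {S : Type*} [TopologicalSpace S] {F : S → ℙ ℂ E}
    {e : OpenPartialHomeomorph S ℂ} {z : ℂ} {v : ℂ → E} (hv : ∀ w, v w ≠ 0)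
    (hF : ∀ᶠ w in 𝓝 z, F (e.symm w) = Projectivization.mk ℂ (v w) (hv w))
    (han : ∀ x : E, AnalyticAt ℂ (fun w => hermInner b x (v w)) z)
    (hlog : ContDiffAt ℝ 2 (fun w => Real.log (hermNormSq b (v w))) z) :
    fsPullback b F e z = ddbar (fun w => Real.log (hermNormSq b (v w))) z := by
  set x₀ := F (e.symm z)
  have h0 : hermInner b x₀.rep (v z) ≠ 0 := by
    have : x₀ = Projectivization.mk ℂ (v z) (hv z) := hF.self_of_nhds
    rw [this]
    exact hermInner_rep_mk_ne_zero b (hv z)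
  have h1 : (fun w => fsPotential b x₀ (F (e.symm w))) =ᶠ[𝓝 z] fun w =>
      Real.log (hermNormSq b (v w)) + (-2) * Real.log ‖hermInner b x₀.rep (v w)‖ := by
    filter_upwards [hF, (han x₀.rep).continuousAt.eventually_ne h0] with w hw hw'
    rw [hw, fsPotential_mk b x₀ (hv w) hw']
    ring
  obtain ⟨h2, h3⟩ := ddbar_log_norm (han x₀.rep) h0
  rw [fsPullback, ddbar_congr h1, ddbar_add hlog (contDiffAt_const.mul h2), ddbar_const_mul _ h2,
    h3, mul_zero, add_zero]

end Hermitian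

/-! ### Wedge products -/

section Wedge

variable {n k : ℕ}

lemma stdBasis_repr (v : V n) (a : Fin (n + n)) :
    (stdBasis n).repr v a = v (finSumFinEquiv.symm a) := by
  simp [stdBasis]

lemma wedgeBasis_repr_ιMulti (x : Fin k → V n) (t : Set.powersetCard (Fin (n + n)) k) :
    (wedgeBasis n k).repr (exteriorPower.ιMulti ℂ k x) t =
      (Matrix.of fun i j =>
        x i (finSumFinEquiv.symm (Set.powersetCard.ofFinEmbEquiv.symm t j))).det := by
  rw [exteriorPower.basis_repr_apply, exteriorPower.ιMultiDual_apply_ιMulti]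
  simp only [Module.Basis.coord_apply, stdBasis_repr]

/-- The Cauchy-Binet formula. -/
lemma hermInner_ιMulti (x y : Fin k → V n) :
    hermInner (wedgeBasis n k) (exteriorPower.ιMulti ℂ k x) (exteriorPower.ιMulti ℂ k y) =
      (Matrix.of fun i j => ∑ a, conj (x i a) * y j a).det := by
  -- The functionals conj x_i turn the Hermitian product with x₁ ∧ ⋯ ∧ x_k into the pairing with f₁
  -- ∧ ⋯ ∧ f_k. Equality is checked on the wedge basis, after which the pairing on decomposable
  -- vectors is a determinant.
  let f : Fin k → Module.Dual ℂ (V n) := fun i => ∑ a, conj (x i a) • LinearMap.proj a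
  have hf : ∀ i v, f i v = ∑ a, conj (x i a) * v a := fun i v => by
    simp [f, LinearMap.sum_apply]
  have h : (∑ t, conj ((wedgeBasis n k).repr (exteriorPower.ιMulti ℂ k x) t) •
      (wedgeBasis n k).coord t) =
      exteriorPower.pairingDual ℂ (V n) k (exteriorPower.ιMulti ℂ k f) := by
    refine (wedgeBasis n k).ext fun t => ?_
    have e1 : exteriorPower.pairingDual ℂ (V n) k (exteriorPower.ιMulti ℂ k f)
        (wedgeBasis n k t) = (Matrix.of fun i j =>
          conj (x j (finSumFinEquiv.symm (Set.powersetCard.ofFinEmbEquiv.symm t i)))).det := by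
      rw [exteriorPower.basis_apply, exteriorPower.ιMulti_family,
        exteriorPower.pairingDual_ιMulti_ιMulti]
      congr 1
      ext i j
      simp only [Matrix.of_apply, hf]
      rw [Finset.sum_eq_single (finSumFinEquiv.symm (Set.powersetCard.ofFinEmbEquiv.symm t i))]
      · simp [stdBasis]
      · intro a _ ha
        simp [stdBasis, ha]
      · simp
    rw [e1]
    simp only [LinearMap.sum_apply, LinearMap.smul_apply, Module.Basis.coord_apply,
      Module.Basis.repr_self, smul_eq_mul]
    rw [Finset.sum_eq_single t]
    · rw [Finsupp.single_eq_same, mul_one, wedgeBasis_repr_ιMulti, ← Matrix.det_transpose,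
        RingHom.map_det]
      rfl
    · intro s _ hs
      rw [Finsupp.single_eq_of_ne hs, mul_zero]
    · simp
  have h1 := LinearMap.congr_fun h (exteriorPower.ιMulti ℂ k y)
  rw [exteriorPower.pairingDual_ιMulti_ιMulti] at h1
  simp only [LinearMap.sum_apply, LinearMap.smul_apply, Module.Basis.coord_apply,
    smul_eq_mul, hf] at h1
  rw [hermInner, h1, ← Matrix.det_transpose]
  rfl

lemma ιMulti_linearCombination (A : Matrix (Fin k) (Fin k) ℂ) (u : Fin k → V n) :
    exteriorPower.ιMulti ℂ k (fun j => ∑ i, A i j • u i) =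
      A.det • exteriorPower.ιMulti ℂ k u := by
  refine (wedgeBasis n k).repr.injective (Finsupp.ext fun t => ?_)
  rw [map_smul, Finsupp.smul_apply, wedgeBasis_repr_ιMulti, wedgeBasis_repr_ιMulti, smul_eq_mul,
    ← Matrix.det_transpose A, ← Matrix.det_mul]
  congr 1
  ext i j
  simp [Matrix.mul_apply, Finset.sum_apply]

lemma stdVec_of_ne {a c : Idx n} (h : a ≠ c) : stdVec n c a = 0 := Pi.single_eq_of_ne h 1

lemma act_stdVec (g : SO n) (c : Idx n) : act g (stdVec n c) = fun a => mat g a c := by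
  ext a
  simp [act, stdVec]

/-- The vector `g u₁ ∧ ⋯ ∧ g u_k`. -/
def wedgeAct (g : SO n) (c : Fin k → Idx n) : ⋀[ℂ]^k (V n) :=
  exteriorPower.map k (act g) (wedgeVec n c)

lemma wedgeAct_eq (g : SO n) (c : Fin k → Idx n) :
    wedgeAct g c = exteriorPower.ιMulti ℂ k (fun j a => mat g a (c j)) := by
  rw [wedgeAct, wedgeVec, exteriorPower.map_apply_ιMulti]
  congr 1
  funext j
  exact act_stdVec g (c j)

lemma wedgeAct_ne_zero (g : SO n) {c : Fin k → Idx n} (hc : Function.Injective c) :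
    wedgeAct g c ≠ 0 := by
  intro h
  refine wedgeVec_ne_zero n c hc (exteriorPower.map_injective_field (act_injective g) ?_)
  rw [map_zero]
  exact h

lemma hermInner_wedgeAct (g g' : SO n) (c : Fin k → Idx n) :
    hermInner (wedgeBasis n k) (wedgeAct g c) (wedgeAct g' c) =
      (((mat g)ᴴ * mat g').submatrix c c).det := by
  rw [wedgeAct_eq, wedgeAct_eq, hermInner_ιMulti]
  rfl

/-- If b preserves the coordinate subspace of c, it acts on its top exterior power by a determinant.
This makes the Plücker maps well defined on cosets. -/
lemma wedgeAct_mul (g b : SO n) {c : Fin k → Idx n}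
    (hc : Function.Injective c) (hb : ∀ i ∉ Set.range c, ∀ j, mat b i (c j) = 0) :
    wedgeAct (g * b) c = ((mat b).submatrix c c).det • wedgeAct g c := by
  have h1 : wedgeAct b c = ((mat b).submatrix c c).det • wedgeVec n c := by
    rw [wedgeAct_eq, wedgeVec, ← ιMulti_linearCombination]
    congr 1
    funext j
    ext a
    simp only [Matrix.submatrix_apply, Finset.sum_apply, Pi.smul_apply, smul_eq_mul]
    by_cases ha : a ∈ Set.range c
    · obtain ⟨i, rfl⟩ := ha
      rw [Finset.sum_eq_single i]
      · simp
      · intro l _ hl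
        rw [stdVec_of_ne (fun h => hl (hc h).symm), mul_zero]
      · simp
    · rw [hb a ha j, Finset.sum_eq_zero]
      intro l _
      rw [stdVec_of_ne (fun h => ha ⟨l, h.symm⟩), mul_zero]
  have h2 : wedgeAct (g * b) c = exteriorPower.map k (act g) (wedgeAct b c) := by
    rw [wedgeAct, act_mul, exteriorPower.map_comp]
    rfl
  rw [h2, h1, map_smul]
  rfl

end Wedge

section Group

variable {n : ℕ}

/-! ### Matrices preserving the quadratic form -/

lemma gram_apply (i j : Idx n) : gram n i j = if i = j.swap then 1 else 0 := by
  rcases i with i | i <;> rcases j with j | j <;>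
    simp [gram, LieAlgebra.Orthogonal.JD, Matrix.one_apply]

lemma gram_mul_apply (A : Matrix (Idx n) (Idx n) ℂ) (i j : Idx n) :
    (gram n * A) i j = A i.swap j := by
  rw [Matrix.mul_apply, Finset.sum_eq_single i.swap]
  · simp [gram_apply]
  · intro k _ hk
    rw [gram_apply, if_neg (fun h => hk (by rw [h, Sum.swap_swap])), zero_mul]
  · simp

lemma mul_gram_apply (A : Matrix (Idx n) (Idx n) ℂ) (i j : Idx n) :
    (A * gram n) i j = A i j.swap := by
  rw [Matrix.mul_apply, Finset.sum_eq_single j.swap]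
  · simp [gram_apply]
  · intro k _ hk
    rw [gram_apply, if_neg hk, mul_zero]
  · simp

lemma gram_mul_gram : gram n * gram n = 1 := by
  ext i j
  rw [gram_mul_apply, gram_apply, Matrix.one_apply]
  refine if_congr ⟨fun h => ?_, fun h => by rw [h]⟩ rfl rfl
  rw [← Sum.swap_swap i, h, Sum.swap_swap]

/-- `M` preserves the quadratic form. -/
def IsOrthogonal (M : Matrix (Idx n) (Idx n) ℂ) : Prop := Mᵀ * gram n * M = gram n

lemma isOrthogonal_mat (g : SO n) : IsOrthogonal (mat g) := g.2

lemma det_mat (g : SO n) : (mat g).det = 1 := g.1.2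

lemma isUnit_det_mat (g : SO n) : IsUnit (mat g).det := by
  rw [det_mat]
  exact isUnit_one

variable {M : Matrix (Idx n) (Idx n) ℂ}

lemma IsOrthogonal.inv_mul (h : IsOrthogonal M) : gram n * Mᵀ * gram n * M = 1 := by
  rw [Matrix.mul_assoc, Matrix.mul_assoc, ← Matrix.mul_assoc Mᵀ, h, gram_mul_gram]

lemma IsOrthogonal.mul_inv (h : IsOrthogonal M) : M * (gram n * Mᵀ * gram n) = 1 :=
  mul_eq_one_comm.1 h.inv_mul

lemma IsOrthogonal.mul_gram_mul (h : IsOrthogonal M) : M * gram n * Mᵀ = gram n := by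
  have h1 := congrArg (· * gram n) h.mul_inv
  simp only [Matrix.mul_assoc, gram_mul_gram, Matrix.mul_one, Matrix.one_mul] at h1
  rw [Matrix.mul_assoc, h1]

lemma conjTranspose_gram : (gram n)ᴴ = gram n := by
  ext i j
  rw [Matrix.conjTranspose_apply, gram_apply, gram_apply]
  have : (j = i.swap) ↔ (i = j.swap) :=
    ⟨fun h => by rw [h, Sum.swap_swap], fun h => by rw [h, Sum.swap_swap]⟩
  simp only [this]
  split_ifs <;> simp

lemma transpose_gram : (gram n)ᵀ = gram n := by
  ext i j
  rw [Matrix.transpose_apply, gram_apply, gram_apply]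
  exact if_congr ⟨fun h => by rw [h, Sum.swap_swap], fun h => by rw [h, Sum.swap_swap]⟩ rfl rfl

lemma IsOrthogonal.mul {N : Matrix (Idx n) (Idx n) ℂ} (h : IsOrthogonal M)
    (h' : IsOrthogonal N) : IsOrthogonal (M * N) := by
  rw [IsOrthogonal, Matrix.transpose_mul]
  calc _ = Nᵀ * (Mᵀ * gram n * M) * N := by simp only [Matrix.mul_assoc]
    _ = _ := by rw [h, h']

lemma IsOrthogonal.conjTranspose (h : IsOrthogonal M) : IsOrthogonal Mᴴ := by
  have h1 := congrArg Matrix.conjTranspose h.mul_gram_mul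
  simp only [Matrix.conjTranspose_mul, conjTranspose_gram] at h1
  rw [IsOrthogonal, Matrix.mul_assoc]
  exact h1

lemma IsOrthogonal.conjTranspose_mul_self (h : IsOrthogonal M) : IsOrthogonal (Mᴴ * M) :=
  h.conjTranspose.mul h

lemma IsOrthogonal.isSelfDual (h : IsOrthogonal M) : IsSelfDual Sum.swap M := by
  intro i k
  have h1 := congrFun (congrFun h.mul_gram_mul i) k
  rw [gram_apply, Matrix.mul_apply] at h1
  have e : (k = i.swap) ↔ (i = k.swap) :=
    ⟨fun h => by rw [h, Sum.swap_swap], fun h => by rw [h, Sum.swap_swap]⟩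
  simp only [e]
  rw [← h1, ← Equiv.sum_comp (Equiv.sumComm _ _)]
  refine Finset.sum_congr rfl fun j _ => ?_
  rw [mul_gram_apply, Matrix.transpose_apply, Equiv.sumComm_apply, Sum.swap_swap]

lemma IsOrthogonal.sum_mul_swap (h : IsOrthogonal M) (k l : Idx n) :
    ∑ i, M i k * M i.swap l = if l = k.swap then 1 else 0 := by
  have h1 := congrFun (congrFun h k) l
  rw [gram_apply, Matrix.mul_apply] at h1
  have e : (l = k.swap) ↔ (k = l.swap) :=
    ⟨fun h => by rw [h, Sum.swap_swap], fun h => by rw [h, Sum.swap_swap]⟩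
  simp only [e]
  rw [← h1, ← Equiv.sum_comp (Equiv.sumComm _ _)]
  refine Finset.sum_congr rfl fun j _ => ?_
  rw [mul_gram_apply, Matrix.transpose_apply, Equiv.sumComm_apply, Sum.swap_swap]

/-! ### The flags `i_±` -/

lemma flagIdx_symm_inl (ε : Bool) (i : Fin n) :
    ((flagIdx n ε).symm (Sum.inl i)).val = if ε = false ∧ i.1 + 1 = n then n else i.1 := by
  cases ε
  · by_cases h : i.1 + 1 = n
    · simp [flagIdx, swapLast, h, Function.Involutive.toPerm]
    · simp [flagIdx, swapLast, h, Function.Involutive.toPerm]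
  · simp [flagIdx]

lemma flagIdx_symm_inr (ε : Bool) (i : Fin n) :
    ((flagIdx n ε).symm (Sum.inr i)).val =
      if ε = false ∧ i.1 + 1 = n then n - 1 else 2 * n - 1 - i.1 := by
  cases ε
  · by_cases h : i.1 + 1 = n
    · simp [flagIdx, swapLast, h, Function.Involutive.toPerm]
      omega
    · simp [flagIdx, swapLast, h, Function.Involutive.toPerm]
      omega
  · simp [flagIdx]
    omega

/-- The indices of the first `k` vectors of the basis adapted to the flag `i_±`. -/
def flagSet (n : ℕ) (ε : Bool) (k : ℕ) : Finset (Idx n) :=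
  Finset.univ.filter fun a => ((flagIdx n ε).symm a).val < k

lemma mem_flagSet {ε : Bool} {k : ℕ} {a : Idx n} :
    a ∈ flagSet n ε k ↔ ((flagIdx n ε).symm a).val < k := by simp [flagSet]

lemma mem_flagSet_iff_range {ε : Bool} {k : ℕ} (hk : k ≤ n + n) (a : Idx n) :
    a ∈ flagSet n ε k ↔ a ∈ Set.range fun j : Fin k => flagIdx n ε (Fin.castLE hk j) := by
  rw [mem_flagSet]
  constructor
  · intro h
    refine ⟨⟨_, h⟩, ?_⟩
    exact (flagIdx n ε).apply_symm_apply a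
  · rintro ⟨j, rfl⟩
    simp

lemma flagSet_zero (ε : Bool) : flagSet n ε 0 = ∅ := by
  ext a
  simp [mem_flagSet]

lemma flagSet_succ (ε : Bool) {k : ℕ} (hk : k < n + n) :
    flagSet n ε (k + 1) = insert (flagIdx n ε ⟨k, hk⟩) (flagSet n ε k) := by
  ext a
  rw [Finset.mem_insert, mem_flagSet, mem_flagSet, ← Equiv.symm_apply_eq, Fin.ext_iff]
  change _ ↔ ((flagIdx n ε).symm a).val = k ∨ _
  omega

lemma flagIdx_notMem_flagSet (ε : Bool) {k : ℕ} (hk : k < n + n) :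
    flagIdx n ε ⟨k, hk⟩ ∉ flagSet n ε k := by
  simp [mem_flagSet]

lemma principalMinor_flagSet (H : Matrix (Idx n) (Idx n) ℂ) (ε : Bool) {k : ℕ} (hk : k ≤ n + n) :
    principalMinor H (flagSet n ε k) =
      (H.submatrix (fun j : Fin k => flagIdx n ε (Fin.castLE hk j))
        fun j : Fin k => flagIdx n ε (Fin.castLE hk j)).det :=
  principalMinor_eq_det _ ((flagIdx n ε).injective.comp (Fin.castLE_injective hk))
    (mem_flagSet_iff_range hk)

/-! ### The Borel subgroup -/

lemma mem_isoFlag {k : ℕ} {v : V n} : v ∈ isoFlag n k ↔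
    (∀ i : Fin n, v (Sum.inr i) = 0) ∧ ∀ i : Fin n, k ≤ i.1 → v (Sum.inl i) = 0 := by
  constructor
  · intro h
    refine Submodule.span_induction (p := fun v _ => (∀ i : Fin n, v (Sum.inr i) = 0) ∧
      ∀ i : Fin n, k ≤ i.1 → v (Sum.inl i) = 0) ?_ ?_ ?_ ?_ h
    · rintro _ ⟨j, hj, rfl⟩
      refine ⟨fun i => stdVec_of_ne (by simp), fun i hi => stdVec_of_ne ?_⟩
      rintro ⟨⟩
      omega
    · simp
    · intro x y _ _ hx hy
      exact ⟨fun i => by simp [hx.1, hy.1], fun i hi => by simp [hx.2 i hi, hy.2 i hi]⟩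
    · intro c x _ hx
      exact ⟨fun i => by simp [hx.1], fun i hi => by simp [hx.2 i hi]⟩
  · rintro ⟨h1, h2⟩
    have hv : v = ∑ i : Fin n, v (Sum.inl i) • stdVec n (Sum.inl i) := by
      ext a
      rw [Finset.sum_apply]
      rcases a with a | a
      · rw [Finset.sum_eq_single a]
        · simp
        · intro b _ hb
          rw [Pi.smul_apply, stdVec_of_ne (by simpa using hb.symm), smul_zero]
        · simp
      · rw [h1, Finset.sum_eq_zero]
        intro b _
        rw [Pi.smul_apply, stdVec_of_ne (by simp), smul_zero]
    rw [hv]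
    refine Submodule.sum_mem _ fun i _ => ?_
    by_cases hi : i.1 < k
    · exact Submodule.smul_mem _ _ (Submodule.subset_span ⟨i, hi, rfl⟩)
    · rw [h2 i (not_lt.1 hi), zero_smul]
      exact Submodule.zero_mem _

lemma stdVec_inl_mem_isoFlag (i : Fin n) : stdVec n (Sum.inl i) ∈ isoFlag n (i.1 + 1) :=
  Submodule.subset_span ⟨i, Nat.lt_succ_self _, rfl⟩

lemma borel_mulVec_mem {b : SO n} (hb : b ∈ borel n) (i : Fin n) :
    (∀ j : Fin n, mat b (Sum.inr j) (Sum.inl i) = 0) ∧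
      ∀ j : Fin n, i < j → mat b (Sum.inl j) (Sum.inl i) = 0 := by
  have h1 : act b (stdVec n (Sum.inl i)) ∈ isoFlag n (i.1 + 1) := by
    have h2 : (isoFlag n (i.1 + 1)).map (act b) = isoFlag n (i.1 + 1) := hb _
    rw [← h2]
    exact Submodule.mem_map_of_mem (stdVec_inl_mem_isoFlag i)
  rw [act_stdVec, mem_isoFlag] at h1
  exact ⟨h1.1, fun j hj => h1.2 j hj⟩

lemma inv_apply_eq (b : SO n) (i j : Idx n) : mat b⁻¹ i j = mat b j.swap i.swap := by
  have h1 : mat b * mat b⁻¹ = 1 := by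
    have : mat (b * b⁻¹) = mat b * mat b⁻¹ := rfl
    rw [← this, mul_inv_cancel]
    rfl
  have h2 : mat b⁻¹ = gram n * (mat b)ᵀ * gram n := by
    calc mat b⁻¹ = (gram n * (mat b)ᵀ * gram n * mat b) * mat b⁻¹ := by
          rw [(isOrthogonal_mat b).inv_mul, Matrix.one_mul]
      _ = _ := by rw [Matrix.mul_assoc, h1, Matrix.mul_one]
  rw [h2, mul_gram_apply, gram_mul_apply, Matrix.transpose_apply]

/-- The inverse of b is upper triangular on the e_i, and inverting an orthogonal matrix exchanges e
and f and transposes. -/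
lemma borel_inr_inr {b : SO n} (hb : b ∈ borel n) {i j : Fin n} (hij : i < j) :
    mat b (Sum.inr i) (Sum.inr j) = 0 := by
  have h := (borel_mulVec_mem (inv_mem hb) i).2 j hij
  rw [inv_apply_eq] at h
  exact h

/-- This is why B also preserves the second Lagrangian ⟨e₁, …, eₙ₋₁, fₙ⟩, hence the flag i₋. -/
lemma borel_last {b : SO n} (hb : b ∈ borel n) {i : Fin n} (hi : i.1 + 1 = n) :
    mat b (Sum.inl i) (Sum.inr i) = 0 := by
  have hrr : ∀ j, j ≠ i → mat b (Sum.inr j) (Sum.inr i) = 0 := fun j hj =>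
    borel_inr_inr hb (lt_of_le_of_ne (Fin.le_def.2 (by omega)) hj)
  -- Isotropy of b fₙ says that twice the product of its eₙ and fₙ coefficients is zero, and Q(b fₙ,
  -- b eₙ) = 1 forces the latter coefficient to be nonzero.
  have h1 := (isOrthogonal_mat b).sum_mul_swap (Sum.inr i) (Sum.inr i)
  rw [if_neg (by simp), Fintype.sum_sum_type, Finset.sum_eq_single i, Finset.sum_eq_single i] at h1
  · have h2 := (isOrthogonal_mat b).sum_mul_swap (Sum.inr i) (Sum.inl i)
    rw [if_pos (by simp), Fintype.sum_sum_type, Finset.sum_eq_zero, zero_add,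
      Finset.sum_eq_single i] at h2
    · have h3 : mat b (Sum.inr i) (Sum.inr i) ≠ 0 := fun h => by
        rw [h, zero_mul] at h2
        exact zero_ne_one h2
      simp only [Sum.swap_inl, Sum.swap_inr] at h1
      have h4 : 2 * (mat b (Sum.inl i) (Sum.inr i) * mat b (Sum.inr i) (Sum.inr i)) = 0 := by
        rw [two_mul]
        nth_rewrite 2 [mul_comm]
        exact h1
      simpa [h3] using h4
    · intro j _ hj
      rw [hrr j hj, zero_mul]
    · simp
    · intro j _
      rw [Sum.swap_inl, (borel_mulVec_mem hb i).1, mul_zero]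
  · intro j _ hj
    rw [hrr j hj, zero_mul]
  · simp
  · intro j _ hj
    rw [Sum.swap_inl, hrr j hj, mul_zero]
  · simp

/-- The elements of `B` are upper triangular in the bases adapted to both flags. -/
lemma borel_upper_triangular (ε : Bool) {b : SO n} (hb : b ∈ borel n) {i j : Idx n}
    (h : mat b i j ≠ 0) :
    ((flagIdx n ε).symm i).val ≤ ((flagIdx n ε).symm j).val := by
  rcases i with i | i <;> rcases j with j | j
  · have h1 : i ≤ j := by
      by_contra hij
      exact h ((borel_mulVec_mem hb j).2 i (not_le.1 hij))
    rw [flagIdx_symm_inl, flagIdx_symm_inl]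
    have := i.2; have := j.2; have : i.1 ≤ j.1 := h1
    cases ε <;> simp only [Bool.true_eq_false, false_and, true_and, if_false] <;>
      (try split_ifs) <;> omega
  · rw [flagIdx_symm_inl, flagIdx_symm_inr]
    have h1 : ¬ (i.1 + 1 = n ∧ j.1 + 1 = n) := fun h1 => by
      have : i = j := Fin.ext (by omega)
      subst this
      exact h (borel_last hb h1.1)
    have := i.2; have := j.2
    cases ε <;> simp only [Bool.true_eq_false, false_and, true_and, if_false] <;>
      (try split_ifs) <;> omega
  · exact absurd ((borel_mulVec_mem hb j).1 i) h
  · have h1 : j ≤ i := by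
      by_contra hij
      exact h (borel_inr_inr hb (not_le.1 hij))
    rw [flagIdx_symm_inr, flagIdx_symm_inr]
    have := i.2; have := j.2; have : j.1 ≤ i.1 := h1
    cases ε <;> simp only [Bool.true_eq_false, false_and, true_and, if_false] <;>
      (try split_ifs) <;> omega

lemma wedgeAct_mul_borel (ε : Bool) {k : ℕ} (hk : k ≤ n + n) (g : SO n) {b : SO n}
    (hb : b ∈ borel n) : ∃ c : ℂ, c ≠ 0 ∧
      wedgeAct (g * b) (fun j : Fin k => flagIdx n ε (Fin.castLE hk j)) =
        c • wedgeAct g (fun j : Fin k => flagIdx n ε (Fin.castLE hk j)) := by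
  set c := fun j : Fin k => flagIdx n ε (Fin.castLE hk j)
  have hc : Function.Injective c := (flagIdx n ε).injective.comp (Fin.castLE_injective hk)
  have h := wedgeAct_mul g b hc fun i hi j => by
    by_contra hne
    refine hi ((mem_flagSet_iff_range hk i).1 (mem_flagSet.2 ?_))
    refine lt_of_le_of_lt (borel_upper_triangular ε hb hne) ?_
    simp [c]
  refine ⟨_, fun h0 => ?_, h⟩
  rw [h0, zero_smul] at h
  exact wedgeAct_ne_zero _ hc h

/-- The chosen representative of a coset need not vary holomorphically; an element of B only
rescales the vector, so it may be replaced by the value of a holomorphic lift. -/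
lemma wedgeOrbit_mk (ε : Bool) {k : ℕ} (hk : k ≤ n + n) (g : SO n) (x : SO n ⧸ borel n)
    (hx : (QuotientGroup.mk g : SO n ⧸ borel n) = x) :
    wedgeOrbit n (fun j : Fin k => flagIdx n ε (Fin.castLE hk j))
      ((flagIdx n ε).injective.comp (Fin.castLE_injective hk)) x =
    Projectivization.mk ℂ (wedgeAct g fun j : Fin k => flagIdx n ε (Fin.castLE hk j))
      (wedgeAct_ne_zero g ((flagIdx n ε).injective.comp (Fin.castLE_injective hk))) := by
  obtain ⟨b, hb⟩ := QuotientGroup.mk_out_eq_mul (borel n) g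
  rw [hx] at hb
  obtain ⟨c, hc0, hc⟩ := wedgeAct_mul_borel ε hk g b.2
  rw [wedgeOrbit, Projectivization.map_mk, Projectivization.mk_eq_mk_iff']
  refine ⟨c, ?_⟩
  rw [← hc, ← hb]
  rfl

lemma hermNormSq_wedgeAct (ε : Bool) {k : ℕ} (hk : k ≤ n + n) (g : SO n) :
    hermNormSq (wedgeBasis n k) (wedgeAct g fun j : Fin k => flagIdx n ε (Fin.castLE hk j)) =
      gramDet (mat g) (flagSet n ε k) := by
  have h := hermInner_wedgeAct g g fun j : Fin k => flagIdx n ε (Fin.castLE hk j)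
  rw [hermInner_self, ← principalMinor_flagSet, ← coe_gramDet (isUnit_det_mat g)] at h
  exact_mod_cast h

end Group

/-! ### Gram determinants of holomorphic frames -/

section Frames

variable {ι : Type*} [Fintype ι] [DecidableEq ι] {M : ℂ → Matrix ι ι ℂ} {z : ℂ}

lemma contDiffAt_gramDet (hM : ∀ i j, AnalyticAt ℂ (fun w => M w i j) z) (s : Finset ι) :
    ContDiffAt ℝ 2 (fun w => gramDet (M w) s) z := by
  have h1 : ∀ i j, ContDiffAt ℝ 2 (fun w => M w i j) z := fun i j =>
    ((hM i j).contDiffAt (n := 2)).restrict_scalars ℝ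
  have h2 : ∀ i j, ContDiffAt ℝ 2 (fun w => ((M w)ᴴ * M w) i j) z := by
    intro i j
    simp only [Matrix.mul_apply, Matrix.conjTranspose_apply]
    exact ContDiffAt.sum fun k _ =>
      ((Complex.conjCLE.contDiff (n := 2)).contDiffAt.comp z (h1 k i)).mul (h1 k j)
  have h3 : ContDiffAt ℝ 2 (fun w => principalMinor ((M w)ᴴ * M w) s) z := by
    simp only [principalMinor, Matrix.det_apply']
    exact ContDiffAt.sum fun σ _ => contDiffAt_const.mul (contDiffAt_prod fun i _ => h2 _ _)
  exact Complex.reCLM.contDiff.contDiffAt.comp z h3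

lemma contDiffAt_log_gramDet (hM : ∀ i j, AnalyticAt ℂ (fun w => M w i j) z)
    (h0 : IsUnit (M z).det) (s : Finset ι) :
    ContDiffAt ℝ 2 (fun w => Real.log (gramDet (M w) s)) z :=
  (contDiffAt_gramDet hM s).log (gramDet_pos h0 s).ne'

/-- The second derivative of M enters only the holomorphic derivative of the logarithmic gradient,
so X = M⁻¹ M' at the single point z determines the value. -/
lemma ddbar_log_gramDet (hM : ∀ i j, AnalyticAt ℂ (fun w => M w i j) z)
    (h0 : ∀ᶠ w in 𝓝 z, IsUnit (M w).det) {X : Matrix ι ι ℂ}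
    (hX : ∀ i j, deriv (fun w => M w i j) z = (M z * X) i j) (s : Finset ι) :
    ddbar (fun w => Real.log (gramDet (M w) s)) z =
      (gramCurvature ((M z)ᴴ * M z) X s).re := by
  let U : ℂ → Matrix ι s ℂ := fun w => (M w).submatrix id Subtype.val
  let V : ℂ → Matrix ι s ℂ := fun w => Matrix.of fun i j => deriv (fun w => M w i j) w
  have hV : V z = (M z * X).submatrix id Subtype.val := by
    ext i j
    exact hX i j
  have h1 := ddbar_log_det_gram (z := z) (U := U) (V := V)
    (W := Matrix.of fun i j => deriv (deriv (fun w => M w i j)) z)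
    (by
      have : ∀ᶠ w in 𝓝 z, ∀ i j, AnalyticAt ℂ (fun w => M w i j) w := by
        rw [eventually_all]
        intro i
        rw [eventually_all]
        exact fun j => (hM i j).eventually_analyticAt
      filter_upwards [this] with w hw i j
      exact (hw i j).differentiableAt.hasDerivAt)
    (fun i j => (hM i j).deriv.differentiableAt.hasDerivAt)
    (by
      filter_upwards [h0] with w hw
      exact ⟨(coe_gramDet hw s).symm, gramDet_pos hw s⟩)
  rw [← trace_eq_gramCurvature, ← hV]
  exact h1

lemma ddbar_log_gramDet_of_single (hM : ∀ i j, AnalyticAt ℂ (fun w => M w i j) z)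
    (h0 : ∀ᶠ w in 𝓝 z, IsUnit (M w).det) {X : Matrix ι ι ℂ}
    (hX : ∀ i j, deriv (fun w => M w i j) z = (M z * X) i j) {s : Finset ι} {r t : ι}
    (hr : r ∈ s) (ht : t ∉ s) (hX' : ∀ i ∉ s, ∀ j ∈ s, X i j ≠ 0 → i = t ∧ j = r) :
    ddbar (fun w => Real.log (gramDet (M w) s)) z =
      ‖X t r‖ ^ 2 * (gramDet (M z) (insert t s) * gramDet (M z) (s.erase r)) /
        gramDet (M z) s ^ 2 := by
  have hu := h0.self_of_nhds
  have h1 := gramCurvature_of_single hr ht (principalMinor_ne_zero hu s)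
    (principalMinor_ne_zero hu _) hX'
  have h2 : star (X t r) * X t r = ((‖X t r‖ ^ 2 : ℝ) : ℂ) := by
    rw [mul_comm, Complex.star_def, Complex.mul_conj, Complex.normSq_eq_norm_sq]
  rw [← coe_gramDet hu, ← coe_gramDet hu, ← coe_gramDet hu, h2] at h1
  have h3 : (gramDet (M z) s : ℂ) ≠ 0 := Complex.ofReal_ne_zero.2 (gramDet_pos hu s).ne'
  have h4 : gramCurvature ((M z)ᴴ * M z) X s = ((‖X t r‖ ^ 2 * (gramDet (M z) (insert t s) *
      gramDet (M z) (s.erase r)) / gramDet (M z) s ^ 2 : ℝ) : ℂ) := by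
    push_cast
    rw [eq_div_iff (pow_ne_zero 2 h3), h1]
    push_cast
    ring
  rw [ddbar_log_gramDet hM h0 hX, h4, Complex.ofReal_re]

lemma ddbar_log_gramDet_of_lagrangian (hM : ∀ i j, AnalyticAt ℂ (fun w => M w i j) z)
    (h0 : ∀ᶠ w in 𝓝 z, IsUnit (M w).det) {X : Matrix ι ι ℂ}
    (hX : ∀ i j, deriv (fun w => M w i j) z = (M z * X) i j) {σ : ι → ι}
    (hσ : Function.Involutive σ) (hH : IsSelfDual σ ((M z)ᴴ * M z)) {s : Finset ι}
    (hs : ∀ i, σ i ∈ s ↔ i ∉ s) {r t : ι} (hr : r ∈ s) (ht : t ∈ s) (hrt : r ≠ t)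
    (hX' : ∀ i ∈ s, ∀ j ∈ s, X (σ i) j ≠ 0 → (i = t ∧ j = r) ∨ (i = r ∧ j = t))
    (hX'' : X (σ r) t = - X (σ t) r) :
    ddbar (fun w => Real.log (gramDet (M w) s)) z =
      2 * (‖X (σ t) r‖ ^ 2 * gramDet (M z) ((s.erase r).erase t) / gramDet (M z) s) := by
  have hu := h0.self_of_nhds
  have h1 := gramCurvature_of_lagrangian hσ hH hs (principalMinor_ne_zero hu s) hr ht hrt
    hX' hX''
  have h2 : star (X (σ t) r) * X (σ t) r = ((‖X (σ t) r‖ ^ 2 : ℝ) : ℂ) := by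
    rw [mul_comm, Complex.star_def, Complex.mul_conj, Complex.normSq_eq_norm_sq]
  rw [← coe_gramDet hu, ← coe_gramDet hu, h2] at h1
  have h3 : (gramDet (M z) s : ℂ) ≠ 0 := Complex.ofReal_ne_zero.2 (gramDet_pos hu s).ne'
  have h4 : gramCurvature ((M z)ᴴ * M z) X s = ((2 * (‖X (σ t) r‖ ^ 2 *
      gramDet (M z) ((s.erase r).erase t) / gramDet (M z) s) : ℝ) : ℂ) := by
    rw [eq_comm, ← mul_left_inj' h3, h1]
    push_cast
    field_simp
  rw [ddbar_log_gramDet hM h0 hX, h4, Complex.ofReal_re]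

end Frames

/-! ### The norm of the second fundamental form of a flag -/

section Quotient

variable {n : ℕ}

/-- The distance to F_j is the length of the orthogonalized vector, and its square is the ratio of
successive Gram determinants by Cramer's rule. -/
lemma quotientNorm_sq (ε : Bool) (g : SO n) {j : ℕ} (hj : j < n + n) :
    quotientNorm ε g ⟨j, hj⟩ ^ 2 =
      gramDet (mat g) (flagSet n ε (j + 1)) / gramDet (mat g) (flagSet n ε j) := by
  set s := flagSet n ε j with hs
  set t := flagIdx n ε ⟨j, hj⟩ with ht
  set M := mat g
  set H := Mᴴ * M with hH
  have hu : IsUnit M.det := isUnit_det_mat g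
  have hts : t ∉ s := flagIdx_notMem_flagSet ε hj
  obtain ⟨b, hbt, hb0, hbs, -⟩ := exists_orthogonalized hts (principalMinor_ne_zero hu s)
  have hcr := principalMinor_insert_mul hts (principalMinor_ne_zero hu _) b hb0 hbs
  let u : Idx n → EuclideanSpace ℂ (Idx n) := fun a => WithLp.toLp 2 fun i => M i a
  have hspan : {v : EuclideanSpace ℂ (Idx n) | ∃ i : Fin (n + n), i < ⟨j, hj⟩ ∧
      v = WithLp.toLp 2 (act g (stdVec n (flagIdx n ε i)))} = u '' s := by
    ext v
    constructor
    · rintro ⟨i, hi, rfl⟩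
      refine ⟨flagIdx n ε i, ?_, ?_⟩
      · rw [Finset.mem_coe, hs, mem_flagSet, Equiv.symm_apply_apply]
        exact hi
      · rw [act_stdVec]
    · rintro ⟨a, ha, rfl⟩
      refine ⟨(flagIdx n ε).symm a, mem_flagSet.1 ha, ?_⟩
      rw [act_stdVec, Equiv.apply_symm_apply]
  have hx : (WithLp.toLp 2 (act g (stdVec n t)) : EuclideanSpace ℂ (Idx n)) = u t := by
    rw [act_stdVec]
  rw [quotientNorm, hspan, ← ht, hx]
  set W := Submodule.span ℂ (u '' s) with hW
  let p : EuclideanSpace ℂ (Idx n) := WithLp.toLp 2 (M *ᵥ b)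
  have hp : p = u t + ∑ i ∈ s, b i • u i := by
    have h1 : p = ∑ i ∈ insert t s, b i • u i := by
      have h2 : p = ∑ i, b i • u i := by
        ext a
        simp [p, u, Matrix.mulVec, dotProduct, mul_comm]
      rw [h2]
      refine (Finset.sum_subset (Finset.subset_univ _) fun i _ hi => ?_).symm
      rw [hb0 i (fun h => hi (h ▸ Finset.mem_insert_self _ _))
        fun h => hi (Finset.mem_insert_of_mem h), zero_smul]
    rw [h1, Finset.sum_insert hts, hbt, one_smul]
  have hinner : ∀ a, inner ℂ (u a) p = (H *ᵥ b) a := by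
    intro a
    rw [hH, ← Matrix.mulVec_mulVec, EuclideanSpace.inner_eq_star_dotProduct]
    simp only [p, u, Matrix.mulVec, dotProduct, Matrix.conjTranspose_apply, Pi.star_apply]
    exact Finset.sum_congr rfl fun i _ => mul_comm _ _
  have hsum : ∑ i ∈ s, b i • u i ∈ W := Submodule.sum_mem _ fun i hi =>
    Submodule.smul_mem _ _ (Submodule.subset_span ⟨i, hi, rfl⟩)
  have hperp : p ∈ Wᗮ := by
    rw [Submodule.mem_orthogonal]
    intro w hw
    -- The inner products of p with the columns of M are the entries of H b, and b was built so that
    -- these vanish on s.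
    refine Submodule.span_induction (p := fun w _ => inner ℂ w p = 0) ?_ ?_ ?_ ?_ hw
    · rintro _ ⟨a, ha, rfl⟩
      rw [hinner, hbs a ha]
    · simp
    · intro x y _ _ hx hy
      rw [inner_add_left, hx, hy, add_zero]
    · intro c x _ hx
      rw [inner_smul_left, hx, mul_zero]
  have hproj : W.starProjection (u t) = -∑ i ∈ s, b i • u i :=
    Submodule.eq_starProjection_of_mem_orthogonal' (Submodule.neg_mem _ hsum) hperp
      (by rw [hp]; abel)
  have hdist : Metric.infDist (u t) (W : Set (EuclideanSpace ℂ (Idx n))) = ‖p‖ := by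
    rw [Metric.infDist_eq_iInf, hp, ← sub_neg_eq_add, ← hproj, Submodule.starProjection_minimal]
    simp only [dist_eq_norm]
    rfl
  have hnorm : ((‖p‖ ^ 2 : ℝ) : ℂ) = (H *ᵥ b) t := by
    have h1 : inner ℂ p p = ((‖p‖ ^ 2 : ℝ) : ℂ) := by
      rw [inner_self_eq_norm_sq_to_K]
      push_cast
      rfl
    rw [← h1]
    nth_rewrite 1 [hp]
    rw [inner_add_left, hinner, (Submodule.mem_orthogonal _ _).1 hperp _ hsum, add_zero]
  rw [hdist, eq_div_iff (gramDet_pos hu s).ne', flagSet_succ ε hj]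
  have h2 : ((‖p‖ ^ 2 * gramDet M s : ℝ) : ℂ) = (gramDet M (insert t s) : ℝ) := by
    rw [Complex.ofReal_mul, hnorm, coe_gramDet hu, coe_gramDet hu, ← hcr, hbt, mul_one]
  exact_mod_cast h2

end Quotient

/-! ### Curves -/

section Curves

variable {n : ℕ} {S : Type*} [TopologicalSpace S] [ChartedSpace ℂ S]
  {f : S → SO n ⧸ borel n} {U : Set S} {g : S → SO n} {e : OpenPartialHomeomorph S ℂ} {z : ℂ}

lemma IsLift.eventually (hg : IsLift f U g) (hz : z ∈ e.target) (hzU : e.symm z ∈ U) :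
    ∀ᶠ w in 𝓝 z, w ∈ e.target ∧ e.symm w ∈ U :=
  (e.open_target.eventually_mem hz).and
    ((e.symm.continuousAt hz).eventually (hg.isOpen.eventually_mem hzU))

lemma IsLift.analyticAt (hg : IsLift f U g) (he : e ∈ IsManifold.maximalAtlas 𝓘(ℂ, ℂ) ω S)
    (hz : z ∈ e.target) (hzU : e.symm z ∈ U) (a b : Idx n) :
    AnalyticAt ℂ (fun w => mat (g (e.symm w)) a b) z := by
  have h1 : DifferentiableOn ℂ (fun w => mat (g (e.symm w)) a b) {w | w ∈ e.target ∧
      e.symm w ∈ U} := by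
    rw [← mdifferentiableOn_iff_differentiableOn]
    refine (hg.holomorphic a b).comp (u := U) ?_ fun w hw => hw.2
    refine MDifferentiableOn.mono ?_ fun w (hw : w ∈ e.target ∧ e.symm w ∈ U) => hw.1
    exact (contMDiffOn_symm_of_mem_maximalAtlas he).mdifferentiableOn (by simp)
  exact h1.analyticAt (hg.eventually hz hzU)

lemma IsLift.analyticAt_hermInner_wedgeAct (hg : IsLift f U g)
    (he : e ∈ IsManifold.maximalAtlas 𝓘(ℂ, ℂ) ω S) (hz : z ∈ e.target) (hzU : e.symm z ∈ U)
    {k : ℕ} (c : Fin k → Idx n) (x : ⋀[ℂ]^k (V n)) :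
    AnalyticAt ℂ (fun w => hermInner (wedgeBasis n k) x (wedgeAct (g (e.symm w)) c)) z := by
  simp only [hermInner, wedgeAct_eq, wedgeBasis_repr_ιMulti, Matrix.det_apply']
  refine Finset.analyticAt_fun_sum _ fun t _ => analyticAt_const.mul ?_
  refine Finset.analyticAt_fun_sum _ fun σ _ => analyticAt_const.mul ?_
  exact Finset.analyticAt_fun_prod _ fun i _ => hg.analyticAt he hz hzU _ _

/-- The coefficient of `(i_± f)^* φ̂_k`. -/
lemma flagMetric_eq (hg : IsLift f U g) (he : e ∈ IsManifold.maximalAtlas 𝓘(ℂ, ℂ) ω S)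
    (hz : z ∈ e.target) (hzU : e.symm z ∈ U) (ε : Bool) {k : ℕ} (hk : k ≤ n + n) :
    flagMetric ε f e k hk z =
      ddbar (fun w => Real.log (gramDet (mat (g (e.symm w))) (flagSet n ε k))) z := by
  have hc := (flagIdx n ε).injective.comp (Fin.castLE_injective hk)
  have han := hg.analyticAt he hz hzU
  rw [flagMetric, fsPullback_eq_ddbar (wedgeBasis n k)
    (v := fun w => wedgeAct (g (e.symm w)) fun j : Fin k => flagIdx n ε (Fin.castLE hk j))
    (fun w => wedgeAct_ne_zero _ hc)]
  · simp only [hermNormSq_wedgeAct]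
  · filter_upwards [hg.eventually hz hzU] with w hw
    exact wedgeOrbit_mk ε hk _ _ (hg.lifts _ hw.2)
  · exact hg.analyticAt_hermInner_wedgeAct he hz hzU _
  · simp only [hermNormSq_wedgeAct]
    exact contDiffAt_log_gramDet han (isUnit_det_mat _) _

/-- The section l has squared norm D_{k+1} D_{k-1} / D_k². Tangency to 𝒩 is not needed: this is the
identity of curvatures of tautological line bundles. -/
lemma flagCurvature_eq (hg : IsLift f U g) (he : e ∈ IsManifold.maximalAtlas 𝓘(ℂ, ℂ) ω S)
    (hz : z ∈ e.target) (hzU : e.symm z ∈ U) (ε : Bool) {k : ℕ} (hk1 : 1 ≤ k) (hk : k < n + n) :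
    flagCurvature ε g e k hk1 hk z = 2 * flagMetric ε f e k hk.le z -
      flagMetric ε f e (k - 1) (by omega) z - flagMetric ε f e (k + 1) hk z := by
  have han := hg.analyticAt he hz hzU
  have hC := fun k => contDiffAt_log_gramDet han (isUnit_det_mat _) (flagSet n ε k)
  rw [flagMetric_eq hg he hz hzU, flagMetric_eq hg he hz hzU, flagMetric_eq hg he hz hzU,
    flagCurvature]
  have h1 : ∀ w, Real.log ((quotientNorm ε (g (e.symm w)) ⟨k, hk⟩ /
      quotientNorm ε (g (e.symm w)) ⟨k - 1, by omega⟩) ^ 2) =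
      (Real.log (gramDet (mat (g (e.symm w))) (flagSet n ε (k + 1))) +
        Real.log (gramDet (mat (g (e.symm w))) (flagSet n ε (k - 1)))) +
      (-2) * Real.log (gramDet (mat (g (e.symm w))) (flagSet n ε k)) := by
    intro w
    have h2 := fun s => (gramDet_pos (isUnit_det_mat (g (e.symm w))) s).ne'
    have hk2 : k - 1 + 1 = k := by omega
    rw [div_pow, quotientNorm_sq, quotientNorm_sq, hk2, Real.log_div, Real.log_div (h2 _) (h2 _),
      Real.log_div (h2 _) (h2 _)]
    · ring
    · exact div_ne_zero (h2 _) (h2 _)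
    · exact div_ne_zero (h2 _) (h2 _)
  simp only [h1]
  rw [ddbar_add ((hC _).add (hC _)) (contDiffAt_const.mul (hC _)), ddbar_add (hC _) (hC _),
    ddbar_const_mul _ (hC _)]
  ring

end Curves

/-! ### The distribution `𝒩` -/

section Distribution

variable {n : ℕ}

lemma mem_so_iff {A : Matrix (Idx n) (Idx n) ℂ} :
    A ∈ so n ↔ ∀ i j, A j.swap i = - A i.swap j := by
  rw [so, LieAlgebra.Orthogonal.typeD, mem_skewAdjointMatricesLieSubalgebra,
    mem_skewAdjointMatricesSubmodule, Matrix.IsSkewAdjoint, Matrix.IsAdjointPair,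
    ← Matrix.ext_iff]
  refine forall_congr' fun i => forall_congr' fun j => ?_
  rw [show LieAlgebra.Orthogonal.JD (Fin n) ℂ = gram n from rfl, mul_gram_apply, gram_mul_apply,
    Matrix.transpose_apply, Matrix.neg_apply]

lemma mem_borelAlgebra_iff {x : so n} : x ∈ borelAlgebra n ↔
    (∀ i j : Fin n, x.1 (Sum.inr i) (Sum.inl j) = 0) ∧
      ∀ i j : Fin n, j < i → x.1 (Sum.inl i) (Sum.inl j) = 0 := by
  constructor
  · intro h
    have h1 : ∀ j : Fin n, x.1 *ᵥ stdVec n (Sum.inl j) ∈ isoFlag n (j.1 + 1) := fun j =>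
      h _ _ (stdVec_inl_mem_isoFlag j)
    simp only [stdVec, Matrix.mulVec_single_one, mem_isoFlag] at h1
    exact ⟨fun i j => (h1 j).1 i, fun i j hij => (h1 j).2 i hij⟩
  · rintro ⟨h1, h2⟩ k v hv
    rw [mem_isoFlag] at hv ⊢
    constructor
    · intro i
      simp [Matrix.mulVec, dotProduct, h1, hv.1]
    · intro i hi
      simp only [Matrix.mulVec, dotProduct, Fintype.sum_sum_type, hv.1, mul_zero,
        Finset.sum_const_zero, add_zero]
      refine Finset.sum_eq_zero fun j _ => ?_
      by_cases hj : j < i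
      · rw [h2 i j hj, zero_mul]
      · rw [hv.2 j (hi.trans (not_lt.1 hj)), mul_zero]

lemma mul_single_one_apply (A : Matrix (Idx n) (Idx n) ℂ) (a b p q : Idx n) :
    (A * Matrix.single a b (1 : ℂ)) p q = if q = b then A p a else 0 := by
  split_ifs with h
  · subst h
    simp
  · exact Matrix.mul_single_apply_of_ne _ _ _ _ _ h _

lemma single_one_mul_apply (A : Matrix (Idx n) (Idx n) ℂ) (a b p q : Idx n) :
    (Matrix.single a b (1 : ℂ) * A) p q = if p = a then A b q else 0 := by
  split_ifs with h
  · subst h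
    simp
  · exact Matrix.single_mul_apply_of_ne _ _ _ _ _ h _

/-- The element `e_j ↦ e_i`, `f_i ↦ -f_j` of `𝔰𝔬(2n, ℂ)`. -/
def glElement (i j : Fin n) : so n :=
  ⟨Matrix.single (Sum.inl i) (Sum.inl j) 1 - Matrix.single (Sum.inr j) (Sum.inr i) 1, by
    rw [mem_so_iff]
    rintro (p | p) (q | q) <;>
      simp [Matrix.single_apply, and_comm]⟩

lemma glElement_mem_borelAlgebra {i j : Fin n} (hij : i ≤ j) :
    glElement i j ∈ borelAlgebra n := by
  rw [mem_borelAlgebra_iff]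
  constructor
  · intro p q
    simp [glElement]
  · intro p q hpq
    have : ¬ (i = p ∧ j = q) := fun h => absurd hij (not_le.2 (by rw [h.1, h.2]; exact hpq))
    simp [glElement, this]

lemma lie_coe_apply (x y : so n) (p q : Idx n) :
    (⁅x, y⁆ : so n).1 p q = (x.1 * y.1) p q - (y.1 * x.1) p q := rfl

/-- A root vector of a positive root L_i - L_j is an eigenvector of the diagonal element `glElement
i i` with eigenvalue 1. Bracketing with these root vectors already cuts 𝒩 down far enough. -/
lemma glElement_mem_borelDerived {i j : Fin n} (hij : i < j) :
    glElement i j ∈ borelDerived n := by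
  refine Submodule.subset_span ⟨glElement i i, glElement_mem_borelAlgebra le_rfl,
    glElement i j, glElement_mem_borelAlgebra hij.le, Subtype.ext (Matrix.ext fun p q => ?_)⟩
  rw [lie_coe_apply]
  simp only [glElement, Matrix.mul_sub, Matrix.sub_apply, mul_single_one_apply]
  rcases p with p | p <;> rcases q with q | q <;>
    simp [Matrix.single_apply] <;> grind

/-- The bracket condition defining `𝒩`, on matrix entries. -/
lemma distr_apply {x : so n} (hx : x ∈ distr n) {i j : Fin n} (hij : i < j) :
    (∀ k l : Fin n, (if l = j then x.1 (Sum.inr k) (Sum.inl i) else 0) +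
      (if k = j then x.1 (Sum.inr i) (Sum.inl l) else 0) = 0) ∧
    (∀ k l : Fin n, l < k → (if l = j then x.1 (Sum.inl k) (Sum.inl i) else 0) -
      (if k = i then x.1 (Sum.inl j) (Sum.inl l) else 0) = 0) := by
  have h := mem_borelAlgebra_iff.1 (hx _ (glElement_mem_borelDerived hij))
  simp only [lie_coe_apply, glElement, Matrix.mul_sub, Matrix.sub_mul, Matrix.sub_apply,
    mul_single_one_apply, single_one_mul_apply] at h
  simpa using h

/-- The bracket with the root vector of L_i - L_{i+1} moves this entry to another position below the
diagonal, where elements of 𝔟 vanish. -/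
lemma distr_inl_inl {x : so n} (hx : x ∈ distr n) {k i : Fin n} (h : i.1 + 1 < k.1) :
    x.1 (Sum.inl k) (Sum.inl i) = 0 := by
  have hi : i < ⟨i.1 + 1, by omega⟩ := Fin.lt_def.2 (Nat.lt_succ_self _)
  have h1 := (distr_apply hx hi).2 k ⟨i.1 + 1, by omega⟩ (Fin.lt_def.2 h)
  rwa [if_pos rfl, if_neg (by rintro rfl; omega), sub_zero] at h1

/-- Two indices i+1 and i+2 are available after i. Choosing one that differs from k isolates the
entry in the bracket condition; this is where i ≤ n-3 (counting from 0) is needed. -/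
lemma distr_inr_inl {x : so n} (hx : x ∈ distr n) (k : Fin n) {i : Fin n} (h : i.1 + 2 < n) :
    x.1 (Sum.inr k) (Sum.inl i) = 0 := by
  have key : ∀ j : Fin n, i < j → k ≠ j → x.1 (Sum.inr k) (Sum.inl i) = 0 := by
    intro j hij hkj
    have h1 := (distr_apply hx hij).1 k j
    rwa [if_pos rfl, if_neg hkj, add_zero] at h1
  by_cases hk : k.1 = i.1 + 1
  · exact key ⟨i.1 + 2, h⟩ (Fin.lt_def.2 (by simp)) (fun h => by
      have := congrArg Fin.val h
      simp at this
      omega)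
  · exact key ⟨i.1 + 1, by omega⟩ (Fin.lt_def.2 (by simp)) (fun h => hk (congrArg Fin.val h))

/-! ### The flags as index sets -/

lemma inl_mem_flagSet {ε : Bool} {k : ℕ} (hk : k < n) {i : Fin n} :
    Sum.inl i ∈ flagSet n ε k ↔ i.1 < k := by
  rw [mem_flagSet, flagIdx_symm_inl]
  split_ifs <;> omega

lemma inr_notMem_flagSet {ε : Bool} {k : ℕ} (hk : k < n) (i : Fin n) :
    Sum.inr i ∉ flagSet n ε k := by
  rw [mem_flagSet, flagIdx_symm_inr]
  split_ifs <;> omega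

lemma flagIdx_of_lt (ε : Bool) {k : ℕ} (hk : k + 1 < n) :
    flagIdx n ε ⟨k, by omega⟩ = Sum.inl ⟨k, by omega⟩ := by
  rw [← Equiv.eq_symm_apply, Fin.ext_iff, flagIdx_symm_inl, if_neg (by simp; omega)]

lemma flagIdx_true_last {k : ℕ} (hk : k + 1 = n) :
    flagIdx n true ⟨k, by omega⟩ = Sum.inl ⟨k, by omega⟩ := by
  rw [← Equiv.eq_symm_apply, Fin.ext_iff, flagIdx_symm_inl, if_neg (by simp)]

lemma flagIdx_false_last {k : ℕ} (hk : k + 1 = n) :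
    flagIdx n false ⟨k, by omega⟩ = Sum.inr ⟨k, by omega⟩ := by
  rw [← Equiv.eq_symm_apply, Fin.ext_iff, flagIdx_symm_inr, if_pos ⟨rfl, hk⟩]
  simp
  omega

lemma flagSet_eq_of_lt {k : ℕ} (hk : k < n) (ε ε' : Bool) : flagSet n ε k = flagSet n ε' k := by
  ext (i | i)
  · rw [inl_mem_flagSet hk, inl_mem_flagSet hk]
  · exact iff_of_false (inr_notMem_flagSet hk i) (inr_notMem_flagSet hk i)

lemma swap_mem_flagSet_iff (ε : Bool) (a : Idx n) :
    a.swap ∈ flagSet n ε n ↔ a ∉ flagSet n ε n := by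
  rcases a with i | i <;>
    simp only [Sum.swap_inl, Sum.swap_inr, mem_flagSet, flagIdx_symm_inl, flagIdx_symm_inr] <;>
    split_ifs <;> omega

/-- Below the Lagrangian level the only velocity leaving ⟨e₁, …, e_{k+1}⟩ is along the simple root
L_{k+1} - L_{k+2}. -/
lemma distr_hessenberg {x : so n} (hx : x ∈ distr n) (ε : Bool) {k : ℕ} (hk : k + 2 < n)
    {i j : Idx n} (hi : i ∉ flagSet n ε (k + 1)) (hj : j ∈ flagSet n ε (k + 1))
    (h : x.1 i j ≠ 0) :
    i = Sum.inl ⟨k + 1, by omega⟩ ∧ j = Sum.inl ⟨k, by omega⟩ := by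
  rcases j with j | j
  · rw [inl_mem_flagSet (by omega)] at hj
    rcases i with i | i
    · rw [inl_mem_flagSet (by omega)] at hi
      have h1 : ¬ j.1 + 1 < i.1 := fun h1 => h (distr_inl_inl hx h1)
      simp only [Sum.inl.injEq, Fin.ext_iff]
      omega
    · exact absurd (distr_inr_inl hx i (by omega)) h
  · exact absurd hj (inr_notMem_flagSet (by omega) j)

/-- The block of x leading out of a Lagrangian is a skew form on it. The columns of e₁, …, eₙ₋₂
vanish by tangency, the corresponding rows by skewness, and so does the diagonal. What remains is
the root L_{n-1} + L_n for i₊ and L_{n-1} - L_n for i₋. -/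
lemma distr_lagrangian {x : so n} (hx : x ∈ distr n) (ε : Bool) {k : ℕ} (hk : k + 2 = n)
    {i j : Idx n} (hi : i ∈ flagSet n ε n) (hj : j ∈ flagSet n ε n) (h : x.1 i.swap j ≠ 0) :
    (i = flagIdx n ε ⟨k + 1, by omega⟩ ∧ j = Sum.inl ⟨k, by omega⟩) ∨
      (i = Sum.inl ⟨k, by omega⟩ ∧ j = flagIdx n ε ⟨k + 1, by omega⟩) := by
  have hskew : ∀ i j, x.1 j.swap i = - x.1 i.swap j := mem_so_iff.1 x.2
  have hmem : ∀ a ∈ flagSet n ε n, a = flagIdx n ε ⟨k + 1, by omega⟩ ∨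
      a = Sum.inl ⟨k, by omega⟩ ∨ ∃ l : Fin n, l.1 + 2 < n ∧ a = Sum.inl l := by
    intro a ha
    rw [mem_flagSet] at ha
    by_cases h1 : ((flagIdx n ε).symm a).val = k + 1
    · left
      rw [← Equiv.symm_apply_eq]
      exact Fin.ext h1
    · right
      have h2 : a = flagIdx n ε ⟨((flagIdx n ε).symm a).val, by omega⟩ := by
        rw [← Equiv.symm_apply_eq]
      rw [flagIdx_of_lt ε (by omega)] at h2
      by_cases h3 : ((flagIdx n ε).symm a).val = k
      · left
        rw [h2]
        simp [h3]
      · exact Or.inr ⟨_, by simp; omega, h2⟩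
  have key : ∀ a ∈ flagSet n ε n, ∀ l : Fin n, l.1 + 2 < n → x.1 a.swap (Sum.inl l) = 0 := by
    rintro (a | a) ha l hl
    · exact distr_inr_inl hx a hl
    -- The Lagrangian contains a vector f_a only for the sign -, and then a is the last index.
    · refine distr_inl_inl hx ?_
      rw [mem_flagSet, flagIdx_symm_inr] at ha
      split_ifs at ha <;> omega
  have hdiag : ∀ a, x.1 a.swap a = 0 := by
    intro a
    have := hskew a a
    rw [eq_neg_iff_add_eq_zero, ← two_mul] at this
    simpa using this
  rcases hmem j hj with hj1 | hj1 | ⟨l, hl, rfl⟩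
  · rcases hmem i hi with hi1 | hi1 | ⟨l, hl, rfl⟩
    · exact absurd (by rw [hi1, hj1]; exact hdiag _) h
    · exact Or.inr ⟨hi1, hj1⟩
    · exact absurd (by rw [hskew, key _ hj l hl, neg_zero]) h
  · rcases hmem i hi with hi1 | hi1 | ⟨l, hl, rfl⟩
    · exact Or.inl ⟨hi1, hj1⟩
    · exact absurd (by rw [hi1, hj1]; exact hdiag _) h
    · exact absurd (by rw [hskew, key _ hj l hl, neg_zero]) h
  · exact absurd (key i hi l hl) h

end Distribution

/-! ### Metrics and curvatures along an integral curve of 𝒩. -/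

/-- A factor |a|² with a holomorphic and nonzero adds a harmonic term to the logarithm, so it does
not affect the curvature. -/
lemma curvatureCoeff_eq {u : ℂ → ℝ} {a : ℂ → ℂ} {P : ℂ → ℝ} {z : ℂ}
    (hu : u =ᶠ[𝓝 z] fun w => ‖a w‖ ^ 2 * P w) (ha : AnalyticAt ℂ a z)
    (hP : ∀ᶠ w in 𝓝 z, 0 < P w) (hlog : ContDiffAt ℝ 2 (fun w => Real.log (P w)) z)
    (h0 : u z ≠ 0) : curvatureCoeff u z = -ddbar (fun w => Real.log (P w)) z := by
  have ha0 : a z ≠ 0 := fun h => h0 (hu.self_of_nhds.trans (by simp [h]))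
  obtain ⟨h1, h2⟩ := ddbar_log_norm ha ha0
  have h3 : (fun w => Real.log (u w)) =ᶠ[𝓝 z] fun w =>
      2 * Real.log ‖a w‖ + Real.log (P w) := by
    filter_upwards [hu, hP, ha.continuousAt.eventually_ne ha0] with w hw hPw haw
    rw [hw, Real.log_mul (pow_ne_zero 2 (norm_ne_zero_iff.2 haw)) hPw.ne', Real.log_pow]
    push_cast
    ring
  rw [curvatureCoeff, ddbar_congr h3, ddbar_add (contDiffAt_const.mul h1) hlog,
    ddbar_const_mul _ h1, h2, mul_zero, zero_add]

section Integral

variable {n : ℕ} {S : Type*} [TopologicalSpace S] [ChartedSpace ℂ S]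
  {f : S → SO n ⧸ borel n} {U : Set S} {g : S → SO n} {e : OpenPartialHomeomorph S ℂ} {z : ℂ}

/-- The logarithmic derivative `g⁻¹ g'` of a lift. -/
def logDeriv (g : S → SO n) (e : OpenPartialHomeomorph S ℂ) (z : ℂ) :
    Matrix (Idx n) (Idx n) ℂ :=
  gram n * (mat (g (e.symm z)))ᵀ * gram n * matDeriv g e z

lemma IsLift.analyticAt_logDeriv (hg : IsLift f U g)
    (he : e ∈ IsManifold.maximalAtlas 𝓘(ℂ, ℂ) ω S) (hz : z ∈ e.target) (hzU : e.symm z ∈ U)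
    (i j : Idx n) : AnalyticAt ℂ (fun w => logDeriv g e w i j) z := by
  have han := hg.analyticAt he hz hzU
  simp only [logDeriv, Matrix.mul_apply (M := gram n * _ * gram n), mul_gram_apply,
    gram_mul_apply, Matrix.transpose_apply, matDeriv, Matrix.of_apply]
  exact Finset.analyticAt_fun_sum _ fun k _ => (han _ _).mul (han k j).deriv

lemma logDeriv_mem_distr (hN : IsIntegralCurve f) (hg : IsLift f U g)
    (he : e ∈ IsManifold.maximalAtlas 𝓘(ℂ, ℂ) ω S) (hz : z ∈ e.target) (hzU : e.symm z ∈ U) :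
    (∃ x ∈ distr n, logDeriv g e z = x.1) ∧ ∀ i j, deriv (fun w => mat (g (e.symm w)) i j) z =
      (mat (g (e.symm z)) * logDeriv g e z) i j := by
  obtain ⟨x, hx, h⟩ := hN U g hg e he z hz hzU
  have h1 : logDeriv g e z = x.1 := by
    rw [logDeriv, h, ← Matrix.mul_assoc, (isOrthogonal_mat _).inv_mul, Matrix.one_mul]
  refine ⟨⟨x, hx, h1⟩, fun i j => ?_⟩
  rw [h1, ← h]
  rfl

/-- The metric is the squared modulus of one entry of g⁻¹ g' times the squared norm of the section
l. Its zeros are the zeros of that entry. -/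
lemma flagMetric_eq_of_lt (hN : IsIntegralCurve f) (hg : IsLift f U g)
    (he : e ∈ IsManifold.maximalAtlas 𝓘(ℂ, ℂ) ω S) (hz : z ∈ e.target) (hzU : e.symm z ∈ U)
    (ε : Bool) {k : ℕ} (hk : k + 2 < n) :
    flagMetric ε f e (k + 1) (by omega) z =
      ‖logDeriv g e z (Sum.inl ⟨k + 1, by omega⟩) (Sum.inl ⟨k, by omega⟩)‖ ^ 2 *
        (gramDet (mat (g (e.symm z))) (flagSet n ε (k + 2)) *
          gramDet (mat (g (e.symm z))) (flagSet n ε k) /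
          gramDet (mat (g (e.symm z))) (flagSet n ε (k + 1)) ^ 2) := by
  obtain ⟨⟨x, hx, hxe⟩, hX⟩ := logDeriv_mem_distr hN hg he hz hzU
  have hi1 : flagIdx n ε ⟨k + 1, by omega⟩ = Sum.inl ⟨k + 1, by omega⟩ :=
    flagIdx_of_lt ε (by omega)
  have hi0 : flagIdx n ε ⟨k, by omega⟩ = Sum.inl ⟨k, by omega⟩ := flagIdx_of_lt ε (by omega)
  have e1 : flagSet n ε (k + 2) = insert (Sum.inl ⟨k + 1, by omega⟩) (flagSet n ε (k + 1)) := by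
    rw [← hi1]
    exact flagSet_succ ε (by omega)
  have e0 : flagSet n ε (k + 1) = insert (Sum.inl ⟨k, by omega⟩) (flagSet n ε k) := by
    rw [← hi0]
    exact flagSet_succ ε (by omega)
  have e2 : flagSet n ε k = (flagSet n ε (k + 1)).erase (Sum.inl ⟨k, by omega⟩) := by
    rw [e0, Finset.erase_insert]
    rw [← hi0]
    exact flagIdx_notMem_flagSet ε _
  rw [flagMetric_eq hg he hz hzU, ddbar_log_gramDet_of_single
    (r := Sum.inl ⟨k, by omega⟩) (t := Sum.inl ⟨k + 1, by omega⟩) (hg.analyticAt he hz hzU)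
    (Eventually.of_forall fun w => isUnit_det_mat _) hX, ← e1, ← e2, mul_div_assoc]
  · rw [e0]
    exact Finset.mem_insert_self _ _
  · rw [← hi1]
    exact flagIdx_notMem_flagSet ε _
  · intro i hi j hj h
    rw [hxe] at h
    exact distr_hessenberg hx ε hk hi hj h

/-- The determinant D_{n-1} does not occur: the surviving skew pair of entries pairs the last two
vectors of the Lagrangian and removes both from it, leaving D_{n-2} / D_n. -/
lemma flagMetric_eq_of_lagrangian (hN : IsIntegralCurve f) (hg : IsLift f U g)
    (he : e ∈ IsManifold.maximalAtlas 𝓘(ℂ, ℂ) ω S) (hz : z ∈ e.target) (hzU : e.symm z ∈ U)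
    (ε : Bool) {k : ℕ} (hk : k + 2 = n) :
    flagMetric ε f e n (by omega) z =
      2 * (‖logDeriv g e z (flagIdx n ε ⟨k + 1, by omega⟩).swap (Sum.inl ⟨k, by omega⟩)‖ ^ 2 *
        (gramDet (mat (g (e.symm z))) (flagSet n ε k) /
          gramDet (mat (g (e.symm z))) (flagSet n ε n))) := by
  obtain ⟨⟨x, hx, hxe⟩, hX⟩ := logDeriv_mem_distr hN hg he hz hzU
  have hi0 : flagIdx n ε ⟨k, by omega⟩ = Sum.inl ⟨k, by omega⟩ := flagIdx_of_lt ε (by omega)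
  have e0 : flagSet n ε (k + 1) = insert (Sum.inl ⟨k, by omega⟩) (flagSet n ε k) := by
    rw [← hi0]
    exact flagSet_succ ε (by omega)
  have e1 : flagSet n ε n = insert (flagIdx n ε ⟨k + 1, by omega⟩) (flagSet n ε (k + 1)) := by
    rw [← flagSet_succ ε]
    congr 1
    exact hk.symm
  have hne : (Sum.inl ⟨k, by omega⟩ : Idx n) ≠ flagIdx n ε ⟨k + 1, by omega⟩ := by
    rw [← hi0]
    intro h
    have := congrArg Fin.val ((flagIdx n ε).injective h)
    simp at this
  have e2 : flagSet n ε k =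
      ((flagSet n ε n).erase (Sum.inl ⟨k, by omega⟩)).erase (flagIdx n ε ⟨k + 1, by omega⟩) := by
    rw [e1, Finset.erase_right_comm, Finset.erase_insert, e0, Finset.erase_insert]
    · rw [← hi0]
      exact flagIdx_notMem_flagSet ε _
    · exact flagIdx_notMem_flagSet ε _
  rw [flagMetric_eq hg he hz hzU, ddbar_log_gramDet_of_lagrangian
    (r := Sum.inl ⟨k, by omega⟩) (t := flagIdx n ε ⟨k + 1, by omega⟩) (σ := Sum.swap)
    (hg.analyticAt he hz hzU) (Eventually.of_forall fun w => isUnit_det_mat _) hX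
    Sum.swap_swap (isOrthogonal_mat _).conjTranspose_mul_self.isSelfDual
    (swap_mem_flagSet_iff ε), ← e2, mul_div_assoc]
  · rw [e1, e0]
    exact Finset.mem_insert_of_mem (Finset.mem_insert_self _ _)
  · rw [e1]
    exact Finset.mem_insert_self _ _
  · exact hne
  · intro i hi j hj h
    rw [hxe] at h
    exact distr_lagrangian hx ε hk hi hj h
  · rw [hxe]
    exact mem_so_iff.1 x.2 _ _

lemma curvatureCoeff_flagMetric_of_lt (hN : IsIntegralCurve f) (hg : IsLift f U g)
    (he : e ∈ IsManifold.maximalAtlas 𝓘(ℂ, ℂ) ω S) (hz : z ∈ e.target) (hzU : e.symm z ∈ U)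
    (ε : Bool) {k : ℕ} (hk : k + 2 < n) (h0 : flagMetric ε f e (k + 1) (by omega) z ≠ 0) :
    curvatureCoeff (flagMetric ε f e (k + 1) (by omega)) z =
      2 * flagMetric ε f e (k + 1) (by omega) z - flagMetric ε f e k (by omega) z -
        flagMetric ε f e (k + 2) (by omega) z := by
  have han := hg.analyticAt he hz hzU
  have hC := fun k => contDiffAt_log_gramDet han (isUnit_det_mat _) (flagSet n ε k)
  have hpos := fun w s => gramDet_pos (isUnit_det_mat (g (e.symm w))) s
  have hlog : ∀ w, Real.log (gramDet (mat (g (e.symm w))) (flagSet n ε (k + 2)) *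
      gramDet (mat (g (e.symm w))) (flagSet n ε k) /
      gramDet (mat (g (e.symm w))) (flagSet n ε (k + 1)) ^ 2) =
      (Real.log (gramDet (mat (g (e.symm w))) (flagSet n ε (k + 2))) +
        Real.log (gramDet (mat (g (e.symm w))) (flagSet n ε k))) +
      (-2) * Real.log (gramDet (mat (g (e.symm w))) (flagSet n ε (k + 1))) := by
    intro w
    rw [Real.log_div (mul_pos (hpos w _) (hpos w _)).ne' (pow_pos (hpos w _) 2).ne',
      Real.log_mul (hpos w _).ne' (hpos w _).ne', Real.log_pow]
    push_cast
    ring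
  rw [curvatureCoeff_eq (P := fun w => gramDet (mat (g (e.symm w))) (flagSet n ε (k + 2)) *
      gramDet (mat (g (e.symm w))) (flagSet n ε k) /
      gramDet (mat (g (e.symm w))) (flagSet n ε (k + 1)) ^ 2) ?_
      (hg.analyticAt_logDeriv he hz hzU (Sum.inl ⟨k + 1, by omega⟩) (Sum.inl ⟨k, by omega⟩))
      (Eventually.of_forall fun w => div_pos (mul_pos (hpos w _) (hpos w _))
        (pow_pos (hpos w _) 2)) ?_ h0]
  · simp only [hlog]
    rw [ddbar_add ((hC _).add (hC _)) (contDiffAt_const.mul (hC _)), ddbar_add (hC _) (hC _),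
      ddbar_const_mul _ (hC _), flagMetric_eq hg he hz hzU, flagMetric_eq hg he hz hzU,
      flagMetric_eq hg he hz hzU]
    ring
  · filter_upwards [hg.eventually hz hzU] with w hw
    exact flagMetric_eq_of_lt hN hg he hw.1 hw.2 ε hk
  · simp only [hlog]
    exact ((hC _).add (hC _)).add (contDiffAt_const.mul (hC _))

/-- The function u is half of the metric of level n, so that the lemma serves both half-spin metrics
before they are identified. The factor 2 cancels against the one produced by the skew pair. -/
lemma curvatureCoeff_flagMetric_of_lagrangian (hN : IsIntegralCurve f) (hg : IsLift f U g)
    (he : e ∈ IsManifold.maximalAtlas 𝓘(ℂ, ℂ) ω S) (hz : z ∈ e.target) (hzU : e.symm z ∈ U)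
    (ε : Bool) {k : ℕ} (hk : k + 2 = n) {u : ℂ → ℝ}
    (hu : ∀ᶠ w in 𝓝 z, flagMetric ε f e n (by omega) w = 2 * u w) (h0 : u z ≠ 0) :
    curvatureCoeff u z =
      flagMetric ε f e n (by omega) z - flagMetric ε f e k (by omega) z := by
  have han := hg.analyticAt he hz hzU
  have hC := fun k => contDiffAt_log_gramDet han (isUnit_det_mat _) (flagSet n ε k)
  have hpos := fun w s => gramDet_pos (isUnit_det_mat (g (e.symm w))) s
  have hlog : ∀ w, Real.log (gramDet (mat (g (e.symm w))) (flagSet n ε k) /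
      gramDet (mat (g (e.symm w))) (flagSet n ε n)) =
      Real.log (gramDet (mat (g (e.symm w))) (flagSet n ε k)) +
        (-1) * Real.log (gramDet (mat (g (e.symm w))) (flagSet n ε n)) := by
    intro w
    rw [Real.log_div (hpos w _).ne' (hpos w _).ne']
    ring
  rw [curvatureCoeff_eq (P := fun w => gramDet (mat (g (e.symm w))) (flagSet n ε k) /
      gramDet (mat (g (e.symm w))) (flagSet n ε n)) ?_
      (hg.analyticAt_logDeriv he hz hzU (flagIdx n ε ⟨k + 1, by omega⟩).swap
        (Sum.inl ⟨k, by omega⟩))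
      (Eventually.of_forall fun w => div_pos (hpos w _) (hpos w _)) ?_ h0]
  · simp only [hlog]
    rw [ddbar_add (hC _) (contDiffAt_const.mul (hC _)), ddbar_const_mul _ (hC _),
      flagMetric_eq hg he hz hzU, flagMetric_eq hg he hz hzU]
    ring
  · filter_upwards [hg.eventually hz hzU, hu] with w hw hw'
    rw [flagMetric_eq_of_lagrangian hN hg he hw.1 hw.2 ε hk] at hw'
    exact (mul_left_cancel₀ two_ne_zero hw').symm
  · simp only [hlog]
    exact (hC _).add (contDiffAt_const.mul (hC _))

lemma gramDet_flagSet_mul (g : SO n) {k : ℕ} (hk : k + 1 = n) (ε : Bool) :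
    gramDet (mat g) (flagSet n true n) * gramDet (mat g) (flagSet n false n) =
      gramDet (mat g) (flagSet n ε k) ^ 2 := by
  have hu := isUnit_det_mat g
  have hH := (isOrthogonal_mat g).conjTranspose_mul_self
  have hlt : k < n := by omega
  have e1 : flagSet n true n = insert (Sum.inl ⟨k, hlt⟩) (flagSet n ε k) := by
    rw [flagSet_eq_of_lt hlt ε true, ← flagIdx_true_last hk, ← flagSet_succ]
    congr 1
    exact hk.symm
  have e2 : flagSet n false n =
      insert (Sum.inl ⟨k, hlt⟩ : Idx n).swap (flagSet n ε k) := by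
    rw [flagSet_eq_of_lt hlt ε false, Sum.swap_inl, ← flagIdx_false_last hk, ← flagSet_succ]
    congr 1
    exact hk.symm
  have h := principalMinor_insert_mul_insert (σ := Sum.swap) (t := Sum.inl ⟨k, hlt⟩)
    (s := flagSet n ε k) Sum.swap_swap hH.isSelfDual hH.sum_mul_swap
    (fun i j => congrFun (congrFun (Matrix.isHermitian_conjTranspose_mul_self (mat g)) j) i)
    (by rw [inl_mem_flagSet hlt]; simp) (inr_notMem_flagSet hlt _) (by simp)
    (by
      rintro (i | i) hi
      · exact inr_notMem_flagSet hlt _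
      · exact absurd hi (inr_notMem_flagSet hlt _))
    (by
      rintro (i | i) h1 h2
      · left
        rw [inl_mem_flagSet hlt] at h1
        congr 1
        exact Fin.ext (by simp; omega)
      · right
        rw [Sum.swap_inr, inl_mem_flagSet hlt] at h2
        rw [Sum.swap_inl]
        congr 1
        exact Fin.ext (by simp; omega))
    (principalMinor_ne_zero hu _) (principalMinor_ne_zero hu _) (principalMinor_ne_zero hu _)
  rw [← e1, ← e2, ← coe_gramDet hu, ← coe_gramDet hu, ← coe_gramDet hu] at h
  exact_mod_cast h

/-- The logarithm of the identity D_n⁺ D_n⁻ = D_{n-1}². -/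
lemma flagMetric_pred (hg : IsLift f U g)
    (he : e ∈ IsManifold.maximalAtlas 𝓘(ℂ, ℂ) ω S) (hz : z ∈ e.target) (hzU : e.symm z ∈ U)
    (ε : Bool) {k : ℕ} (hk : k + 1 = n) :
    2 * flagMetric ε f e k (by omega) z =
      flagMetric true f e n (by omega) z + flagMetric false f e n (by omega) z := by
  have han := hg.analyticAt he hz hzU
  have hC := fun s => contDiffAt_log_gramDet han (isUnit_det_mat _) s
  rw [flagMetric_eq hg he hz hzU, flagMetric_eq hg he hz hzU, flagMetric_eq hg he hz hzU,
    ← ddbar_const_mul _ (hC _), ← ddbar_add (hC _) (hC _)]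
  congr 1
  funext w
  have hpos := fun s => (gramDet_pos (isUnit_det_mat (g (e.symm w))) s).ne'
  rw [← Real.log_mul (hpos _) (hpos _), gramDet_flagSet_mul _ hk ε, Real.log_pow]
  push_cast
  rfl

end Integral

/-! ### Surjectivity of `Spin(2n, ℂ) → SO(2n, ℂ)` -/

section SpinLift

variable {n : ℕ}

/-- The bilinear form `Q`. -/
def bform (n : ℕ) (v w : V n) : ℂ := v ⬝ᵥ (gram n *ᵥ w)

lemma bform_comm (v w : V n) : bform n v w = bform n w v := by
  rw [bform, bform, dotProduct_mulVec, ← mulVec_transpose, transpose_gram, dotProduct_comm]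

lemma bform_add_left (u v w : V n) : bform n (u + v) w = bform n u w + bform n v w :=
  add_dotProduct _ _ _

lemma bform_sub_left (u v w : V n) : bform n (u - v) w = bform n u w - bform n v w :=
  sub_dotProduct _ _ _

lemma bform_smul_left (c : ℂ) (v w : V n) : bform n (c • v) w = c * bform n v w :=
  smul_dotProduct _ _ _

lemma bform_add_right (u v w : V n) : bform n u (v + w) = bform n u v + bform n u w := by
  rw [bform_comm, bform_add_left, bform_comm v, bform_comm w]

lemma bform_sub_right (u v w : V n) : bform n u (v - w) = bform n u v - bform n u w := by
  rw [bform_comm, bform_sub_left, bform_comm v, bform_comm w]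

lemma bform_smul_right (c : ℂ) (v w : V n) : bform n v (c • w) = c * bform n v w := by
  rw [bform_comm, bform_smul_left, bform_comm w]

lemma bform_stdVec_left (a : Idx n) (w : V n) : bform n (stdVec n a) w = w a.swap := by
  rw [bform, single_one_dotProduct, mulVec, dotProduct, Finset.sum_eq_single a.swap]
  · rw [gram_apply, Sum.swap_swap, if_pos rfl, one_mul]
  · intro b _ hb
    rw [gram_apply, if_neg (fun h => hb (by rw [h, Sum.swap_swap])), zero_mul]
  · simp

lemma quad_eq_bform (v : V n) : quad n v = bform n v v / 2 := by
  rw [quad_apply, bform, dotProduct, Fintype.sum_sum_type]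
  have h1 (a : Idx n) : (gram n *ᵥ v) a = v a.swap := by
    rw [← bform_stdVec_left a v, bform, single_one_dotProduct]
  simp only [h1, Sum.swap_inl, Sum.swap_inr]
  rw [eq_div_iff two_ne_zero, mul_two]
  congr 1
  exact Finset.sum_congr rfl fun i _ => mul_comm _ _

lemma polar_quad (v w : V n) : QuadraticMap.polar (quad n) v w = bform n v w := by
  rw [QuadraticMap.polar, quad_eq_bform, quad_eq_bform, quad_eq_bform, bform_add_left,
    bform_add_right, bform_add_right, bform_comm w v]
  ring

lemma IsOrthogonal.bform_mulVec {M : Matrix (Idx n) (Idx n) ℂ} (h : IsOrthogonal M) (v w : V n) :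
    bform n (M *ᵥ v) (M *ᵥ w) = bform n v w := by
  rw [bform, bform, mulVec_mulVec, dotProduct_comm, dotProduct_mulVec, ← mulVec_transpose,
    mulVec_mulVec, dotProduct_comm, ← Matrix.mul_assoc, h]

/-- The reflection in the hyperplane orthogonal to a vector `w` with `Q(w, w) = -2`. -/
def reflMat (w : V n) : Matrix (Idx n) (Idx n) ℂ := 1 + vecMulVec w (gram n *ᵥ w)

lemma reflMat_mulVec (w v : V n) : reflMat w *ᵥ v = v + bform n v w • w := by
  rw [reflMat, add_mulVec, one_mulVec, vecMulVec_mulVec, bform, dotProduct_comm v]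
  simp

lemma isOrthogonal_reflMat {w : V n} (hw : bform n w w = -2) : IsOrthogonal (reflMat w) := by
  have key : ∀ u v, bform n (reflMat w *ᵥ u) (reflMat w *ᵥ v) = bform n u v := by
    intro u v
    simp only [reflMat_mulVec, bform_add_left, bform_add_right, bform_smul_left,
      bform_smul_right, hw, bform_comm w v]
    ring
  ext a b
  have h := key (stdVec n a) (stdVec n b)
  rw [bform, dotProduct_comm, dotProduct_mulVec, ← mulVec_transpose, mulVec_mulVec, mulVec_mulVec,
    dotProduct_comm, bform] at h
  simpa using h

lemma det_reflMat {w : V n} (hw : bform n w w = -2) : (reflMat w).det = -1 := by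
  rw [reflMat, vecMulVec_eq Unit, det_one_add_replicateCol_mul_replicateRow, dotProduct_comm]
  rw [bform] at hw
  rw [hw]
  norm_num

/-- `M` is the product of `k` reflections in hyperplanes, and `s` is the product of the corresponding
vectors in the Clifford algebra. -/
structure PinCovers (s : CliffordAlgebra (quad n)) (k : ℕ) (M : Matrix (Idx n) (Idx n) ℂ) :
    Prop where
  mem : s ∈ pinGroup (quad n)
  parity : s ∈ CliffordAlgebra.evenOdd (quad n) k
  det : M.det = (-1) ^ k
  covers : ∀ v, s * CliffordAlgebra.ι (quad n) v =
    (-1) ^ k * (CliffordAlgebra.ι (quad n) (M *ᵥ v) * s)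

lemma ι_mul_self {w : V n} (hw : bform n w w = -2) :
    CliffordAlgebra.ι (quad n) w * CliffordAlgebra.ι (quad n) w = -1 := by
  rw [CliffordAlgebra.ι_sq_scalar, quad_eq_bform, hw]
  norm_num

/-- The normalisation Q(w, w) = -2 gives w² = -1, and the star operation negates vectors, so w is
unitary. -/
lemma ι_mem_pinGroup {w : V n} (hw : bform n w w = -2) :
    CliffordAlgebra.ι (quad n) w ∈ pinGroup (quad n) := by
  have h := ι_mul_self hw
  have h1 : CliffordAlgebra.ι (quad n) w * -CliffordAlgebra.ι (quad n) w = 1 := by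
    rw [mul_neg, h, neg_neg]
  have h2 : -CliffordAlgebra.ι (quad n) w * CliffordAlgebra.ι (quad n) w = 1 := by
    rw [neg_mul, h, neg_neg]
  refine ⟨⟨⟨_, _, h1, h2⟩, Subgroup.subset_closure ⟨w, rfl⟩, rfl⟩, ?_⟩
  rw [SetLike.mem_coe, Unitary.mem_iff, CliffordAlgebra.star_ι]
  exact ⟨h2, h1⟩

/-- Moving w past a vector u reflects u and changes the sign; the factor (-1)^k in `PinCovers`
records these signs. -/
lemma PinCovers.reflMat_mul {s : CliffordAlgebra (quad n)} {k : ℕ}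
    {M : Matrix (Idx n) (Idx n) ℂ} (h : PinCovers s k M) {w : V n} (hw : bform n w w = -2) :
    PinCovers (CliffordAlgebra.ι (quad n) w * s) (k + 1) (reflMat w * M) where
  mem := mul_mem (ι_mem_pinGroup hw) h.mem
  parity := by
    have := SetLike.mul_mem_graded (CliffordAlgebra.ι_mem_evenOdd_one (quad n) w) h.parity
    rw [Nat.cast_add, Nat.cast_one, add_comm]
    exact this
  det := by rw [det_mul, det_reflMat hw, h.det, pow_succ']
  covers := by
    intro v
    have h1 : ∀ u, CliffordAlgebra.ι (quad n) w * CliffordAlgebra.ι (quad n) u =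
        -(CliffordAlgebra.ι (quad n) (reflMat w *ᵥ u) * CliffordAlgebra.ι (quad n) w) := by
      intro u
      have h2 := CliffordAlgebra.ι_mul_ι_add_swap (Q := quad n) w u
      rw [polar_quad] at h2
      rw [reflMat_mulVec, map_add, map_smul, add_mul, smul_mul_assoc, ι_mul_self hw,
        eq_sub_of_add_eq h2, bform_comm w u, Algebra.algebraMap_eq_smul_one, smul_neg]
      abel
    rw [mul_assoc, h.covers, ← mul_assoc, ((Commute.neg_one_right _).pow_right _).eq, mul_assoc,
      ← mul_assoc (CliffordAlgebra.ι (quad n) w), h1, pow_succ, mulVec_mulVec, neg_mul, mul_neg,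
      mul_neg_one, neg_mul, mul_assoc]

lemma reflMat_mul_reflMat {w : V n} (hw : bform n w w = -2) : reflMat w * reflMat w = 1 := by
  refine Matrix.ext_of_mulVec_single fun a => ?_
  rw [← mulVec_mulVec, reflMat_mulVec, reflMat_mulVec, bform_add_left, bform_smul_left, hw,
    one_mulVec]
  module

/-- An orthogonal basis of `V`. -/
def orthVec (n : ℕ) : Idx n → V n
  | Sum.inl i => stdVec n (Sum.inl i) + stdVec n (Sum.inr i)
  | Sum.inr i => stdVec n (Sum.inl i) - stdVec n (Sum.inr i)

lemma bform_orthVec_self (a : Idx n) : bform n (orthVec n a) (orthVec n a) ≠ 0 := by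
  rcases a with i | i
  · simp [orthVec, bform_add_left, bform_stdVec_left]
  · simp [orthVec, bform_sub_left, bform_stdVec_left]
    norm_num

lemma bform_orthVec_of_ne {a b : Idx n} (h : a ≠ b) : bform n (orthVec n a) (orthVec n b) = 0 := by
  rcases a with i | i <;> rcases b with j | j <;>
    simp [orthVec, bform_add_left, bform_sub_left, bform_stdVec_left, Pi.single_apply] <;>
    aesop

lemma eq_one_of_mulVec_orthVec {M : Matrix (Idx n) (Idx n) ℂ}
    (h : ∀ a, M *ᵥ orthVec n a = orthVec n a) : M = 1 := by
  refine Matrix.ext_of_mulVec_single fun a => ?_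
  rw [one_mulVec]
  have e1 (i : Fin n) : stdVec n (Sum.inl i) =
      (1 / 2 : ℂ) • (orthVec n (Sum.inl i) + orthVec n (Sum.inr i)) := by
    simp only [orthVec]; module
  have e2 (i : Fin n) : stdVec n (Sum.inr i) =
      (1 / 2 : ℂ) • (orthVec n (Sum.inl i) - orthVec n (Sum.inr i)) := by
    simp only [orthVec]; module
  rcases a with i | i
  · rw [show (Pi.single (Sum.inl i) 1 : V n) = _ from e1 i, mulVec_smul, mulVec_add, h, h]
  · rw [show (Pi.single (Sum.inr i) 1 : V n) = _ from e2 i, mulVec_smul, mulVec_sub, h, h]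

/-- Over ℂ every anisotropic vector can be rescaled to Q(w, w) = -2. -/
lemma exists_reflMat {u : V n} (hu : bform n u u ≠ 0) :
    ∃ w : V n, bform n w w = -2 ∧
      ∀ v, reflMat w *ᵥ v = v - (2 * bform n v u / bform n u u) • u := by
  obtain ⟨c, hc⟩ := IsAlgClosed.exists_pow_nat_eq (-2 / bform n u u) (n := 2) two_pos
  refine ⟨c • u, ?_, fun v => ?_⟩
  · rw [bform_smul_left, bform_smul_right, ← mul_assoc, ← sq, hc, div_mul_cancel₀ _ hu]
  · rw [reflMat_mulVec, bform_smul_right, smul_smul, mul_right_comm, ← sq, hc, sub_eq_add_neg,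
      ← neg_smul]
    congr 2
    ring

/-- Every orthogonal matrix is a product of reflections. -/
lemma exists_pinCovers {M : Matrix (Idx n) (Idx n) ℂ} (hM : IsOrthogonal M) :
    ∃ s k, PinCovers s k M := by
  have step : ∀ (w : V n) (N : Matrix (Idx n) (Idx n) ℂ), bform n w w = -2 →
      (∃ s k, PinCovers s k (reflMat w * N)) → ∃ s k, PinCovers s k N := by
    rintro w N hw ⟨s, k, h⟩
    have := h.reflMat_mul hw
    rw [← Matrix.mul_assoc, reflMat_mul_reflMat hw, Matrix.one_mul] at this
    exact ⟨_, _, this⟩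
  -- Cartan-Dieudonné by induction on the set t of vectors of the orthogonal basis that N may still
  -- move.
  have key : ∀ t : Finset (Idx n), ∀ N, IsOrthogonal N →
      (∀ a ∉ t, N *ᵥ orthVec n a = orthVec n a) → ∃ s k, PinCovers s k N := by
    intro t
    induction t using Finset.induction with
    | empty =>
      intro N _ h
      rw [eq_one_of_mulVec_orthVec fun a => h a (Finset.notMem_empty a)]
      exact ⟨1, 0, one_mem _, by simpa using SetLike.GradedOne.one_mem, by simp, by simp⟩
    | insert a t ha ih =>
      intro N hN h
      set v := orthVec n a with hv
      have hfix : ∀ b ∉ insert a t, bform n (orthVec n b) (N *ᵥ v) = 0 := by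
        intro b hb
        rw [← h b hb, hN.bform_mulVec]
        exact bform_orthVec_of_ne fun hab => hb (hab ▸ Finset.mem_insert_self _ _)
      have hfix' : ∀ b ∉ insert a t, bform n (orthVec n b) v = 0 := fun b hb =>
        bform_orthVec_of_ne fun hab => hb (hab ▸ Finset.mem_insert_self _ _)
      have hNv : bform n (N *ᵥ v) (N *ᵥ v) = bform n v v := hN.bform_mulVec v v
      have hv0 : bform n v v ≠ 0 := bform_orthVec_self a
      -- The reflection in N v - v carries N v to v unless that vector is isotropic. In that case
      -- Q(N v + v, N v + v) = 4 Q(v, v) ≠ 0, and the reflection in N v + v followed by the one in v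
      -- does the same. All these mirrors are orthogonal to the vectors already fixed.
      by_cases h0 : bform n (N *ᵥ v - v) (N *ᵥ v - v) = 0
      · have h1 : bform n (N *ᵥ v + v) (N *ᵥ v + v) = 4 * bform n v v := by
          simp only [bform_add_left, bform_sub_left, bform_add_right, bform_sub_right, hNv] at h0 ⊢
          linear_combination -h0
        have h1' : bform n (N *ᵥ v + v) (N *ᵥ v + v) ≠ 0 := by
          rw [h1]
          exact mul_ne_zero (by norm_num) hv0
        obtain ⟨w, hw, hw'⟩ := exists_reflMat h1'
        obtain ⟨w₂, hw₂, hw₂'⟩ := exists_reflMat hv0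
        refine step w N hw (step w₂ _ hw₂ (ih _ ?_ ?_))
        · exact (isOrthogonal_reflMat hw₂).mul ((isOrthogonal_reflMat hw).mul hN)
        · intro b hb
          rw [← mulVec_mulVec, ← mulVec_mulVec]
          by_cases hba : b = a
          · have h2 : bform n (N *ᵥ v) (N *ᵥ v + v) = 2 * bform n v v := by
              have := h1
              simp only [bform_add_left, bform_add_right, hNv, bform_comm v (N *ᵥ v)] at this ⊢
              linear_combination this / 2
            rw [hba, ← hv, hw', h2, h1, show 2 * (2 * bform n v v) / (4 * bform n v v) = 1 by
              field_simp; norm_num, one_smul, hw₂',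
              show N *ᵥ v - (N *ᵥ v + v) = (-1 : ℂ) • v by module, bform_smul_left,
              show 2 * (-1 * bform n v v) / bform n v v = -2 by field_simp]
            module
          · have hb' : b ∉ insert a t := by simp [hba, hb]
            rw [h b hb', hw', bform_add_right, hfix b hb', hfix' b hb', add_zero, mul_zero,
              zero_div, zero_smul, sub_zero, hw₂', hfix' b hb', mul_zero, zero_div, zero_smul,
              sub_zero]
      · obtain ⟨w, hw, hw'⟩ := exists_reflMat h0
        refine step w N hw (ih _ ((isOrthogonal_reflMat hw).mul hN) ?_)
        intro b hb
        rw [← mulVec_mulVec]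
        by_cases hba : b = a
        · have h2 : 2 * bform n (N *ᵥ v) (N *ᵥ v - v) = bform n (N *ᵥ v - v) (N *ᵥ v - v) := by
            simp only [bform_sub_left, bform_sub_right, hNv, bform_comm v (N *ᵥ v)]
            ring
          rw [hba, ← hv, hw', h2, div_self h0]
          module
        · have hb' : b ∉ insert a t := by simp [hba, hb]
          rw [h b hb', hw', bform_sub_right, hfix b hb', hfix' b hb', sub_zero, mul_zero,
            zero_div, zero_smul, sub_zero]
  exact key Finset.univ M hM fun a ha => absurd (Finset.mem_univ a) ha

lemma covers_spinLift (g : SO n) : Covers (spinLift g) g := by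
  refine Classical.epsilon_spec (p := fun s => Covers s g) ?_
  obtain ⟨s, k, h⟩ := exists_pinCovers (isOrthogonal_mat g)
  -- The determinant is 1, so the number of reflections is even and the product of vectors lies in
  -- the even part.
  have hk : Even k := by
    by_contra hk
    have := h.det
    rw [det_mat, (Nat.not_even_iff_odd.1 hk).neg_one_pow] at this
    norm_num at this
  have hk2 : (k : ZMod 2) = 0 := (ZMod.natCast_eq_zero_iff_even).2 hk
  refine ⟨⟨s, h.mem, ?_⟩, fun v => ?_⟩
  · have := h.parity
    rw [hk2] at this
    exact this
  · have := h.covers v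
    rw [hk.neg_one_pow, one_mul] at this
    rw [act, toLin'_apply]
    exact this

end SpinLift

/-! ### The gamma matrices of the spin module -/

section Gamma

variable {n : ℕ}

lemma spinBasis_empty : spinBasis n ∅ = 1 := by
  rw [ExteriorAlgebra.basis_apply_ofCard _ Finset.card_empty, ExteriorAlgebra.ιMulti_family,
    ExteriorAlgebra.ιMulti_apply]
  simp

lemma spinBasis_singleton (i : Fin n) :
    spinBasis n {i} = ExteriorAlgebra.ι ℂ (Pi.single i (1 : ℂ)) := by
  rw [ExteriorAlgebra.basis_apply_ofCard _ (Finset.card_singleton i), ExteriorAlgebra.ιMulti_family,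
    ExteriorAlgebra.ιMulti_apply]
  have h : (Set.powersetCard.ofFinEmbEquiv.symm
      (Set.powersetCard.ofCard (Finset.card_singleton i))) 0 = i := by
    have := (Set.powersetCard.mem_range_ofFinEmbEquiv_symm_iff_mem
      (Set.powersetCard.ofCard (Finset.card_singleton i)) _).1 (Set.mem_range_self 0)
    exact Finset.mem_singleton.1 this
  simp [h]

/-- The sign is kept abstract: only its square is ever used. -/
lemma exists_ι_mul_spinBasis (i : Fin n) (J : Finset (Fin n)) (hi : i ∉ J) :
    ∃ σ : ℤˣ, ExteriorAlgebra.ι ℂ (Pi.single i (1 : ℂ)) * spinBasis n J =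
      σ • spinBasis n (insert i J) := by
  have hd : Disjoint (Set.powersetCard.ofCard (Finset.card_singleton i)).val
      (Set.powersetCard.ofCard (rfl : J.card = J.card)).val := by
    simpa using hi
  have h := ExteriorAlgebra.basis_mul_of_disjoint (Pi.basisFun ℂ (Fin n)) _ _ hd
  rw [← spinBasis_singleton]
  rw [Set.powersetCard.coe_disjUnion, Finset.disjUnion_eq_union] at h
  exact ⟨_, h⟩

lemma ι_mul_spinBasis_of_mem (i : Fin n) (J : Finset (Fin n)) (hi : i ∈ J) :
    ExteriorAlgebra.ι ℂ (Pi.single i (1 : ℂ)) * spinBasis n J = 0 := by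
  rw [← spinBasis_singleton]
  refine ExteriorAlgebra.basis_mul_of_not_disjoint (Pi.basisFun ℂ (Fin n))
    (Set.powersetCard.ofCard (Finset.card_singleton i))
    (Set.powersetCard.ofCard (rfl : J.card = J.card)) ?_
  simpa using hi

open Classical in
/-- The sign in `e_i ∧ e_J = ± e_{J ∪ {i}}`, `i ∉ J`. -/
def spinSign (i : Fin n) (J : Finset (Fin n)) : ℤˣ :=
  if h : i ∉ J then (exists_ι_mul_spinBasis i J h).choose else 1

lemma ι_mul_spinBasis (i : Fin n) (J : Finset (Fin n)) (hi : i ∉ J) :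
    ExteriorAlgebra.ι ℂ (Pi.single i (1 : ℂ)) * spinBasis n J =
      ((spinSign i J : ℤ) : ℂ) • spinBasis n (insert i J) := by
  refine (exists_ι_mul_spinBasis i J hi).choose_spec.trans ?_
  rw [spinSign, dif_pos hi, Units.smul_def, Int.cast_smul_eq_zsmul]

lemma cliffordMul_inl (i : Fin n) (x : Spinors n) :
    cliffordMul n (stdVec n (Sum.inl i)) x = ExteriorAlgebra.ι ℂ (Pi.single i (1 : ℂ)) * x := by
  have h1 : (LinearMap.funLeft ℂ ℂ (Sum.inl : Fin n → Idx n)) (stdVec n (Sum.inl i)) =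
      Pi.single i 1 := by
    ext j; simp [LinearMap.funLeft, Pi.single_apply]
  have h2 : (LinearMap.funLeft ℂ ℂ (Sum.inr : Fin n → Idx n)) (stdVec n (Sum.inl i)) = 0 := by
    ext j; simp [LinearMap.funLeft]
  simp [cliffordMul, h1, h2]

lemma cliffordMul_inr (i : Fin n) (x : Spinors n) :
    cliffordMul n (stdVec n (Sum.inr i)) x =
      CliffordAlgebra.contractLeft ((Pi.basisFun ℂ (Fin n)).toDual (Pi.single i 1)) x := by
  have h1 : (LinearMap.funLeft ℂ ℂ (Sum.inr : Fin n → Idx n)) (stdVec n (Sum.inr i)) =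
      Pi.single i 1 := by
    ext j; simp [LinearMap.funLeft, Pi.single_apply]
  have h2 : (LinearMap.funLeft ℂ ℂ (Sum.inl : Fin n → Idx n)) (stdVec n (Sum.inr i)) = 0 := by
    ext j; simp [LinearMap.funLeft]
  simp [cliffordMul, h1, h2]

lemma cliffordMul_inr_ι_mul (i j : Fin n) (x : Spinors n) :
    cliffordMul n (stdVec n (Sum.inr i)) (ExteriorAlgebra.ι ℂ (Pi.single j (1 : ℂ)) * x) =
      (if i = j then (1 : ℂ) else 0) • x -
        ExteriorAlgebra.ι ℂ (Pi.single j (1 : ℂ)) * cliffordMul n (stdVec n (Sum.inr i)) x := by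
  rw [cliffordMul_inr, cliffordMul_inr]
  refine (CliffordAlgebra.contractLeft_ι_mul _ _ _).trans ?_
  have h := Module.Basis.toDual_apply (Pi.basisFun ℂ (Fin n)) i j
  rw [Pi.basisFun_apply, Pi.basisFun_apply] at h
  rw [h]

lemma units_cast_mul_self (σ : ℤˣ) : ((σ : ℤ) : ℂ) * ((σ : ℤ) : ℂ) = 1 := by
  rw [← Int.cast_mul, ← Units.val_mul, Int.units_mul_self, Units.val_one, Int.cast_one]

lemma spinBasis_insert (i : Fin n) (J : Finset (Fin n)) (hi : i ∉ J) :
    spinBasis n (insert i J) = ((spinSign i J : ℤ) : ℂ) •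
      (ExteriorAlgebra.ι ℂ (Pi.single i (1 : ℂ)) * spinBasis n J) := by
  rw [ι_mul_spinBasis i J hi, smul_smul, units_cast_mul_self, one_smul]

lemma cliffordMul_inr_spinBasis_of_notMem (i : Fin n) (J : Finset (Fin n)) (hi : i ∉ J) :
    cliffordMul n (stdVec n (Sum.inr i)) (spinBasis n J) = 0 := by
  induction J using Finset.induction with
  | empty =>
    rw [spinBasis_empty, cliffordMul_inr]
    exact CliffordAlgebra.contractLeft_one (0 : QuadraticForm ℂ (Fin n → ℂ)) _
  | insert j J hj ih =>
    rw [Finset.mem_insert, not_or] at hi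
    rw [spinBasis_insert j J hj, map_smul, cliffordMul_inr_ι_mul, if_neg hi.1, ih hi.2, zero_smul,
      mul_zero, sub_zero, smul_zero]

lemma cliffordMul_inr_spinBasis_insert (i : Fin n) (J : Finset (Fin n)) (hi : i ∉ J) :
    cliffordMul n (stdVec n (Sum.inr i)) (spinBasis n (insert i J)) =
      ((spinSign i J : ℤ) : ℂ) • spinBasis n J := by
  rw [spinBasis_insert i J hi, map_smul, cliffordMul_inr_ι_mul, if_pos rfl,
    cliffordMul_inr_spinBasis_of_notMem i J hi, one_smul, mul_zero, sub_zero]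

/-- The matrices of the elements of the Clifford algebra in the basis of the spin module. -/
def spinMat (n : ℕ) :
    CliffordAlgebra (quad n) →ₐ[ℂ] Matrix (Finset (Fin n)) (Finset (Fin n)) ℂ :=
  (LinearMap.toMatrixAlgEquiv (spinBasis n)).toAlgHom.comp (spinModule n)

/-- The matrices of the vectors. -/
def gam (n : ℕ) : V n →ₗ[ℂ] Matrix (Finset (Fin n)) (Finset (Fin n)) ℂ :=
  (spinMat n).toLinearMap ∘ₗ CliffordAlgebra.ι (quad n)

lemma spinMat_apply (x : CliffordAlgebra (quad n)) (I J : Finset (Fin n)) :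
    spinMat n x I J = (spinBasis n).repr (spinModule n x (spinBasis n J)) I :=
  LinearMap.toMatrixAlgEquiv_apply _ _ _ _

lemma spinMat_ι (v : V n) : spinMat n (CliffordAlgebra.ι (quad n) v) = gam n v := rfl

lemma gam_apply (v : V n) (I J : Finset (Fin n)) :
    gam n v I J = (spinBasis n).repr (cliffordMul n v (spinBasis n J)) I := by
  rw [← spinMat_ι, spinMat_apply, spinModule, CliffordAlgebra.lift_ι_apply]

lemma gam_mul_add (v w : V n) : gam n v * gam n w + gam n w * gam n v = bform n v w • 1 := by
  rw [← spinMat_ι, ← spinMat_ι, ← map_mul (spinMat n), ← map_mul (spinMat n), ← map_add (spinMat n),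
    CliffordAlgebra.ι_mul_ι_add_swap, polar_quad, AlgHom.commutes, Algebra.algebraMap_eq_smul_one]

lemma gam_inl (i : Fin n) (I J : Finset (Fin n)) : gam n (stdVec n (Sum.inl i)) I J =
    if i ∉ J ∧ I = insert i J then ((spinSign i J : ℤ) : ℂ) else 0 := by
  rw [gam_apply, cliffordMul_inl]
  by_cases hi : i ∈ J
  · rw [ι_mul_spinBasis_of_mem i J hi, if_neg (fun h => h.1 hi)]
    simp
  · rw [ι_mul_spinBasis i J hi]
    by_cases hI : I = insert i J
    · simp [hI, hi]
    · rw [if_neg (fun h => hI h.2)]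
      simp [Ne.symm hI]

lemma gam_inr (i : Fin n) (I J : Finset (Fin n)) : gam n (stdVec n (Sum.inr i)) I J =
    if i ∉ I ∧ J = insert i I then ((spinSign i I : ℤ) : ℂ) else 0 := by
  rw [gam_apply]
  by_cases hi : i ∈ J
  · obtain ⟨J, hi', rfl⟩ : ∃ J', i ∉ J' ∧ J = insert i J' :=
      ⟨J.erase i, Finset.notMem_erase _ _, (Finset.insert_erase hi).symm⟩
    rw [cliffordMul_inr_spinBasis_insert i J hi']
    by_cases hI : J = I
    · subst hI
      simp [hi']
    · rw [if_neg]
      · simp [hI]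
      · rintro ⟨h1, h2⟩
        exact hI (by rw [← Finset.erase_insert hi', h2, Finset.erase_insert h1])
  · rw [cliffordMul_inr_spinBasis_of_notMem i J hi, if_neg]
    · simp
    · rintro ⟨_, rfl⟩
      exact hi (Finset.mem_insert_self _ _)

/-- Wedging with e_i and contracting with f_i use the same signs and are transposes of each other.
The entries are real, so the same holds for adjoints. -/
lemma gam_transpose_stdVec (a : Idx n) : (gam n (stdVec n a))ᵀ = gam n (stdVec n a.swap) := by
  ext I J
  rcases a with i | i
  · rw [Sum.swap_inl, gam_inr, transpose_apply, gam_inl]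
  · rw [Sum.swap_inr, gam_inl, transpose_apply, gam_inr]

lemma gam_conjTranspose_stdVec (a : Idx n) : (gam n (stdVec n a))ᴴ = gam n (stdVec n a.swap) := by
  rw [← gam_transpose_stdVec]
  ext I J
  rw [conjTranspose_apply, transpose_apply]
  rcases a with i | i
  · rw [gam_inl]; split_ifs <;> simp
  · rw [gam_inr]; split_ifs <;> simp

lemma gam_eq_sum (v : V n) : gam n v = ∑ a, v a • gam n (stdVec n a) := by
  have h : v = ∑ a, v a • stdVec n a := by
    ext b
    simp [Finset.sum_apply, Pi.single_apply]
  conv_lhs => rw [h, map_sum]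
  simp only [map_smul]

lemma gam_transpose (v : V n) : (gam n v)ᵀ = gam n (v ∘ Sum.swap) := by
  rw [gam_eq_sum, gam_eq_sum (v ∘ _), transpose_sum, ← Equiv.sum_comp (Equiv.sumComm _ _)]
  refine Finset.sum_congr rfl fun a _ => ?_
  rw [transpose_smul, gam_transpose_stdVec, Equiv.sumComm_apply, Sum.swap_swap, Function.comp]

lemma gam_conjTranspose (v : V n) : (gam n v)ᴴ = gam n (star v ∘ Sum.swap) := by
  rw [gam_eq_sum, gam_eq_sum (_ ∘ _), conjTranspose_sum, ← Equiv.sum_comp (Equiv.sumComm _ _)]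
  refine Finset.sum_congr rfl fun a _ => ?_
  rw [conjTranspose_smul, gam_conjTranspose_stdVec, Equiv.sumComm_apply, Sum.swap_swap]
  rfl

/-- The component of a vector in `W`. -/
def wPart (v : V n) : V n := Sum.elim (fun i => v (Sum.inl i)) 0

/-- The component of a vector in `W'`. -/
def wPart' (v : V n) : V n := Sum.elim 0 (fun i => v (Sum.inr i))

lemma wPart_add_wPart' (v : V n) : wPart v + wPart' v = v := by
  ext a
  rcases a with i | i <;> simp [wPart, wPart']

lemma gam_wPart_apply_of_ne (v : V n) {I J : Finset (Fin n)} (h : I.card ≠ J.card + 1) :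
    gam n (wPart v) I J = 0 := by
  rw [gam_eq_sum, Matrix.sum_apply, Fintype.sum_sum_type]
  have h1 (i : Fin n) : gam n (stdVec n (Sum.inl i)) I J = 0 := by
    rw [gam_inl, if_neg]
    rintro ⟨h1, rfl⟩
    exact h (Finset.card_insert_of_notMem h1)
  simp [h1, wPart]

lemma gam_wPart'_apply_of_ne (v : V n) {I J : Finset (Fin n)} (h : J.card ≠ I.card + 1) :
    gam n (wPart' v) I J = 0 := by
  rw [gam_eq_sum, Matrix.sum_apply, Fintype.sum_sum_type]
  have h1 (i : Fin n) : gam n (stdVec n (Sum.inr i)) I J = 0 := by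
    rw [gam_inr, if_neg]
    rintro ⟨h1, rfl⟩
    exact h (Finset.card_insert_of_notMem h1)
  simp [h1, wPart']

/-- Each vector raises the degree by at most one, through its component in W. Starting from the unit
spinor, degree equal to the number of factors is reached only if every factor acts through W. -/
lemma gam_list_prod_apply (l : List (V n)) :
    (∀ I : Finset (Fin n), l.length < I.card → (l.map (gam n)).prod I ∅ = 0) ∧
    ∀ I : Finset (Fin n), l.length ≤ I.card →
      (l.map (gam n)).prod I ∅ = (l.map fun v => gam n (wPart v)).prod I ∅ := by
  induction l with
  | nil =>
    refine ⟨fun I hI => ?_, fun I _ => rfl⟩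
    rw [List.map_nil, List.prod_nil, Matrix.one_apply_ne]
    rintro rfl
    simp at hI
  | cons w l ih =>
    simp only [List.map_cons, List.prod_cons, List.length_cons]
    refine ⟨fun I hI => ?_, fun I hI => ?_⟩
    · rw [Matrix.mul_apply]
      refine Finset.sum_eq_zero fun J _ => ?_
      by_cases hJ : l.length < J.card
      · rw [ih.1 J hJ, mul_zero]
      · rw [← wPart_add_wPart' w, map_add, Matrix.add_apply,
          gam_wPart_apply_of_ne w (by omega), gam_wPart'_apply_of_ne w (by omega), add_zero,
          zero_mul]
    · rw [Matrix.mul_apply, Matrix.mul_apply]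
      refine Finset.sum_congr rfl fun J _ => ?_
      conv_lhs => rw [← wPart_add_wPart' w, map_add, Matrix.add_apply]
      by_cases hJ : l.length < J.card
      · rw [ih.1 J hJ, ← ih.2 J hJ.le, ih.1 J hJ, mul_zero, mul_zero]
      · rw [gam_wPart'_apply_of_ne w (by omega), add_zero]
        by_cases hJ' : I.card = J.card + 1
        · rw [ih.2 J (by omega)]
        · rw [gam_wPart_apply_of_ne w hJ', zero_mul, zero_mul]

lemma gam_wPart_list_prod_apply_of_ne (l : List (V n)) {I J : Finset (Fin n)}
    (h : I.card ≠ J.card + l.length) : (l.map fun v => gam n (wPart v)).prod I J = 0 := by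
  induction l generalizing I with
  | nil =>
    rw [List.map_nil, List.prod_nil, Matrix.one_apply_ne]
    rintro rfl
    simp at h
  | cons w l ih =>
    rw [List.map_cons, List.prod_cons, Matrix.mul_apply]
    refine Finset.sum_eq_zero fun K _ => ?_
    rw [List.length_cons] at h
    by_cases hK : I.card = K.card + 1
    · rw [ih (by omega), mul_zero]
    · rw [gam_wPart_apply_of_ne w hK, zero_mul]

lemma cliffordMul_wPart (v : V n) (x : Spinors n) :
    cliffordMul n (wPart v) x = ExteriorAlgebra.ι ℂ (fun i => v (Sum.inl i)) * x := by
  have h1 : (LinearMap.funLeft ℂ ℂ (Sum.inl : Fin n → Idx n)) (wPart v) =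
      fun i => v (Sum.inl i) := by
    ext j; simp [LinearMap.funLeft, wPart]
  have h2 : (LinearMap.funLeft ℂ ℂ (Sum.inr : Fin n → Idx n)) (wPart v) = 0 := by
    ext j; simp [LinearMap.funLeft, wPart]
  simp [cliffordMul, h1, h2]

lemma spinModule_wPart_list_prod (l : List (V n)) :
    spinModule n (l.map fun v => CliffordAlgebra.ι (quad n) (wPart v)).prod 1 =
      (l.map fun v => ExteriorAlgebra.ι ℂ (fun i => v (Sum.inl i))).prod := by
  induction l with
  | nil => simp
  | cons w l ih =>
    rw [List.map_cons, List.prod_cons, List.map_cons, List.prod_cons, map_mul,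
      Module.End.mul_apply, ih, spinModule, CliffordAlgebra.lift_ι_apply, cliffordMul_wPart]

lemma repr_ιMulti_univ (w : Fin n → Fin n → ℂ) :
    (spinBasis n).repr (ExteriorAlgebra.ιMulti ℂ n w) Finset.univ = (Matrix.of w).det := by
  let F : (Fin n → ℂ) [⋀^Fin n]→ₗ[ℂ] ℂ :=
    ((spinBasis n).coord Finset.univ).compAlternatingMap (ExteriorAlgebra.ιMulti ℂ n)
  have h1 : F (Pi.basisFun ℂ (Fin n)) = 1 := by
    have h2 : ExteriorAlgebra.ιMulti ℂ n (Pi.basisFun ℂ (Fin n)) = spinBasis n Finset.univ := by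
      rw [ExteriorAlgebra.basis_apply_ofCard _ (Finset.card_fin n), ExteriorAlgebra.ιMulti_family]
      congr 1
      have h3 : ⇑(Set.powersetCard.ofFinEmbEquiv.symm
          (Set.powersetCard.ofCard (Finset.card_fin n))) = id := by
        rw [Set.powersetCard.ofFinEmbEquiv_symm_apply]
        exact (Finset.orderEmbOfFin_unique _ (fun _ => Finset.mem_univ _) strictMono_id).symm
      rw [h3]
      rfl
    exact (congrArg (fun x => (spinBasis n).repr x Finset.univ) h2).trans (by simp)
  have h := congrArg (fun G : (Fin n → ℂ) [⋀^Fin n]→ₗ[ℂ] ℂ => G w)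
    (AlternatingMap.eq_smul_basis_det (Pi.basisFun ℂ (Fin n)) F)
  rw [h1, one_smul] at h
  refine h.trans ?_
  rw [Pi.basisFun_det_apply]

/-- The top coefficient of a product of `n` vectors applied to the unit spinor. -/
lemma gam_prod_univ_empty (w : Fin n → V n) :
    (List.ofFn fun j => gam n (w j)).prod Finset.univ ∅ =
      (Matrix.of fun i j => w j (Sum.inl i)).det := by
  have h := (gam_list_prod_apply (List.ofFn w)).2 Finset.univ (by simp)
  rw [List.map_ofFn, List.map_ofFn] at h
  refine h.trans ?_
  have h1 : (List.ofFn ((fun v => gam n (wPart v)) ∘ w)).prod =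
      spinMat n ((List.ofFn w).map fun v => CliffordAlgebra.ι (quad n) (wPart v)).prod := by
    rw [map_list_prod, List.map_map, List.map_ofFn]
    rfl
  rw [h1, spinMat_apply, spinBasis_empty, spinModule_wPart_list_prod, List.map_ofFn,
    ← det_transpose]
  exact (congrArg (fun x => (spinBasis n).repr x Finset.univ)
    (ExteriorAlgebra.ιMulti_apply (R := ℂ) fun j i => w j (Sum.inl i)).symm).trans
    (repr_ιMulti_univ _)

end Gamma

/-! ### The square of a coefficient of the half-spin representations -/

section SpinSquare

variable {n : ℕ}

/-- The index `i` of `e_i` and of `f_i`. -/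
def idx (a : Idx n) : Fin n := Sum.elim id id a

/-- The Clifford multiplication by `e_i - f_i`. -/
def flipMat (n : ℕ) (i : Fin n) : Matrix (Finset (Fin n)) (Finset (Fin n)) ℂ :=
  gam n (orthVec n (Sum.inr i))

lemma transpose_flipMat (i : Fin n) : (flipMat n i)ᵀ = -flipMat n i := by
  rw [flipMat, orthVec, map_sub, transpose_sub, gam_transpose_stdVec, gam_transpose_stdVec, neg_sub]
  rfl

lemma conjTranspose_flipMat (i : Fin n) : (flipMat n i)ᴴ = (flipMat n i)ᵀ := by
  rw [flipMat, orthVec, map_sub, transpose_sub, conjTranspose_sub]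
  simp only [gam_transpose_stdVec, gam_conjTranspose_stdVec]

lemma flipMat_mul_transpose (i : Fin n) : flipMat n i * (flipMat n i)ᵀ = 1 := by
  have h := gam_mul_add (orthVec n (Sum.inr i)) (orthVec n (Sum.inr i))
  have h2 : bform n (orthVec n (Sum.inr i)) (orthVec n (Sum.inr i)) = -2 := by
    simp [orthVec, bform_sub_left, bform_stdVec_left]
    norm_num
  rw [transpose_flipMat, mul_neg, flipMat]
  rw [h2, ← two_smul ℂ] at h
  have h3 := congrArg (fun X => (-1 / 2 : ℂ) • X) h
  simp only [smul_smul] at h3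
  norm_num at h3
  exact h3

/-- The vector e_i - f_i has Q = -2, so moving it past a vector reflects that vector; the reflection
exchanges e_i and f_i and fixes the other basis vectors. -/
lemma flipMat_mul_gam_stdVec (i : Fin n) (a : Idx n) :
    flipMat n i * gam n (stdVec n a) =
      -(gam n (stdVec n (if idx a = i then a.swap else a)) * flipMat n i) := by
  have h := gam_mul_add (orthVec n (Sum.inr i)) (stdVec n a)
  have h1 : flipMat n i * gam n (stdVec n a) =
      bform n (stdVec n a) (orthVec n (Sum.inr i)) • 1 - gam n (stdVec n a) * flipMat n i := by
    rw [bform_comm]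
    exact eq_sub_of_add_eq h
  have h2 := flipMat_mul_transpose i
  rw [transpose_flipMat, mul_neg] at h2
  have h3 : gam n (stdVec n (if idx a = i then a.swap else a)) =
      gam n (stdVec n a) + bform n (stdVec n a) (orthVec n (Sum.inr i)) • flipMat n i := by
    rw [flipMat, ← map_smul, ← map_add]
    congr 1
    rw [bform_stdVec_left]
    rcases a with j | j <;> by_cases hj : j = i <;> simp [idx, orthVec, hj]
  rw [h1, h3, add_mul, smul_mul_assoc, ← neg_neg (flipMat n i * flipMat n i), h2, smul_neg]
  abel

lemma flipMat_list_prod_mul_gam (l : List (Fin n)) (hl : l.Nodup) (a : Idx n) :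
    (l.map (flipMat n)).prod * gam n (stdVec n a) = (-1 : ℂ) ^ l.length •
      (gam n (stdVec n (if idx a ∈ l then a.swap else a)) * (l.map (flipMat n)).prod) := by
  induction l with
  | nil => simp
  | cons i l ih =>
    rw [List.nodup_cons] at hl
    rw [List.map_cons, List.prod_cons, List.length_cons, mul_assoc, ih hl.2, mul_smul_comm,
      ← mul_assoc, flipMat_mul_gam_stdVec, pow_succ, mul_smul, neg_one_smul, neg_mul, mul_assoc]
    have hsw : idx a.swap = idx a := by rcases a with j | j <;> rfl
    have : (if idx (if idx a ∈ l then a.swap else a) = i then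
        (if idx a ∈ l then a.swap else a).swap else if idx a ∈ l then a.swap else a) =
        if idx a ∈ i :: l then a.swap else a := by
      by_cases h1 : idx a ∈ l
      · have h2 : idx a ≠ i := fun h => hl.1 (h ▸ h1)
        simp [h1, hsw, h2]
      · by_cases h2 : idx a = i
        · subst h2
          simp [h1]
        · simp [h1, h2]
    rw [this]

/-- The product of all the `e_i - f_i`, acting on spinors. -/
def flipAll (n : ℕ) : Matrix (Finset (Fin n)) (Finset (Fin n)) ℂ :=
  ((List.finRange n).map (flipMat n)).prod

/-- Conjugation by all the e_i - f_i exchanges every e_i with f_i, which undoes the exchange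
produced by transposition. Their composite is `spinTr`, which fixes each vector up to the common
sign (-1)^n. -/
lemma flipAll_mul_gam (v : V n) :
    flipAll n * gam n v = (-1 : ℂ) ^ n • (gam n (v ∘ Sum.swap) * flipAll n) := by
  have h : gam n (v ∘ Sum.swap) = ∑ a, v a • gam n (stdVec n a.swap) := by
    rw [gam_eq_sum, ← Equiv.sum_comp (Equiv.sumComm _ _)]
    simp
  rw [gam_eq_sum v, h, Finset.mul_sum, Finset.sum_mul, Finset.smul_sum]
  refine Finset.sum_congr rfl fun a _ => ?_
  rw [mul_smul_comm, flipAll, flipMat_list_prod_mul_gam _ (List.nodup_finRange n),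
    List.length_finRange, if_pos (List.mem_finRange _), smul_mul_assoc, smul_comm]

lemma flipAll_mul_transpose : flipAll n * (flipAll n)ᵀ = 1 := by
  rw [flipAll]
  induction List.finRange n with
  | nil => simp
  | cons i l ih =>
    rw [List.map_cons, List.prod_cons, transpose_mul]
    calc _ = flipMat n i * ((l.map (flipMat n)).prod * (l.map (flipMat n)).prodᵀ) *
          (flipMat n i)ᵀ := by simp only [Matrix.mul_assoc]
      _ = 1 := by rw [ih, Matrix.mul_one, flipMat_mul_transpose]

lemma transpose_mul_flipAll : (flipAll n)ᵀ * flipAll n = 1 :=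
  mul_eq_one_comm.1 flipAll_mul_transpose

lemma conjTranspose_flipAll : (flipAll n)ᴴ = (flipAll n)ᵀ := by
  rw [flipAll]
  induction List.finRange n with
  | nil => simp
  | cons i l ih =>
    rw [List.map_cons, List.prod_cons, transpose_mul, conjTranspose_mul, ih, conjTranspose_flipMat]

/-- The transposition anti-automorphism that is `± 1` on vectors. -/
def spinTr (A : Matrix (Finset (Fin n)) (Finset (Fin n)) ℂ) :
    Matrix (Finset (Fin n)) (Finset (Fin n)) ℂ := (flipAll n)ᵀ * Aᵀ * flipAll n

lemma spinTr_mul (A B : Matrix (Finset (Fin n)) (Finset (Fin n)) ℂ) :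
    spinTr (A * B) = spinTr B * spinTr A := by
  rw [spinTr, spinTr, spinTr, transpose_mul]
  calc _ = (flipAll n)ᵀ * Bᵀ * 1 * Aᵀ * flipAll n := by simp only [Matrix.mul_assoc, Matrix.one_mul]
    _ = _ := by rw [← flipAll_mul_transpose]; simp only [Matrix.mul_assoc]

lemma spinTr_one : spinTr (1 : Matrix (Finset (Fin n)) (Finset (Fin n)) ℂ) = 1 := by
  rw [spinTr, transpose_one, Matrix.mul_one, transpose_mul_flipAll]

lemma spinTr_conjTranspose (A : Matrix (Finset (Fin n)) (Finset (Fin n)) ℂ) :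
    spinTr Aᴴ = (spinTr A)ᴴ := by
  rw [spinTr, spinTr, conjTranspose_mul, conjTranspose_mul, conjTranspose_flipAll,
    ← conjTranspose_flipAll, conjTranspose_conjTranspose, conjTranspose_flipAll, Matrix.mul_assoc]
  rfl

lemma spinTr_gam (v : V n) : spinTr (gam n v) = (-1 : ℂ) ^ n • gam n v := by
  rw [spinTr, gam_transpose, Matrix.mul_assoc]
  have h := flipAll_mul_gam v
  have h1 : gam n (v ∘ Sum.swap) * flipAll n = (-1 : ℂ) ^ n • (flipAll n * gam n v) := by
    rw [h, smul_smul, ← mul_pow]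
    norm_num
  rw [h1, mul_smul_comm, ← Matrix.mul_assoc, transpose_mul_flipAll, Matrix.one_mul]

/-- On even elements the sign (-1)^n occurs in pairs, so `spinTr` is the reversal; on the spin group
the reversal agrees with the star operation. -/
lemma spinTr_spinMat (s : spinGroup (quad n)) :
    spinTr (spinMat n s) = spinMat n (star (s : CliffordAlgebra (quad n))) := by
  have h : ∀ x ∈ CliffordAlgebra.evenOdd (quad n) 0,
      spinTr (spinMat n x) = spinMat n (CliffordAlgebra.reverse x) := by
    intro x hx
    induction x, hx using CliffordAlgebra.even_induction with
    | algebraMap r =>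
      rw [CliffordAlgebra.reverse.commutes, AlgHom.commutes, Algebra.algebraMap_eq_smul_one, spinTr,
        transpose_smul, mul_smul_comm, smul_mul_assoc]
      exact congrArg _ spinTr_one
    | add x y _ _ hx hy =>
      rw [map_add, map_add, map_add, ← hx, ← hy, spinTr, spinTr, spinTr, transpose_add, mul_add,
        add_mul]
    | ι_mul_ι_mul m₁ m₂ x hx ih =>
      rw [map_mul, map_mul, CliffordAlgebra.reverse.map_mul, CliffordAlgebra.reverse.map_mul,
        CliffordAlgebra.reverse_ι, CliffordAlgebra.reverse_ι, map_mul, map_mul, spinTr_mul,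
        spinTr_mul, ih, spinMat_ι, spinMat_ι, spinTr_gam, spinTr_gam, smul_mul_smul_comm, ← mul_pow,
        mul_smul_comm]
      norm_num
  rw [h _ (spinGroup.mem_even s.2), CliffordAlgebra.star_def, spinGroup.involute_eq s.2]

/-- `A` has the covariance properties of the action on spinors of an element of the spin group
over `H`. -/
structure SpinCovers (A : Matrix (Finset (Fin n)) (Finset (Fin n)) ℂ)
    (H : Matrix (Idx n) (Idx n) ℂ) : Prop where
  mul_gam : ∀ v, A * gam n v = gam n (H *ᵥ v) * A
  mul_spinTr : A * spinTr A = 1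

lemma Covers.spinCovers {s : spinGroup (quad n)} {g : SO n} (h : Covers s g) :
    SpinCovers (spinMat n s) (mat g) where
  mul_gam v := by
    rw [← spinMat_ι, ← map_mul, h v, map_mul, act, toLin'_apply]
    rfl
  mul_spinTr := by
    rw [spinTr_spinMat, ← map_mul, spinGroup.mul_star_self_of_mem s.2, map_one]

variable {A B : Matrix (Finset (Fin n)) (Finset (Fin n)) ℂ} {H K : Matrix (Idx n) (Idx n) ℂ}

lemma SpinCovers.mul (hA : SpinCovers A H) (hB : SpinCovers B K) : SpinCovers (A * B) (H * K) where
  mul_gam v := by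
    rw [Matrix.mul_assoc, hB.mul_gam, ← Matrix.mul_assoc, hA.mul_gam, Matrix.mul_assoc,
      mulVec_mulVec]
  mul_spinTr := by
    rw [spinTr_mul]
    calc _ = A * (B * spinTr B) * spinTr A := by simp only [Matrix.mul_assoc]
      _ = 1 := by rw [hB.mul_spinTr, Matrix.mul_one, hA.mul_spinTr]

/-- Conjugate transposition of the covariance relation, applied to the preimage under H of the
vector whose γ is the adjoint of γ(v). -/
lemma SpinCovers.conjTranspose (hA : SpinCovers A H) (hH : IsOrthogonal H) :
    SpinCovers Aᴴ Hᴴ where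
  mul_gam v := by
    have hsw (u : V n) : gram n *ᵥ u = u ∘ Sum.swap := by
      ext a
      rw [Function.comp, ← bform_stdVec_left a u, bform, single_one_dotProduct]
    have h := congrArg Matrix.conjTranspose (hA.mul_gam ((gram n * Hᵀ * gram n) *ᵥ
      (star v ∘ Sum.swap)))
    rw [mulVec_mulVec, hH.mul_inv, one_mulVec, conjTranspose_mul, conjTranspose_mul,
      gam_conjTranspose, gam_conjTranspose] at h
    have h1 : star (star v ∘ Sum.swap) ∘ Sum.swap = v := by
      ext a
      simp
    have h2 : star ((gram n * Hᵀ * gram n) *ᵥ (star v ∘ Sum.swap)) ∘ Sum.swap = Hᴴ *ᵥ v := by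
      rw [← hsw (star v), mulVec_mulVec, Matrix.mul_assoc, gram_mul_gram, Matrix.mul_one,
        ← mulVec_mulVec, hsw]
      ext a
      simp [mulVec, dotProduct, conjTranspose_apply]
    rw [h1, h2] at h
    exact h.symm
  mul_spinTr := by
    rw [spinTr_conjTranspose, ← conjTranspose_mul, mul_eq_one_comm.1 hA.mul_spinTr,
      conjTranspose_one]

lemma SpinCovers.mul_list_prod (hA : SpinCovers A H) (l : List (V n)) :
    A * (l.map (gam n)).prod = (l.map fun v => gam n (H *ᵥ v)).prod * A := by
  induction l with
  | nil => simp
  | cons w l ih =>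
    rw [List.map_cons, List.prod_cons, List.map_cons, List.prod_cons, ← Matrix.mul_assoc, hA.mul_gam,
      Matrix.mul_assoc, ih, Matrix.mul_assoc]

/-- The product of the actions of `e₁, …, eₙ` on spinors is a matrix unit. -/
lemma gam_inl_prod : (List.ofFn fun j : Fin n => gam n (stdVec n (Sum.inl j))).prod =
    Matrix.single Finset.univ ∅ 1 := by
  ext I J
  by_cases h : Finset.univ = I ∧ ∅ = J
  · obtain ⟨rfl, rfl⟩ := h
    rw [gam_prod_univ_empty, Matrix.single_apply_same]
    convert Matrix.det_one (n := Fin n) (R := ℂ)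
    ext i j
    simp [Matrix.one_apply, Pi.single_apply]
  · rw [Matrix.single_apply, if_neg h]
    have h1 (j : Fin n) : wPart (stdVec n (Sum.inl j)) = stdVec n (Sum.inl j) := by
      ext a
      rcases a with a | a <;> simp [wPart]
    have h2 := gam_wPart_list_prod_apply_of_ne (List.ofFn fun j : Fin n => stdVec n (Sum.inl j))
      (I := I) (J := J) (by
        intro hc
        rw [List.length_ofFn] at hc
        have hI := Finset.card_le_univ I
        rw [Fintype.card_fin] at hI
        refine h ⟨((Finset.card_eq_iff_eq_univ I).1 ?_).symm, (Finset.card_eq_zero.1 ?_).symm⟩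
        · rw [Fintype.card_fin]; omega
        · omega)
    rw [List.map_ofFn] at h2
    simpa only [Function.comp_def, h1] using h2

/-- Contraction by f_i kills the unit spinor, so its image under `flipAll` is killed by wedging with
every e_i and is a multiple of the top vector. The multiple is a determinant, equal to 1. -/
lemma flipAll_apply_empty (I : Finset (Fin n)) :
    flipAll n I ∅ = if I = Finset.univ then 1 else 0 := by
  have key : flipAll n Finset.univ ∅ = 1 := by
    rw [flipAll, ← List.ofFn_eq_map]
    refine (gam_prod_univ_empty fun i => orthVec n (Sum.inr i)).trans ?_
    convert Matrix.det_one (n := Fin n) (R := ℂ)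
    ext i j
    simp [orthVec, Matrix.one_apply, Pi.single_apply]
  split_ifs with h
  · rw [h, key]
  · obtain ⟨i, hi⟩ : ∃ i, i ∉ I := by
      by_contra! hI
      exact h (Finset.eq_univ_iff_forall.2 hI)
    have h1 := congrFun (congrFun (flipAll_mul_gam (stdVec n (Sum.inr i))) (insert i I)) ∅
    have h2 : stdVec n (Sum.inr i) ∘ Sum.swap = stdVec n (Sum.inl i) := by
      ext a
      rcases a with a | a <;> simp [Pi.single_apply]
    rw [h2, Matrix.smul_apply, Matrix.mul_apply, Matrix.mul_apply, Finset.sum_eq_zero,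
      Finset.sum_eq_single I] at h1
    · rw [gam_inl, if_pos ⟨hi, rfl⟩] at h1
      have hσ := units_cast_mul_self (spinSign i I)
      have h3 : ((spinSign i I : ℤ) : ℂ) ≠ 0 := left_ne_zero_of_mul_eq_one hσ
      simpa [h3] using h1.symm
    · intro J _ hJ
      rw [gam_inl, if_neg, zero_mul]
      rintro ⟨h3, h4⟩
      exact hJ (by rw [← Finset.erase_insert h3, ← h4, Finset.erase_insert hi])
    · simp
    · intro J _
      rw [gam_inr, if_neg, mul_zero]
      rintro ⟨_, h4⟩
      exact Finset.insert_ne_empty _ _ h4.symm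

/-- With E = γ(e₁)⋯γ(eₙ) the matrix unit from ∅ to the full set, A E A^τ = γ(He₁)⋯γ(Heₙ), where τ is
`spinTr`. The entry at (univ, ∅) is the determinant of the W-components on the right and A(univ,
univ) A^τ(∅, ∅) on the left. As τ exchanges these two diagonal positions, the left side is a square.
-/
lemma SpinCovers.sq_apply_univ (hA : SpinCovers A H) :
    A Finset.univ Finset.univ ^ 2 = (H.submatrix (Sum.inl : Fin n → Idx n) Sum.inl).det := by
  have h1 : spinTr A ∅ ∅ = A Finset.univ Finset.univ := by
    rw [spinTr, Matrix.mul_apply, Finset.sum_eq_single Finset.univ]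
    · rw [flipAll_apply_empty, if_pos rfl, mul_one, Matrix.mul_apply,
        Finset.sum_eq_single Finset.univ]
      · rw [transpose_apply, transpose_apply, flipAll_apply_empty, if_pos rfl, one_mul]
      · intro I _ hI
        rw [transpose_apply, flipAll_apply_empty, if_neg hI, zero_mul]
      · simp
    · intro I _ hI
      rw [flipAll_apply_empty, if_neg hI, mul_zero]
    · simp
  have h2 := hA.mul_list_prod (List.ofFn fun j : Fin n => stdVec n (Sum.inl j))
  rw [List.map_ofFn, List.map_ofFn, Function.comp_def, Function.comp_def, gam_inl_prod] at h2
  have h3 := congrArg (fun X => (X * spinTr A) Finset.univ ∅) h2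
  simp only [Matrix.mul_assoc, hA.mul_spinTr, Matrix.mul_one] at h3
  rw [gam_prod_univ_empty] at h3
  rw [sq]
  refine (Eq.trans ?_ h3).trans ?_
  · rw [← Matrix.mul_assoc, Matrix.mul_apply, Finset.sum_eq_single ∅, Matrix.mul_single_apply_same,
      mul_one, h1]
    · intro I _ hI
      rw [Matrix.mul_single_apply_of_ne _ _ _ _ _ hI, zero_mul]
    · simp
  · congr 1
    ext i j
    simp

/-- The permutation matrix exchanging `e_i` and `f_i`. -/
def swapMat (i : Fin n) : Matrix (Idx n) (Idx n) ℂ :=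
  Matrix.of fun a b => if a = (if idx b = i then b.swap else b) then 1 else 0

lemma swapMat_mulVec_stdVec (i : Fin n) (b : Idx n) :
    swapMat i *ᵥ stdVec n b = stdVec n (if idx b = i then b.swap else b) := by
  ext a
  simp [swapMat, Pi.single_apply]

lemma flipMat_mul_gam (i : Fin n) (v : V n) :
    flipMat n i * gam n v = -(gam n (swapMat i *ᵥ v) * flipMat n i) := by
  have h : v = ∑ a, v a • stdVec n a := by
    ext b
    simp [Finset.sum_apply, Pi.single_apply]
  rw [h, mulVec_sum, map_sum, map_sum, Finset.mul_sum, Finset.sum_mul, ← Finset.sum_neg_distrib]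
  refine Finset.sum_congr rfl fun a _ => ?_
  rw [mulVec_smul, map_smul, map_smul, mul_smul_comm, smul_mul_assoc, ← smul_neg,
    flipMat_mul_gam_stdVec, swapMat_mulVec_stdVec]

/-- The two signs from moving e_i - f_i past a vector cancel, and so do the two signs (-1)^n from
`spinTr`. -/
lemma SpinCovers.conj_flipMat (hA : SpinCovers A H) (i : Fin n) :
    SpinCovers (flipMat n i * A * (flipMat n i)ᵀ) (swapMat i * H * swapMat i) where
  mul_gam v := by
    rw [transpose_flipMat, mul_neg, neg_mul, mul_neg, mul_assoc, flipMat_mul_gam, mul_neg, neg_neg,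
      ← mul_assoc, mul_assoc _ A, hA.mul_gam, ← mul_assoc, flipMat_mul_gam, mulVec_mulVec,
      mulVec_mulVec, neg_mul, neg_mul]
    simp only [Matrix.mul_assoc]
  mul_spinTr := by
    have h1 : spinTr (flipMat n i) = (-1 : ℂ) ^ n • flipMat n i := spinTr_gam _
    have h2 : spinTr (flipMat n i)ᵀ = -((-1 : ℂ) ^ n • flipMat n i) := by
      rw [← h1, transpose_flipMat, spinTr, spinTr, transpose_neg, mul_neg, neg_mul]
    have h3 := mul_eq_one_comm.1 (flipMat_mul_transpose i)
    have h4 : (flipMat n i)ᵀ * spinTr (flipMat n i)ᵀ = (-1 : ℂ) ^ n • -1 := by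
      rw [h2, mul_neg, mul_smul_comm, h3, smul_neg]
    rw [spinTr_mul, spinTr_mul]
    calc _ = flipMat n i * A * ((flipMat n i)ᵀ * spinTr (flipMat n i)ᵀ) * spinTr A *
          spinTr (flipMat n i) := by simp only [Matrix.mul_assoc]
      _ = -(((-1 : ℂ) ^ n * (-1 : ℂ) ^ n) • (flipMat n i * (A * spinTr A) * flipMat n i)) := by
        rw [h4, h1, mul_smul_comm, mul_smul_comm, smul_mul_assoc, smul_mul_assoc, smul_smul, mul_neg,
          mul_one, neg_mul, neg_mul, smul_neg]
        simp only [Matrix.mul_assoc]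
      _ = 1 := by
        have h5 := flipMat_mul_transpose i
        rw [transpose_flipMat, mul_neg] at h5
        rw [hA.mul_spinTr, Matrix.mul_one, ← mul_pow, ← smul_neg, h5]
        norm_num

lemma flipMat_univ_apply (i : Fin n) (I : Finset (Fin n)) :
    flipMat n i Finset.univ I = if I = Finset.univ.erase i
      then ((spinSign i (Finset.univ.erase i) : ℤ) : ℂ) else 0 := by
  rw [flipMat, orthVec, map_sub, Matrix.sub_apply, gam_inl, gam_inr,
    if_neg (fun h : i ∉ Finset.univ ∧ _ => h.1 (Finset.mem_univ i)), sub_zero]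
  by_cases h : I = Finset.univ.erase i
  · subst h
    rw [if_pos ⟨Finset.notMem_erase _ _, (Finset.insert_erase (Finset.mem_univ i)).symm⟩, if_pos rfl]
  · rw [if_neg h, if_neg]
    rintro ⟨h1, h2⟩
    exact h (by rw [h2, Finset.erase_insert h1])

/-- Multiplication by e_i - f_i carries the top spinor to ± the one with e_i omitted. This transfers
`SpinCovers.sq_apply_univ` from v₊ to v₋, with e_i and f_i exchanged in H. -/
lemma SpinCovers.sq_apply_erase (hA : SpinCovers A H) (i : Fin n) :
    A (Finset.univ.erase i) (Finset.univ.erase i) ^ 2 =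
      ((swapMat i * H * swapMat i).submatrix (Sum.inl : Fin n → Idx n) Sum.inl).det := by
  rw [← (hA.conj_flipMat i).sq_apply_univ]
  have h : (flipMat n i * A * (flipMat n i)ᵀ) Finset.univ Finset.univ =
      A (Finset.univ.erase i) (Finset.univ.erase i) := by
    rw [Matrix.mul_apply, Finset.sum_eq_single (Finset.univ.erase i), Matrix.mul_apply,
      Finset.sum_eq_single (Finset.univ.erase i)]
    · rw [transpose_apply, flipMat_univ_apply, if_pos rfl, mul_right_comm, units_cast_mul_self,
        one_mul]
    · intro I _ hI
      rw [flipMat_univ_apply, if_neg hI, zero_mul]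
    · simp
    · intro I _ hI
      rw [transpose_apply, flipMat_univ_apply, if_neg hI, mul_zero]
    · simp
  rw [h]

end SpinSquare

/-! ### The half-spin metrics -/

section SpinMetric

variable {n : ℕ}

lemma flagIdx_true_castLE (hk : n ≤ n + n) (j : Fin n) :
    flagIdx n true (Fin.castLE hk j) = Sum.inl j := by
  rw [← Equiv.eq_symm_apply, Fin.ext_iff, flagIdx_symm_inl, if_neg (by simp)]
  rfl

lemma flagIdx_false_castLE {i : Fin n} (hi : i.1 + 1 = n) (hk : n ≤ n + n) (j : Fin n) :
    flagIdx n false (Fin.castLE hk j) = if j = i then Sum.inr j else Sum.inl j := by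
  split_ifs with h
  · subst h
    rw [← Equiv.eq_symm_apply, Fin.ext_iff, flagIdx_symm_inr, if_pos ⟨rfl, hi⟩]
    simp
    omega
  · have : j.1 ≠ i.1 := fun h' => h (Fin.ext h')
    rw [← Equiv.eq_symm_apply, Fin.ext_iff, flagIdx_symm_inl, if_neg (by omega)]
    rfl

lemma swapMat_mul_mul_swapMat_apply (i : Fin n) (H : Matrix (Idx n) (Idx n) ℂ) (a b : Idx n) :
    (swapMat i * H * swapMat i) a b =
      H (if idx a = i then a.swap else a) (if idx b = i then b.swap else b) := by
  have h1 (X : Matrix (Idx n) (Idx n) ℂ) (a b : Idx n) :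
      (X * swapMat i) a b = X a (if idx b = i then b.swap else b) := by
    rw [Matrix.mul_apply, Finset.sum_eq_single (if idx b = i then b.swap else b)]
    · simp [swapMat]
    · intro c _ hc
      simp [swapMat, hc]
    · simp
  have hinv (c : Idx n) : (if idx (if idx c = i then c.swap else c) = i then
      (if idx c = i then c.swap else c).swap else if idx c = i then c.swap else c) = c := by
    have hsw : idx c.swap = idx c := by rcases c with j | j <;> rfl
    by_cases h : idx c = i <;> simp [h, hsw]
  have h2 (X : Matrix (Idx n) (Idx n) ℂ) (a b : Idx n) :
      (swapMat i * X) a b = X (if idx a = i then a.swap else a) b := by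
    rw [Matrix.mul_apply, Finset.sum_eq_single (if idx a = i then a.swap else a)]
    · rw [swapMat, Matrix.of_apply, hinv, if_pos rfl, one_mul]
    · intro c _ hc
      rw [swapMat, Matrix.of_apply, if_neg, zero_mul]
      rintro rfl
      exact hc (hinv c).symm
    · simp
  rw [h1, h2]

/-- The Hermitian products of the lines of the half-spin representations are square roots of those of
the corresponding lines of `⋀ⁿ V`. -/
lemma hermInner_spin_sq (hn : 2 ≤ n) (ε : Bool) {s₀ s : spinGroup (quad n)} {g₀ g : SO n}
    (h₀ : Covers s₀ g₀) (h : Covers s g) :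
    hermInner (spinBasis n) (spinModule n s₀ (spinVec n ε)) (spinModule n s (spinVec n ε)) ^ 2 =
      hermInner (wedgeBasis n n)
        (wedgeAct g₀ fun j : Fin n => flagIdx n ε (Fin.castLE (Nat.le_add_left n n) j))
        (wedgeAct g fun j : Fin n => flagIdx n ε (Fin.castLE (Nat.le_add_left n n) j)) := by
  -- The diagonal entries of s₀ᴴ s are the Hermitian products sought, and this matrix is covariant
  -- over g₀ᴴ g.
  have hc := (h₀.spinCovers.conjTranspose (isOrthogonal_mat g₀)).mul h.spinCovers
  have e1 (I : Finset (Fin n)) : hermInner (spinBasis n) (spinModule n s₀ (spinBasis n I))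
      (spinModule n s (spinBasis n I)) = ((spinMat n s₀)ᴴ * spinMat n s) I I := by
    rw [Matrix.mul_apply, hermInner]
    refine Finset.sum_congr rfl fun J _ => ?_
    rw [conjTranspose_apply, spinMat_apply, spinMat_apply]
    rfl
  rw [hermInner_wedgeAct]
  cases ε with
  | true =>
    rw [spinVec, e1, hc.sq_apply_univ]
    simp only [flagIdx_true_castLE]
  | false =>
    let i : Fin n := ⟨n - 1, Nat.sub_one_lt_of_lt hn⟩
    have hi : i.1 + 1 = n := by simp only [i]; omega
    have h1 : (Finset.univ.filter fun j : Fin n => j.1 + 1 < n) = Finset.univ.erase i := by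
      ext j
      simp only [Finset.mem_filter, Finset.mem_univ, true_and, Finset.mem_erase, and_true, ne_eq,
        Fin.ext_iff]
      omega
    rw [spinVec, h1, e1, hc.sq_apply_erase]
    congr 1
    ext a b
    rw [submatrix_apply, submatrix_apply, swapMat_mul_mul_swapMat_apply,
      flagIdx_false_castLE hi, flagIdx_false_castLE hi]
    rfl

/-- The Fubini-Study potential of `π_±` is one half of that of the corresponding map to `ℙ(⋀ⁿ V)`, up
to a constant. -/
lemma exists_two_mul_fsPotential_spinOrbit (hn : 2 ≤ n) (ε : Bool) (hk : n ≤ n + n)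
    (hc : Function.Injective fun j : Fin n => flagIdx n ε (Fin.castLE hk j))
    (x₀ : SO n ⧸ borel n) : ∃ C : ℝ, ∀ x : SO n ⧸ borel n,
      hermInner (wedgeBasis n n) (wedgeOrbit n _ hc x₀).rep (wedgeOrbit n _ hc x).rep ≠ 0 →
      2 * fsPotential (spinBasis n) (spinOrbit n ε x₀) (spinOrbit n ε x) =
        fsPotential (wedgeBasis n n) (wedgeOrbit n _ hc x₀) (wedgeOrbit n _ hc x) + C := by
  have hS (x : SO n ⧸ borel n) : spinOrbit n ε x = Projectivization.mk ℂ
      (spinModule n (spinLift x.out) (spinVec n ε))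
      (fun h => spinVec_ne_zero n ε (spinModule_injective _ (h.trans (map_zero _).symm))) :=
    Projectivization.map_mk _ _ _ _
  have hW (x : SO n ⧸ borel n) : wedgeOrbit n _ hc x = Projectivization.mk ℂ
      (wedgeAct x.out fun j : Fin n => flagIdx n ε (Fin.castLE hk j)) (wedgeAct_ne_zero _ hc) :=
    wedgeOrbit_mk ε hk _ _ (QuotientGroup.out_eq' x)
  obtain ⟨a, ha⟩ := Projectivization.exists_smul_eq_mk_rep ℂ
    (spinModule n (spinLift x₀.out) (spinVec n ε))
    (fun h => spinVec_ne_zero n ε (spinModule_injective _ (h.trans (map_zero _).symm)))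
  obtain ⟨a', ha'⟩ := Projectivization.exists_smul_eq_mk_rep ℂ
    (wedgeAct x₀.out fun j : Fin n => flagIdx n ε (Fin.castLE hk j)) (wedgeAct_ne_zero _ hc)
  rw [← hS] at ha
  rw [← hW] at ha'
  -- The constant comes from the scalars a and a' relating the chosen representatives of the two
  -- base points to the actual vectors; the base points stay fixed while x moves.
  refine ⟨2 * Real.log ‖(a' : ℂ)‖ - 4 * Real.log ‖(a : ℂ)‖, fun x hx => ?_⟩
  obtain ⟨b, hb⟩ := Projectivization.exists_smul_eq_mk_rep ℂ
    (wedgeAct x.out fun j : Fin n => flagIdx n ε (Fin.castLE hk j)) (wedgeAct_ne_zero _ hc)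
  rw [← hW] at hb
  have hsq := hermInner_spin_sq hn ε (covers_spinLift x₀.out) (covers_spinLift x.out)
  have hsq' := hermInner_spin_sq hn ε (covers_spinLift x.out) (covers_spinLift x.out)
  have hσ := hermNormSq_pos (spinBasis n) (x := spinModule n (spinLift x.out) (spinVec n ε))
    (fun h => spinVec_ne_zero n ε (spinModule_injective _ (h.trans (map_zero _).symm)))
  rw [hermInner_self, hermInner_self] at hsq'
  have hN : hermNormSq (wedgeBasis n n)
      (wedgeAct x.out fun j : Fin n => flagIdx n ε (Fin.castLE hk j)) =
      hermNormSq (spinBasis n) (spinModule n (spinLift x.out) (spinVec n ε)) ^ 2 := by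
    exact_mod_cast hsq'.symm
  have hω : hermInner (wedgeBasis n n)
      (wedgeAct x₀.out fun j : Fin n => flagIdx n ε (Fin.castLE hk j))
      (wedgeAct x.out fun j : Fin n => flagIdx n ε (Fin.castLE hk j)) ≠ 0 := by
    rw [← ha', ← hb, Units.smul_def, Units.smul_def, hermInner_smul_left, hermInner_smul_right] at hx
    exact right_ne_zero_of_mul (right_ne_zero_of_mul hx)
  have hσω : hermInner (spinBasis n) (spinModule n (spinLift x₀.out) (spinVec n ε))
      (spinModule n (spinLift x.out) (spinVec n ε)) ≠ 0 := fun h0 => by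
    rw [h0] at hsq
    exact hω (hsq.symm.trans (by simp))
  have hlog := congrArg (fun c => Real.log ‖c‖) hsq
  simp only [norm_pow, Real.log_pow] at hlog
  have ha0 : (starRingEnd ℂ) (a : ℂ) ≠ 0 := (map_ne_zero _).2 a.ne_zero
  have ha0' : (starRingEnd ℂ) (a' : ℂ) ≠ 0 := (map_ne_zero _).2 a'.ne_zero
  rw [hS x, hW x, fsPotential_mk, fsPotential_mk, ← ha, ← ha', Units.smul_def, Units.smul_def,
    hermInner_smul_left, hermInner_smul_left, norm_mul, norm_mul, Real.log_mul, Real.log_mul, hN,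
    Real.log_pow, RCLike.norm_conj, RCLike.norm_conj, ← hlog]
  · push_cast
    ring
  · exact norm_ne_zero_iff.2 ha0'
  · exact norm_ne_zero_iff.2 hω
  · exact norm_ne_zero_iff.2 ha0
  · exact norm_ne_zero_iff.2 hσω
  · rw [← ha', Units.smul_def, hermInner_smul_left]
    exact mul_ne_zero ha0' hω
  · rw [← ha, Units.smul_def, hermInner_smul_left]
    exact mul_ne_zero ha0 hσω

variable {S : Type*} [TopologicalSpace S] [ChartedSpace ℂ S] {f : S → SO n ⧸ borel n} {U : Set S}
  {g : S → SO n} {e : OpenPartialHomeomorph S ℂ} {z : ℂ}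

/-- `(i_± f)^* φ̂_n = 2 φ_±`. -/
lemma flagMetric_eq_two_mul_spin (hn : 2 ≤ n) (hg : IsLift f U g)
    (he : e ∈ IsManifold.maximalAtlas 𝓘(ℂ, ℂ) ω S) (hz : z ∈ e.target) (hzU : e.symm z ∈ U)
    (ε : Bool) : flagMetric ε f e n (Nat.le_add_left n n) z =
      2 * fsPullback (spinBasis n) (fun p => spinOrbit n ε (f p)) e z := by
  have hk : n ≤ n + n := by omega
  have hc : Function.Injective fun j : Fin n => flagIdx n ε (Fin.castLE hk j) :=
    (flagIdx n ε).injective.comp (Fin.castLE_injective hk)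
  obtain ⟨C, hC⟩ := exists_two_mul_fsPotential_spinOrbit hn ε hk hc (f (e.symm z))
  set x₀ := wedgeOrbit n _ hc (f (e.symm z)) with hx₀
  have hF : ∀ᶠ w in 𝓝 z, wedgeOrbit n _ hc (f (e.symm w)) = Projectivization.mk ℂ
      (wedgeAct (g (e.symm w)) fun j : Fin n => flagIdx n ε (Fin.castLE hk j))
      (wedgeAct_ne_zero _ hc) := by
    filter_upwards [hg.eventually hz hzU] with w hw
    exact wedgeOrbit_mk ε hk _ _ (hg.lifts _ hw.2)
  have han := hg.analyticAt_hermInner_wedgeAct he hz hzU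
    (fun j : Fin n => flagIdx n ε (Fin.castLE hk j)) x₀.rep
  have h0 : hermInner (wedgeBasis n n) x₀.rep
      (wedgeAct (g (e.symm z)) fun j : Fin n => flagIdx n ε (Fin.castLE hk j)) ≠ 0 := by
    rw [hx₀, hF.self_of_nhds]
    exact hermInner_rep_mk_ne_zero _ _
  have hW : (fun w => fsPotential (wedgeBasis n n) x₀ (wedgeOrbit n _ hc (f (e.symm w)))) =ᶠ[𝓝 z]
      fun w => Real.log (gramDet (mat (g (e.symm w))) (flagSet n ε n)) - 2 * Real.log
        ‖hermInner (wedgeBasis n n) x₀.rep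
          (wedgeAct (g (e.symm w)) fun j : Fin n => flagIdx n ε (Fin.castLE hk j))‖ := by
    filter_upwards [hF, han.continuousAt.eventually_ne h0] with w hw hw'
    rw [hw, fsPotential_mk _ x₀ _ hw', hermNormSq_wedgeAct]
  have hcd : ContDiffAt ℝ 2 (fun w => fsPotential (wedgeBasis n n) x₀
      (wedgeOrbit n _ hc (f (e.symm w)))) z :=
    ((contDiffAt_log_gramDet (hg.analyticAt he hz hzU) (isUnit_det_mat _) _).sub
      (contDiffAt_const.mul (ddbar_log_norm han h0).1)).congr_of_eventuallyEq hW
  -- The chosen spin lifts need not depend continuously on w, so regularity of the spin potential is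
  -- deduced from that of the potential on ⋀ⁿ V.
  have hS : (fun w => fsPotential (spinBasis n) (spinOrbit n ε (f (e.symm z)))
      (spinOrbit n ε (f (e.symm w)))) =ᶠ[𝓝 z] fun w => (1 / 2 : ℝ) *
        (fsPotential (wedgeBasis n n) x₀ (wedgeOrbit n _ hc (f (e.symm w)))) + C / 2 := by
    filter_upwards [hF, han.continuousAt.eventually_ne h0] with w hw hw'
    have hne : hermInner (wedgeBasis n n) x₀.rep (wedgeOrbit n _ hc (f (e.symm w))).rep ≠ 0 := by
      obtain ⟨b, hb⟩ := Projectivization.exists_smul_eq_mk_rep ℂ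
        (wedgeAct (g (e.symm w)) fun j : Fin n => flagIdx n ε (Fin.castLE hk j))
        (wedgeAct_ne_zero _ hc)
      rw [hw, ← hb, Units.smul_def, hermInner_smul_right]
      exact mul_ne_zero b.ne_zero hw'
    linarith [hC _ hne]
  have h1 : fsPullback (spinBasis n) (fun p => spinOrbit n ε (f p)) e z =
      1 / 2 * flagMetric ε f e n hk z := by
    rw [fsPullback, ddbar_congr hS, ddbar_add (contDiffAt_const.mul hcd) contDiffAt_const,
      ddbar_const, add_zero, ddbar_const_mul _ hcd]
    rfl
  rw [h1]
  ring

end SpinMetric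

/-! ### The Plücker formulas -/

/-! ### Rows of the Cartan matrices. -/

section Sums

lemma sum_ite_val_eq_mul {m : ℕ} (Φ : Fin m → ℝ) (k : ℕ) :
    ∑ j : Fin m, (if j.1 = k then (1 : ℝ) else 0) * Φ j = if h : k < m then Φ ⟨k, h⟩ else 0 := by
  split_ifs with h
  · rw [Finset.sum_eq_single ⟨k, h⟩]
    · simp
    · intro j _ hj
      rw [if_neg (fun h' => hj (Fin.ext h')), zero_mul]
    · simp
  · refine Finset.sum_eq_zero fun j _ => ?_
    rw [if_neg (by omega), zero_mul]

lemma sum_ite_val_succ_eq_mul {m : ℕ} (Φ : Fin m → ℝ) (k : ℕ) (hk : k < m) :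
    ∑ j : Fin m, (if j.1 + 1 = k then (1 : ℝ) else 0) * Φ j =
      if h : k = 0 then 0 else Φ ⟨k - 1, by omega⟩ := by
  split_ifs with h
  · refine Finset.sum_eq_zero fun j _ => ?_
    rw [if_neg (by omega), zero_mul]
  · have h1 := sum_ite_val_eq_mul Φ (k - 1)
    rw [dif_pos (by omega)] at h1
    rw [← h1]
    refine Finset.sum_congr rfl fun j _ => ?_
    congr 1
    exact if_congr (by omega) rfl rfl

lemma sum_cartanMatrix_A {m : ℕ} (Φ : Fin m → ℝ) (k : Fin m) :
    ∑ j, (CartanMatrix.A m k j : ℝ) * Φ j =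
      2 * Φ k - (if h : k.1 = 0 then 0 else Φ ⟨k.1 - 1, by omega⟩) -
        if h : k.1 + 1 < m then Φ ⟨k.1 + 1, h⟩ else 0 := by
  rw [← sum_ite_val_eq_mul, ← sum_ite_val_succ_eq_mul Φ k.1 k.2]
  have h := sum_ite_val_eq_mul Φ k.1
  rw [dif_pos k.2] at h
  rw [← h, Finset.mul_sum, ← Finset.sum_sub_distrib, ← Finset.sum_sub_distrib]
  refine Finset.sum_congr rfl fun j _ => ?_
  rw [← mul_assoc, ← sub_mul, ← sub_mul]
  congr 1
  simp only [CartanMatrix.A, Matrix.of_apply, Fin.ext_iff]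
  split_ifs <;> first | omega | norm_num

variable {n : ℕ} (Φ : Fin n → ℝ)

/-- The node i = n-3 (counting from 0) is the branch point: it is joined to both end nodes n-2 and
n-1. -/
lemma sum_cartanMatrix_D_of_lt {i : Fin n} (hi : i.1 + 2 < n) :
    ∑ j, (CartanMatrix.D n i j : ℝ) * Φ j =
      2 * Φ i - (if h : i.1 = 0 then 0 else Φ ⟨i.1 - 1, by omega⟩) -
        (if i.1 + 3 = n then Φ ⟨n - 2, by omega⟩ + Φ ⟨n - 1, by omega⟩
          else Φ ⟨i.1 + 1, by omega⟩) := by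
  have h := sum_ite_val_eq_mul Φ i.1
  rw [dif_pos i.2] at h
  have h1 := sum_ite_val_eq_mul Φ (i.1 + 1)
  rw [dif_pos (by omega)] at h1
  have h2 := sum_ite_val_eq_mul Φ (n - 1)
  rw [dif_pos (by omega)] at h2
  have h3 : (if i.1 + 3 = n then Φ ⟨n - 2, by omega⟩ + Φ ⟨n - 1, by omega⟩
      else Φ ⟨i.1 + 1, by omega⟩) =
      Φ ⟨i.1 + 1, by omega⟩ + (if i.1 + 3 = n then 1 else 0) * Φ ⟨n - 1, by omega⟩ := by
    split_ifs with h3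
    · have : n - 2 = i.1 + 1 := by omega
      simp only [this, one_mul]
    · simp
  rw [h3, ← h, ← h1, ← h2, ← sum_ite_val_succ_eq_mul Φ i.1 i.2, Finset.mul_sum, Finset.mul_sum,
    ← Finset.sum_add_distrib, ← Finset.sum_sub_distrib, ← Finset.sum_sub_distrib]
  refine Finset.sum_congr rfl fun j _ => ?_
  rw [← mul_assoc, ← mul_assoc, ← add_mul, ← sub_mul, ← sub_mul]
  congr 1
  simp only [CartanMatrix.D, Matrix.of_apply, Fin.ext_iff]
  split_ifs <;> first | omega | norm_num

/-- Both end nodes are joined to n-3 only, and to nothing when n = 2. -/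
lemma sum_cartanMatrix_D_of_le {i : Fin n} (hn : 2 ≤ n) (hi : n ≤ i.1 + 2) :
    ∑ j, (CartanMatrix.D n i j : ℝ) * Φ j =
      2 * Φ i - (if h : n = 2 then 0 else Φ ⟨n - 3, by omega⟩) := by
  have h := sum_ite_val_eq_mul Φ i.1
  rw [dif_pos i.2] at h
  have h2 : (if h : n = 2 then 0 else Φ ⟨n - 3, by omega⟩) =
      ∑ j : Fin n, (if j.1 + 3 = n then (1 : ℝ) else 0) * Φ j := by
    split_ifs with h2
    · refine (Finset.sum_eq_zero fun j _ => ?_).symm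
      rw [if_neg (by omega), zero_mul]
    · have h1 := sum_ite_val_eq_mul Φ (n - 3)
      rw [dif_pos (by omega)] at h1
      rw [← h1]
      refine Finset.sum_congr rfl fun j _ => ?_
      congr 1
      exact if_congr (by omega) rfl rfl
  rw [h2, ← h, Finset.mul_sum, ← Finset.sum_sub_distrib]
  refine Finset.sum_congr rfl fun j _ => ?_
  rw [← mul_assoc, ← sub_mul]
  congr 1
  simp only [CartanMatrix.D, Matrix.of_apply, Fin.ext_iff]
  split_ifs <;> first | omega | norm_num

end Sums

/-! ### The formulas for the metrics φ_i and their curvatures. -/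

section Formulas

variable {n : ℕ} {S : Type*} [TopologicalSpace S]
  {f : S → SO n ⧸ borel n} {U : Set S} {g : S → SO n} {e : OpenPartialHomeomorph S ℂ} {z : ℂ}

lemma wedgeOrbit_congr {k : ℕ} {c c' : Fin k → Idx n} (h : c = c') (hc : Function.Injective c)
    (hc' : Function.Injective c') : wedgeOrbit n c hc = wedgeOrbit n c' hc' := by
  subst h
  rfl

lemma metric_of_lt (ε : Bool) {i : Fin n} (hi : i.1 + 2 < n) :
    metric f e i = flagMetric ε f e (i.1 + 1) (by omega) := by
  have hk : i.1 + 1 ≤ n + n := by omega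
  have h : (fun j : Fin (i.1 + 1) => (Sum.inl (Fin.castLE i.2 j) : Idx n)) =
      fun j : Fin (i.1 + 1) => flagIdx n ε (Fin.castLE hk j) := by
    funext j
    exact (flagIdx_of_lt ε (k := j.1) (by omega)).symm
  rw [metric, if_pos hi, flagMetric, wedgeOrbit_congr h]

lemma flagMetric_congr (ε : Bool) {k k' : ℕ} (h : k = k') (hk : k ≤ n + n) (hk' : k' ≤ n + n) :
    flagMetric ε f e k hk z = flagMetric ε f e k' hk' z := by
  subst h
  rfl

variable [ChartedSpace ℂ S]

lemma flagMetric_eq_two_mul_metric (hn : 2 ≤ n) (hg : IsLift f U g)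
    (he : e ∈ IsManifold.maximalAtlas 𝓘(ℂ, ℂ) ω S) (hz : z ∈ e.target) (hzU : e.symm z ∈ U)
    (ε : Bool) {i : Fin n} (hi : i.1 = if ε then n - 1 else n - 2) :
    flagMetric ε f e n (Nat.le_add_left n n) z = 2 * metric f e i z := by
  rw [flagMetric_eq_two_mul_spin hn hg he hz hzU]
  cases ε with
  | true =>
    simp only [if_true] at hi
    rw [metric, if_neg (by omega), if_neg (by omega)]
  | false =>
    simp only [Bool.false_eq_true, if_false] at hi
    rw [metric, if_neg (by omega), if_pos (by omega)]

lemma flagMetric_zero (hg : IsLift f U g) (he : e ∈ IsManifold.maximalAtlas 𝓘(ℂ, ℂ) ω S)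
    (hz : z ∈ e.target) (hzU : e.symm z ∈ U) (ε : Bool) :
    flagMetric ε f e 0 (Nat.zero_le _) z = 0 := by
  rw [flagMetric_eq hg he hz hzU]
  have h (M : Matrix (Idx n) (Idx n) ℂ) : gramDet M (flagSet n ε 0) = 1 := by
    rw [flagSet_zero, gramDet, principalMinor, det_isEmpty, Complex.one_re]
  simp only [h, ddbar_const]

/-- The full Gram determinant is |det g|² = 1. Together with the trivial level 0 this supplies the
boundary terms of the type A formulas. -/
lemma flagMetric_top (hg : IsLift f U g) (he : e ∈ IsManifold.maximalAtlas 𝓘(ℂ, ℂ) ω S)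
    (hz : z ∈ e.target) (hzU : e.symm z ∈ U) (ε : Bool) :
    flagMetric ε f e (n + n) le_rfl z = 0 := by
  rw [flagMetric_eq hg he hz hzU]
  have h (g : SO n) : gramDet (mat g) (flagSet n ε (n + n)) = 1 := by
    rw [gramDet, principalMinor_flagSet _ _ le_rfl]
    have h1 := det_submatrix_equiv_self (flagIdx n ε) ((mat g)ᴴ * mat g)
    rw [det_mul, det_conjTranspose, det_mat, star_one, one_mul] at h1
    exact (congrArg Complex.re h1).trans Complex.one_re
  simp only [h, ddbar_const]

lemma flagMetric_eq_of_lt_rank (hg : IsLift f U g)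
    (he : e ∈ IsManifold.maximalAtlas 𝓘(ℂ, ℂ) ω S) (hz : z ∈ e.target) (hzU : e.symm z ∈ U)
    (ε ε' : Bool) {k : ℕ} (hk : k < n) :
    flagMetric ε f e k (by omega) z = flagMetric ε' f e k (by omega) z := by
  rw [flagMetric_eq hg he hz hzU, flagMetric_eq hg he hz hzU, flagSet_eq_of_lt hk ε ε']

lemma flagMetric_pred_eq_add (hn : 2 ≤ n) (hg : IsLift f U g)
    (he : e ∈ IsManifold.maximalAtlas 𝓘(ℂ, ℂ) ω S) (hz : z ∈ e.target) (hzU : e.symm z ∈ U)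
    (ε : Bool) (h₁ : n - 1 ≤ n + n) (h₂ : n - 1 < n) (h₃ : n - 2 < n) :
    flagMetric ε f e (n - 1) h₁ z = metric f e ⟨n - 1, h₂⟩ z + metric f e ⟨n - 2, h₃⟩ z := by
  have h := flagMetric_pred hg he hz hzU ε (k := n - 1) (by omega)
  rw [flagMetric_eq_two_mul_metric hn hg he hz hzU true (i := ⟨n - 1, h₂⟩) rfl,
    flagMetric_eq_two_mul_metric hn hg he hz hzU false (i := ⟨n - 2, h₃⟩) rfl] at h
  linarith

lemma curvature_of_lt (hN : IsIntegralCurve f) (hg : IsLift f U g)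
    (he : e ∈ IsManifold.maximalAtlas 𝓘(ℂ, ℂ) ω S) (hz : z ∈ e.target) (hzU : e.symm z ∈ U)
    (ε : Bool) {i : Fin n} (hi : i.1 + 2 < n) (h0 : metric f e i z ≠ 0) :
    curvature f e i z = 2 * flagMetric ε f e (i.1 + 1) (by omega) z -
      flagMetric ε f e i.1 (by omega) z - flagMetric ε f e (i.1 + 2) (by omega) z := by
  rw [metric_of_lt ε hi] at h0
  rw [curvature, metric_of_lt ε hi]
  exact curvatureCoeff_flagMetric_of_lt hN hg he hz hzU ε hi h0

/-- The sign ε' selects the Lagrangian flag adapted to the metric i. The sign ε is free, because the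
two flags agree below dimension n. -/
lemma curvature_of_le (hn : 2 ≤ n) (hN : IsIntegralCurve f) (hg : IsLift f U g)
    (he : e ∈ IsManifold.maximalAtlas 𝓘(ℂ, ℂ) ω S) (hz : z ∈ e.target) (hzU : e.symm z ∈ U)
    (ε : Bool) {i : Fin n} (hi : n ≤ i.1 + 2) (h0 : metric f e i z ≠ 0) (hk : n - 2 ≤ n + n) :
    curvature f e i z = 2 * metric f e i z - flagMetric ε f e (n - 2) hk z := by
  obtain ⟨ε', hε'⟩ : ∃ ε' : Bool, i.1 = if ε' then n - 1 else n - 2 := by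
    by_cases h : i.1 = n - 1
    · exact ⟨true, h⟩
    · exact ⟨false, by simp; omega⟩
  have hu : ∀ᶠ w in 𝓝 z, flagMetric ε' f e n (Nat.le_add_left n n) w = 2 * metric f e i w := by
    filter_upwards [hg.eventually hz hzU] with w hw
    exact flagMetric_eq_two_mul_metric hn hg he hw.1 hw.2 ε' hε'
  rw [curvature, curvatureCoeff_flagMetric_of_lagrangian hN hg he hz hzU ε' (k := n - 2) (by omega) hu h0,
    hu.self_of_nhds, flagMetric_eq_of_lt_rank hg he hz hzU ε' ε (by omega)]

lemma curvature_eq_sum (hn : 2 ≤ n) (hN : IsIntegralCurve f) (hg : IsLift f U g)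
    (he : e ∈ IsManifold.maximalAtlas 𝓘(ℂ, ℂ) ω S) (hz : z ∈ e.target) (hzU : e.symm z ∈ U)
    (i : Fin n) (h0 : metric f e i z ≠ 0) :
    curvature f e i z = ∑ j : Fin n, (CartanMatrix.D n i j : ℝ) * metric f e j z := by
  by_cases hi : i.1 + 2 < n
  · rw [curvature_of_lt hN hg he hz hzU true hi h0,
      sum_cartanMatrix_D_of_lt (fun j => metric f e j z) hi, metric_of_lt true hi]
    congr 1
    · congr 1
      split_ifs with h
      · simp only [h]
        exact flagMetric_zero hg he hz hzU true
      · rw [metric_of_lt true (by simp only; omega)]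
        exact flagMetric_congr true (by simp only; omega) _ _
    · split_ifs with h
      · have := flagMetric_pred_eq_add hn hg he hz hzU true (by omega) (by omega) (by omega)
        exact (flagMetric_congr true (by omega) _ (by omega)).trans (this.trans (add_comm _ _))
      · rw [metric_of_lt true (by simp only; omega)]
  · rw [curvature_of_le hn hN hg he hz hzU true (not_lt.1 hi) h0 (by omega),
      sum_cartanMatrix_D_of_le (fun j => metric f e j z) hn (not_lt.1 hi)]
    congr 1
    split_ifs with h
    · subst h
      exact flagMetric_zero hg he hz hzU true
    · rw [metric_of_lt true (by simp only; omega)]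
      exact flagMetric_congr true (by simp only; omega) _ _

lemma flagCurvature_eq_sum (hg : IsLift f U g)
    (he : e ∈ IsManifold.maximalAtlas 𝓘(ℂ, ℂ) ω S) (hz : z ∈ e.target) (hzU : e.symm z ∈ U)
    (ε : Bool) (hm : ∀ j : Fin (2 * n - 1), j.1 + 1 ≤ n + n) (k : Fin (2 * n - 1))
    (hk1 : 1 ≤ k.1 + 1) (hk : k.1 + 1 < n + n) :
    flagCurvature ε g e (k.1 + 1) hk1 hk z =
      ∑ j : Fin (2 * n - 1), (CartanMatrix.A (2 * n - 1) k j : ℝ) *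
        flagMetric ε f e (j.1 + 1) (hm j) z := by
  rw [flagCurvature_eq hg he hz hzU,
    sum_cartanMatrix_A (fun j : Fin (2 * n - 1) => flagMetric ε f e (j.1 + 1) (hm j) z) k]
  congr 1
  · congr 1
    split_ifs with h
    · simp only [h]
      exact flagMetric_zero hg he hz hzU ε
    · exact flagMetric_congr ε (by simp only; omega) _ _
  · split_ifs with h
    · rfl
    · rw [← flagMetric_top hg he hz hzU ε]
      exact flagMetric_congr ε (by omega) _ _

end Formulas

end SOPlucker

end

/-! ### The local Plücker formulas. -/

open SOPlucker in
theorem mainTheorem1 (n : ℕ) (hn : 2 ≤ n)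
    {S : Type*} [TopologicalSpace S] [ChartedSpace ℂ S] [IsManifold 𝓘(ℂ, ℂ) ω S]
    (f : S → SO n ⧸ borel n) (hf : IsHolomorphicCurve f) (hN : IsIntegralCurve f)
    (e : OpenPartialHomeomorph S ℂ) (he : e ∈ IsManifold.maximalAtlas 𝓘(ℂ, ℂ) ω S)
    (z : ℂ) (hz : z ∈ e.target) :
    -- the local Plücker formulas: `θ = A φ`, with `A` the Cartan matrix of type `D_n`
    (∀ i : Fin n, metric f e i z ≠ 0 →
      curvature f e i z = ∑ j : Fin n, (CartanMatrix.D n i j : ℝ) * metric f e j z) ∧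
    -- they are obtained from the pullbacks of the formulas of type `A_{2n-1}` by `i_± ∘ f`
    (∀ (ε : Bool) (U : Set S) (g : S → SO n), IsLift f U g → e.symm z ∈ U →
      (∀ k : Fin (2 * n - 1),
        flagCurvature ε g e (k.1 + 1) (by omega) (by omega) z =
          ∑ j : Fin (2 * n - 1), (CartanMatrix.A (2 * n - 1) k j : ℝ) *
            flagMetric ε f e (j.1 + 1) (by omega) z) ∧
      (∀ i : Fin n, i.1 + 2 < n → metric f e i z ≠ 0 →
        curvature f e i z = flagCurvature ε g e (i.1 + 1) (by omega) (by omega) z) ∧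
      (∀ i : Fin n, i.1 = (if ε then n - 2 else n - 1) → metric f e i z ≠ 0 →
        curvature f e i z = flagCurvature ε g e (n - 1) (by omega) (by omega) z)) ∧
    (∀ ε : Bool,
      (∀ i : Fin n, i.1 + 2 < n →
        flagMetric ε f e (i.1 + 1) (by omega) z = metric f e i z) ∧
      flagMetric ε f e (n - 1) (by omega) z =
        metric f e ⟨n - 1, by omega⟩ z + metric f e ⟨n - 2, by omega⟩ z ∧
      (∀ i : Fin n, i.1 = (if ε then n - 1 else n - 2) →
        flagMetric ε f e n (by omega) z = 2 * metric f e i z)) := by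
  obtain ⟨U, hzU, g, hg⟩ := hf (e.symm z)
  refine ⟨fun i => curvature_eq_sum hn hN hg he hz hzU i, fun ε U g hg hzU => ⟨?_, ?_, ?_⟩,
    fun ε => ⟨?_, ?_, ?_⟩⟩
  · exact fun k => flagCurvature_eq_sum hg he hz hzU ε _ k _ _
  · intro i hi h0
    rw [curvature_of_lt hN hg he hz hzU ε hi h0, flagCurvature_eq hg he hz hzU]
    rfl
  · intro i hi h0
    have hle : n ≤ i.1 + 2 := by cases ε <;> simp at hi <;> omega
    -- The signs cross: ϑ̂_{n-1} = 2(φ₊ + φ₋) - φ̂_{n-2} - 2φ_± = 2φ_∓ - φ̂_{n-2}, which is θ_∓.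
    have h1 := flagCurvature_eq hg he hz hzU ε (k := n - 1) (by omega) (by omega)
    rw [flagMetric_pred_eq_add hn hg he hz hzU _ _ (by omega) (by omega),
      flagMetric_congr ε (show n - 1 - 1 = n - 2 by omega) _ (by omega),
      flagMetric_congr ε (show n - 1 + 1 = n by omega) _ (by omega)] at h1
    rw [curvature_of_le hn hN hg he hz hzU ε hle h0 (by omega), h1]
    cases ε with
    | true =>
      rw [flagMetric_eq_two_mul_metric hn hg he hz hzU true (i := ⟨n - 1, by omega⟩) rfl,
        show i = ⟨n - 2, by omega⟩ from Fin.ext hi]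
      ring
    | false =>
      rw [flagMetric_eq_two_mul_metric hn hg he hz hzU false (i := ⟨n - 2, by omega⟩) rfl,
        show i = ⟨n - 1, by omega⟩ from Fin.ext hi]
      ring
  · intro i hi
    rw [metric_of_lt ε hi]
  · exact flagMetric_pred_eq_add hn hg he hz hzU ε _ _ _
  · intro i hi
    exact flagMetric_eq_two_mul_metric hn hg he hz hzU ε hi
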